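/- Let $\alpha\in\mathbb R$ and let $\omega(\xi,\mu)=\xi^5-\alpha\xi^3+\mu^2/\xi$ be the dispersive function of the fifth order KP-I equation. Let $\eta:\mathbb R\to\mathbb R$ be a smooth function with support in $[-2,2]$ and $\eta=1$ on $(-1,1)$. Put $\eta_0=\eta$ and $\eta_j(x)=\eta(2^{-j}x)-\eta(2^{1-j}x)$ for integers $j\ge 1$. For $f\in L^2(\mathbb R^3)$ (complex-valued, in the variables $(x,y,t)$ with dual variables $(\xi,\mu,\tau)$) and $j\ge 0$ let $f_j\in L^2(\mathbb R^3)$ be the inverse Fourier transform $$f_j=\big(\eta_j(\tau-\omega(\xi,\mu))\,|\hat f(\xi,\mu,\tau)|\big)^\vee .$$ For $s\ge 0$ let $|-i\partial_x|^s f_j$ be the tempered distribution on $\mathbb R^3$ whose Fourier transform is $|\xi|^s\widehat{f_j}$, and for $T>0$ let $$\|g\|_{L^q_TL^r(\mathbb R^2)}=\Big\|\,\|g(\cdot,\cdot,t)\|_{L^r(\mathbb R^2)}\Big\|_{L^q([-T,T],\,dt)} .$$ Then for every $r\in[2,\infty)$ there is a constant $C>0$, independent of $T$, $j$ and $f$,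 such that for all $T\in(0,1)$, all integers $j\ge 0$ and all $f\in L^2(\mathbb R^3)$ the distribution $|-i\partial_x|^{\frac12-\frac1r}f_j$ is on $\mathbb R^2\times(-T,T)$ a locally integrable function, and $$\big\||-i\partial_x|^{\frac12-\frac1r}f_j\big\|_{L^{2r/(r-2)}_TL^r(\mathbb R^2)}\le C\,2^{j/2}\,\|f_j\|_{L^2(\mathbb R^3)},$$ where $2r/(r-2)=\infty$ for $r=2$. In particular, there is a constant $C>0$, independent of $T$, $j$ and $f$, such that for all such $T$, $j$, $f$ $$\big\||-i\partial_x|^{\frac14}f_j\big\|_{L^4_TL^4(\mathbb R^2)}\le C\,2^{j/2}\,\|f_j\|_{L^2(\mathbb R^3)} .$$ -/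

import Mathlib

open MeasureTheory Set SchwartzMap FourierTransform
open scoped ENNReal ContDiff

noncomputable section

namespace KP

/-- `ℝ³` with its Euclidean structure. In physical space the coordinates `0, 1, 2` are `x, y, t`;
in frequency space they are `ξ, μ, τ`. -/
abbrev E3 : Type := EuclideanSpace ℝ (Fin 3)

/-- The space `L²(ℝ³)` of complex-valued functions. -/
abbrev L2 : Type := Lp ℂ 2 (volume : Measure E3)

/-- The dispersive function `ω(ξ, μ) = ξ⁵ - α ξ³ + μ² / ξ` of the fifth order KP-I equation
(the value on the null set `ξ = 0` is irrelevant). -/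
def omega (α ξ μ : ℝ) : ℝ := ξ ^ 5 - α * ξ ^ 3 + μ ^ 2 / ξ

/-- A smooth bump function supported in `[-2, 2]` and equal to `1` on `(-1, 1)`. -/
structure IsBump (η : ℝ → ℝ) : Prop where
  contDiff : ContDiff ℝ ∞ η
  tsupport_subset : tsupport η ⊆ Icc (-2) 2
  eq_one : ∀ x ∈ Ioo (-1 : ℝ) 1, η x = 1

/-- The dyadic cut-offs: `η₀ = η` and `η_j(x) = η(2^{-j} x) - η(2^{1-j} x)` for `j ≥ 1`. -/
def dyadicCutoff (η : ℝ → ℝ) : ℕ → ℝ → ℝ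
  | 0, x => η x
  | j + 1, x => η (x / 2 ^ (j + 1)) - η (x / 2 ^ j)

/-- The symbol `η_j(τ - ω(ξ, μ))`, as a function of the angular frequencies `(ξ, μ, τ)`. -/
def modulationCutoff (α : ℝ) (η : ℝ → ℝ) (j : ℕ) (ξ μ τ : ℝ) : ℝ :=
  dyadicCutoff η j (τ - omega α ξ μ)

/-- The function `η_j(τ - ω(ξ, μ)) |f̂|(ξ, μ, τ)`.
Mathlib's Fourier transform has the kernel `exp(-2πi⟨x, ζ⟩)`, so its variable `ζ` corresponds to the
angular frequency `(ξ, μ, τ) = 2πζ` of the kernel `exp(-i(xξ + yμ + tτ))`. -/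
def pieceFourier (α : ℝ) (η : ℝ → ℝ) (j : ℕ) (f : L2) (ζ : E3) : ℂ :=
  (modulationCutoff α η j (2 * Real.pi * ζ 0) (2 * Real.pi * ζ 1) (2 * Real.pi * ζ 2) : ℂ) *
    (‖(𝓕 f : L2) ζ‖ : ℂ)

theorem IsBump.exists_bound {η : ℝ → ℝ} (hη : IsBump η) : ∃ M : ℝ, ∀ x, ‖η x‖ ≤ M :=
  hη.contDiff.continuous.bounded_above_of_compact_support
    (IsCompact.of_isClosed_subset isCompact_Icc (isClosed_tsupport η) hη.tsupport_subset)

theorem IsBump.exists_bound_dyadicCutoff {η : ℝ → ℝ} (hη : IsBump η) (j : ℕ) :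
    ∃ M : ℝ, ∀ x, ‖dyadicCutoff η j x‖ ≤ M := by
  obtain ⟨M, hM⟩ := hη.exists_bound
  cases j with
  | zero => exact ⟨M, hM⟩
  | succ j => exact ⟨M + M, fun x => (norm_sub_le _ _).trans (add_le_add (hM _) (hM _))⟩

theorem IsBump.measurable_dyadicCutoff {η : ℝ → ℝ} (hη : IsBump η) (j : ℕ) :
    Measurable (dyadicCutoff η j) := by
  have h := hη.contDiff.continuous.measurable
  cases j with
  | zero => exact h
  | succ j =>
    exact (h.comp (measurable_id.div_const _)).sub (h.comp (measurable_id.div_const _))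

theorem IsBump.memLp_pieceFourier {η : ℝ → ℝ} (hη : IsBump η) (α : ℝ) (j : ℕ)
    (f : L2) : MemLp (pieceFourier α η j f) 2 volume := by
  obtain ⟨M, hM⟩ := hη.exists_bound_dyadicCutoff j
  have hm := hη.measurable_dyadicCutoff j
  refine MemLp.of_le_mul (c := M) (Lp.memLp (𝓕 f : L2)) ?_ ?_
  · refine AEStronglyMeasurable.mul ?_ ?_
    · refine (Complex.measurable_ofReal.comp (hm.comp ?_)).aestronglyMeasurable
      unfold omega
      fun_prop
    · exact Complex.continuous_ofReal.comp_aestronglyMeasurable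
        (Lp.aestronglyMeasurable (𝓕 f : L2)).norm
  · refine Filter.Eventually.of_forall fun ζ => ?_
    unfold pieceFourier
    rw [norm_mul, Complex.norm_real, Complex.norm_real, norm_norm]
    exact mul_le_mul_of_nonneg_right (hM _) (norm_nonneg _)

/-- `f_j = (η_j(τ - ω(ξ, μ)) |f̂|)^∨ ∈ L²(ℝ³)`, through the Fourier transform on `L²`. -/
def dyadicPiece (α : ℝ) {η : ℝ → ℝ} (hη : IsBump η) (j : ℕ) (f : L2) :
    L2 :=
  𝓕⁻ ((hη.memLp_pieceFourier α j f).toLp (pieceFourier α η j f) : L2)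

/-- The open space-time slab `ℝ² × (-T, T)`. -/
def slab (T : ℝ) : Set E3 := {p | p 2 ∈ Ioo (-T) T}

/-- For `u ∈ L²(ℝ³)` and `s ≥ 0`, the tempered distribution `|-i∂ₓ|^s u` is the inverse Fourier
transform of the function `|ξ|^s û`, that is
`⟨|-i∂ₓ|^s u, φ⟩ = ∫ |ξ|^s û 𝓕⁻φ` (with `ξ = 2π ζ₀`). This predicate says that on the slab
`ℝ² × (-T, T)` this distribution is the locally integrable function `g`. -/
def IsAbsDxPow (s T : ℝ) (u : L2) (g : E3 → ℂ) : Prop :=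
  LocallyIntegrableOn g (slab T) volume ∧
  ∀ φ : 𝓢(E3, ℂ), HasCompactSupport φ → tsupport φ ⊆ slab T →
    ∫ p, g p * φ p =
      ∫ ζ : E3, ((|2 * Real.pi * ζ 0| ^ s : ℝ) : ℂ) * (𝓕 u : L2) ζ *
        (𝓕⁻ φ : 𝓢(E3, ℂ)) ζ

/-- The mixed norm `‖g‖_{L^q_T L^r(ℝ²)}`: the `L^r` norm in `(x, y) ∈ ℝ²`, then the `L^q` norm in
`t ∈ [-T, T]`. -/
def mixedNorm (q r : ℝ≥0∞) (T : ℝ) (g : E3 → ℂ) : ℝ≥0∞ :=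
  eLpNorm (fun t : ℝ => eLpNorm (fun z : ℝ × ℝ => g !₂[z.1, z.2, t]) r volume) q
    (volume.restrict (Icc (-T) T))

/-- The time exponent `2r / (r - 2)`, which is `∞` for `r = 2`. -/
def timeExponent (r : ℝ) : ℝ≥0∞ := ENNReal.ofReal (2 * r) / ENNReal.ofReal (r - 2)

end KP

end

noncomputable section

namespace KP

/-! The estimate is a Strichartz estimate for the group `e^{itω(D)}`, transferred to functions whose
Fourier transform lives in a neighbourhood of the characteristic surface `τ = ω(ξ, μ)`. Only the
support of the cut-off and the `L²` norm of `f_j` matter; the modulus taken on `f̂` plays no role.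

Dispersion: the kernel of `|D_x|^{1+iγ} e^{itω(D)}` is `O((1+|γ|)/|t|)` for `0 < |t| ≤ 2`. The phase
is quadratic in `μ`, so the `μ`-integral is Gaussian and produces `(|ξ|/|t|)^{1/2}`. What remains is
an integral of `ξ^{3/2+iγ}` against a phase whose second derivative has size `|t| ξ³` at high
frequency, and this amplitude is exactly what the second derivative test turns into `|t|^{-1/2}`.
Low frequencies, where `α` and `γ` may spoil the convexity, are bounded trivially
(`exists_norm_kernel_le`, `exists_norm_dispersive_kernel_le`).

Interpolating analytically between this `L¹ → L^∞` bound and the `L²` bound gives, with `θ = 1 -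
2/r` and `ρ = 2/(1+θ) = r'`, that `|D_x|^θ e^{itω(D)}` maps `L^ρ` to `L^r` with norm `O(|t|^{-θ})`
(`exists_fixed_time_estimate`). Since `θ < 1`, the `TT*` identity and the Hardy–Littlewood–Sobolev
inequality in time give the dual statement: the Fourier transform of a test function `F`, weighted
by `|ξ|^{θ/2}`, has its `L²` norm on the surface bounded by the norm of `F` in `L^{2/(2-θ)}_t L^ρ`.
A translate of the surface in `τ` only adds a unimodular factor, so integration over translates of
size at most `L` yields the factor `L` in `exists_tube_estimate`. With `L = 2^{j+1}`, a square root
gives `2^{j/2}`.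

Finally this is dualised. `RestrictionBound.exists_function` realises `|D_x|^{θ/2} f_j` as a
function on the slab, and its mixed norm is recovered from its pairings with test functions. The
exponent dual to `2/(2-θ)` is `2/θ = 2r/(r-2)`. -/

/-! ### One-dimensional oscillatory integrals. -/

/-- The total variation of `arctan (R / κ)` is at most `π`. -/
theorem integral_deriv_div_sq_add_sq_le {a b κ : ℝ} (hab : a ≤ b) (hκ : 0 < κ) {R R' : ℝ → ℝ}
    (hR : ∀ x ∈ Icc a b, HasDerivAt R (R' x) x) (hR' : ContinuousOn R' (Icc a b)) :
    ∫ x in a..b, R' x / (κ ^ 2 + R x ^ 2) ≤ Real.pi / κ := by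
  have hpos : ∀ x, 0 < κ ^ 2 + R x ^ 2 := fun x => by positivity
  have hRc : ContinuousOn R (Icc a b) := fun x hx => (hR x hx).continuousAt.continuousWithinAt
  have h := intervalIntegral.integral_eq_sub_of_hasDerivAt
    (f := fun x => Real.arctan (R x / κ) / κ)
    (f' := fun x => R' x / (κ ^ 2 + R x ^ 2)) (a := a) (b := b) ?_ ?_
  · rw [h, ← sub_div]
    gcongr
    linarith [Real.arctan_lt_pi_div_two (R b / κ), Real.neg_pi_div_two_lt_arctan (R a / κ)]
  · intro x hx
    rw [uIcc_of_le hab] at hx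
    refine ((hR x hx).div_const κ).arctan.div_const κ |>.congr_deriv ?_
    have := (hpos x).ne'
    field_simp
  · apply ContinuousOn.intervalIntegrable
    rw [uIcc_of_le hab]
    exact hR'.div (continuousOn_const.add (hRc.pow 2)) fun x _ => ne_of_gt (hpos x)

/-- An oscillatory integral estimate that contains both the first and the second derivative test of
van der Corput: `P' = Q W'` and the weight is `A W'` with an amplitude `A` of variation at most 1. -/
theorem norm_oscillatory_le {a b κ B₁ B₂ : ℝ} (hab : a ≤ b) (hκ : 0 < κ)
    {A A' W' P Q Q' : ℝ → ℝ}
    (hA : ∀ x ∈ Icc a b, HasDerivAt A (A' x) x) (hA' : ContinuousOn A' (Icc a b))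
    (hA01 : ∀ x ∈ Icc a b, |A x| ≤ 1)
    (hQ : ∀ x ∈ Icc a b, HasDerivAt Q (Q' x) x) (hQ' : ContinuousOn Q' (Icc a b))
    (hW' : ContinuousOn W' (Icc a b))
    (hP : ∀ x ∈ Icc a b, HasDerivAt P (Q x * W' x) x)
    (hAi : ∫ x in a..b, |A' x| ≤ 1)
    (hB₁ : ∫ x in a..b, |Q' x| / (κ ^ 2 + Q x ^ 2) ≤ B₁)
    (hB₂ : ∫ x in a..b, κ ^ 2 * |W' x| / (κ ^ 2 + Q x ^ 2) ≤ B₂) :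
    ‖∫ x in a..b, (A x * W' x : ℂ) * Complex.exp (Complex.I * P x)‖ ≤
      3 / (2 * κ) + B₁ + B₂ := by
  have hpos : ∀ x, 0 < κ ^ 2 + Q x ^ 2 := fun x => by positivity
  have hposC : ∀ x, ((κ : ℂ) ^ 2 + (Q x : ℂ) ^ 2) ≠ 0 := fun x => by
    exact_mod_cast (hpos x).ne'
  have hQc : ContinuousOn Q (Icc a b) := fun x hx => (hQ x hx).continuousAt.continuousWithinAt
  have hAc : ContinuousOn A (Icc a b) := fun x hx => (hA x hx).continuousAt.continuousWithinAt
  have hPc : ContinuousOn P (Icc a b) := fun x hx => (hP x hx).continuousAt.continuousWithinAt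
  have hm : ∀ x, |Q x / (κ ^ 2 + Q x ^ 2)| ≤ 1 / (2 * κ) := fun x => by
    rw [abs_div, abs_of_pos (hpos x), div_le_div_iff₀ (hpos x) (by positivity)]
    nlinarith [sq_nonneg (κ - |Q x|), sq_abs (Q x)]
  have hmd : ∀ x, |(κ ^ 2 - Q x ^ 2) / (κ ^ 2 + Q x ^ 2) ^ 2| ≤ 1 / (κ ^ 2 + Q x ^ 2) := fun x => by
    have h1 : |κ ^ 2 - Q x ^ 2| ≤ κ ^ 2 + Q x ^ 2 := by
      rw [abs_le]; constructor <;> nlinarith [sq_nonneg κ, sq_nonneg (Q x)]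
    rw [abs_div, abs_of_pos (pow_pos (hpos x) 2), div_le_div_iff₀ (pow_pos (hpos x) 2) (hpos x)]
    nlinarith [hpos x]
  have hexp : ∀ x, ‖Complex.exp (Complex.I * P x)‖ = 1 := fun x => by
    rw [mul_comm]; exact Complex.norm_exp_ofReal_mul_I _
  -- Integration by parts with `1/Q` regularised to `m = Q/(κ² + Q²)`: since `Q m = 1 - κ²/(κ² +
  -- Q²)`, nothing blows up at stationary points and the defect is the term `D`. The two boundary
  -- values and the variation of `A` each cost `1/(2κ)`; the variation of `m` costs `B₁` and `D`
  -- costs `B₂`.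
  set m : ℝ → ℝ := fun x => Q x / (κ ^ 2 + Q x ^ 2) with hmdef
  set m' : ℝ → ℝ := fun x => (κ ^ 2 - Q x ^ 2) / (κ ^ 2 + Q x ^ 2) ^ 2 * Q' x with hm'def
  have hmder : ∀ x ∈ Icc a b, HasDerivAt m (m' x) x := by
    intro x hx
    have h2 := (hQ x hx).div (((hQ x hx).pow 2).const_add (κ ^ 2)) (hpos x).ne'
    refine h2.congr_deriv ?_
    simp only [hm'def, Pi.pow_apply]
    have := (hpos x).ne'
    field_simp
    push_cast
    ring
  set Ψ : ℝ → ℂ := fun x => ((A x * m x : ℝ) : ℂ) * (-Complex.I * Complex.exp (Complex.I * P x))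
    with hΨ
  set E : ℝ → ℂ := fun x => ((A' x * m x + A x * m' x : ℝ) : ℂ) *
    (-Complex.I * Complex.exp (Complex.I * P x)) with hE
  set D : ℝ → ℂ := fun x => ((A x * (κ ^ 2 * W' x / (κ ^ 2 + Q x ^ 2)) : ℝ) : ℂ) *
    Complex.exp (Complex.I * P x) with hD
  have hΨder : ∀ x ∈ Icc a b, HasDerivAt Ψ
      ((A x * W' x : ℂ) * Complex.exp (Complex.I * P x) + E x - D x) x := by
    intro x hx
    have h1 := ((hA x hx).mul (hmder x hx)).ofReal_comp
    have h2 := (((hP x hx).ofReal_comp.const_mul Complex.I).cexp).const_mul (-Complex.I)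
    refine (h1.mul h2).congr_deriv ?_
    simp only [hE, hD, hmdef, Pi.mul_apply]
    push_cast
    have := hposC x
    have h4 : (Q x : ℂ) / ((κ : ℂ) ^ 2 + (Q x : ℂ) ^ 2) * Q x =
      1 - κ ^ 2 / ((κ : ℂ) ^ 2 + (Q x : ℂ) ^ 2) := by
      field_simp
      ring
    have hI : Complex.I * Complex.I = -1 := Complex.I_mul_I
    linear_combination ((A x : ℂ) * W' x * Complex.exp (Complex.I * P x)) * h4 -
      ((A x : ℂ) * (Q x / ((κ : ℂ) ^ 2 + (Q x : ℂ) ^ 2)) * Complex.exp (Complex.I * P x) * Q x *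
        W' x) * hI
  have hexpc : ContinuousOn (fun x => Complex.exp (Complex.I * P x)) (Icc a b) := by
    apply ContinuousOn.cexp
    exact continuousOn_const.mul (Complex.continuous_ofReal.comp_continuousOn hPc)
  have hden : ContinuousOn (fun x => κ ^ 2 + Q x ^ 2) (Icc a b) :=
    continuousOn_const.add (hQc.pow 2)
  have hmc : ContinuousOn m (Icc a b) := hQc.div hden fun x _ => (hpos x).ne'
  have hm'c : ContinuousOn m' (Icc a b) := by
    refine ContinuousOn.mul (ContinuousOn.div ?_ (hden.pow 2) fun x _ => (pow_pos (hpos x) 2).ne') hQ'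
    exact continuousOn_const.sub (hQc.pow 2)
  have hEc : ContinuousOn E (Icc a b) := by
    refine ContinuousOn.mul (Complex.continuous_ofReal.comp_continuousOn ?_)
      (continuousOn_const.mul hexpc)
    exact (hA'.mul hmc).add (hAc.mul hm'c)
  have hDc : ContinuousOn D (Icc a b) := by
    refine ContinuousOn.mul (Complex.continuous_ofReal.comp_continuousOn ?_) hexpc
    exact hAc.mul ((continuousOn_const.mul hW').div hden fun x _ => (hpos x).ne')
  have hMc : ContinuousOn (fun x => (A x * W' x : ℂ) * Complex.exp (Complex.I * P x)) (Icc a b) :=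
    ((Complex.continuous_ofReal.comp_continuousOn hAc).mul
      (Complex.continuous_ofReal.comp_continuousOn hW')).mul hexpc
  have hii : ∀ {f : ℝ → ℂ}, ContinuousOn f (Icc a b) → IntervalIntegrable f volume a b :=
    fun hf => ContinuousOn.intervalIntegrable (by rwa [uIcc_of_le hab])
  have hiiR : ∀ {f : ℝ → ℝ}, ContinuousOn f (Icc a b) → IntervalIntegrable f volume a b :=
    fun hf => ContinuousOn.intervalIntegrable (by rwa [uIcc_of_le hab])
  have hFTC := intervalIntegral.integral_eq_sub_of_hasDerivAt (a := a) (b := b)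
    (fun x hx => hΨder x (by rwa [uIcc_of_le hab] at hx)) (((hii hMc).add (hii hEc)).sub (hii hDc))
  rw [intervalIntegral.integral_sub ((hii hMc).add (hii hEc)) (hii hDc),
    intervalIntegral.integral_add (hii hMc) (hii hEc)] at hFTC
  have hkey : ∫ x in a..b, (A x * W' x : ℂ) * Complex.exp (Complex.I * P x) =
      Ψ b - Ψ a - (∫ x in a..b, E x) + ∫ x in a..b, D x := by
    rw [← hFTC]; ring
  have hΨb : ∀ x ∈ Icc a b, ‖Ψ x‖ ≤ 1 / (2 * κ) := fun x hx => by
    simp only [hΨ, norm_mul, norm_neg, Complex.norm_I, hexp, Complex.norm_real, Real.norm_eq_abs,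
      mul_one]
    calc |A x| * |m x| ≤ 1 * (1 / (2 * κ)) :=
          mul_le_mul (hA01 x hx) (hm x) (abs_nonneg _) zero_le_one
      _ = _ := one_mul _
  have hinv : ContinuousOn (fun x => |Q' x| / (κ ^ 2 + Q x ^ 2)) (Icc a b) :=
    hQ'.abs.div hden fun x _ => (hpos x).ne'
  have hAm : IntervalIntegrable (fun x => |A' x| * (1 / (2 * κ))) volume a b :=
    hiiR (hA'.abs.mul continuousOn_const)
  have hEb : ‖∫ x in a..b, E x‖ ≤ 1 / (2 * κ) + B₁ := by
    calc ‖∫ x in a..b, E x‖ ≤ ∫ x in a..b, (|A' x| * (1 / (2 * κ)) + |Q' x| / (κ ^ 2 + Q x ^ 2)) := by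
          refine intervalIntegral.norm_integral_le_of_norm_le hab
            (Filter.Eventually.of_forall fun x hx => ?_) (hAm.add (hiiR hinv))
          have hx' : x ∈ Icc a b := Ioc_subset_Icc_self hx
          simp only [hE, norm_mul, norm_neg, Complex.norm_I, hexp, Complex.norm_real,
            Real.norm_eq_abs, mul_one]
          refine (abs_add_le _ _).trans ?_
          rw [abs_mul, abs_mul]
          refine add_le_add (mul_le_mul_of_nonneg_left (hm x) (abs_nonneg _)) ?_
          calc |A x| * |m' x| ≤ 1 * |m' x| :=
                mul_le_mul_of_nonneg_right (hA01 x hx') (abs_nonneg _)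
            _ = |(κ ^ 2 - Q x ^ 2) / (κ ^ 2 + Q x ^ 2) ^ 2| * |Q' x| := by
                rw [one_mul, hm'def, abs_mul]
            _ ≤ 1 / (κ ^ 2 + Q x ^ 2) * |Q' x| :=
                mul_le_mul_of_nonneg_right (hmd x) (abs_nonneg _)
            _ = _ := by ring
      _ = (∫ x in a..b, |A' x|) * (1 / (2 * κ)) + ∫ x in a..b, |Q' x| / (κ ^ 2 + Q x ^ 2) := by
          rw [intervalIntegral.integral_add hAm (hiiR hinv),
            intervalIntegral.integral_mul_const]
      _ ≤ 1 * (1 / (2 * κ)) + B₁ := by gcongr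
      _ = _ := by rw [one_mul]
  have hDb : ‖∫ x in a..b, D x‖ ≤ B₂ := by
    refine le_trans (intervalIntegral.norm_integral_le_of_norm_le hab
      (Filter.Eventually.of_forall fun x hx => ?_) (hiiR ?_)) hB₂
    · have hx' : x ∈ Icc a b := Ioc_subset_Icc_self hx
      simp only [hD, norm_mul, hexp, Complex.norm_real, Real.norm_eq_abs, mul_one]
      rw [abs_div, abs_mul, abs_of_pos (hpos x), abs_of_pos (pow_pos hκ 2)]
      exact mul_le_of_le_one_left (div_nonneg (by positivity) (hpos x).le) (hA01 x hx')
    · exact (continuousOn_const.mul hW'.abs).div hden fun x _ => (hpos x).ne'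
  rw [hkey]
  calc ‖Ψ b - Ψ a - (∫ x in a..b, E x) + ∫ x in a..b, D x‖
      ≤ ‖Ψ b‖ + ‖Ψ a‖ + ‖∫ x in a..b, E x‖ + ‖∫ x in a..b, D x‖ := by
        refine (norm_add_le _ _).trans (add_le_add_left ?_ _)
        refine (norm_sub_le _ _).trans (add_le_add_left ?_ _)
        exact norm_sub_le _ _
    _ ≤ 1 / (2 * κ) + 1 / (2 * κ) + (1 / (2 * κ) + B₁) + B₂ := by
        gcongr
        · exact hΨb b ⟨hab, le_rfl⟩
        · exact hΨb a ⟨le_rfl, hab⟩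
    _ = _ := by ring

/-! ### Decay of the dispersive kernel. -/

/-- The phase of the dispersive kernel in the variable `v = ξ^{1/2}`. -/
def kernelPhase (α t X γ v : ℝ) : ℝ :=
  X * v ^ 2 + t * (v ^ 10 - α * v ^ 6) + 2 * γ * Real.log v

/-- Comparison with the arctangent integral of a monotone minorant `R` of `|Q|`. It allows `Q`
itself to be non-monotone, which happens when `X > 0`. -/
theorem abs_integral_le_of_deriv {a b κ : ℝ} (hab : a ≤ b) (hκ : 0 < κ) {f Q R R' : ℝ → ℝ}
    (hf : ContinuousOn f (Icc a b)) (hQ : ContinuousOn Q (Icc a b))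
    (hR : ∀ x ∈ Icc a b, HasDerivAt R (R' x) x) (hR' : ContinuousOn R' (Icc a b))
    (hfR : ∀ x ∈ Icc a b, f x ≤ R' x) (hR0 : ∀ x ∈ Icc a b, 0 ≤ R' x)
    (hQR : ∀ x ∈ Icc a b, |R x| ≤ |Q x|) :
    ∫ x in a..b, f x / (κ ^ 2 + Q x ^ 2) ≤ Real.pi / κ := by
  have hRc : ContinuousOn R (Icc a b) := fun x hx => (hR x hx).continuousAt.continuousWithinAt
  refine le_trans ?_ (integral_deriv_div_sq_add_sq_le hab hκ hR hR')
  refine intervalIntegral.integral_mono_on hab ?_ ?_ fun x hx => ?_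
  · apply ContinuousOn.intervalIntegrable
    rw [uIcc_of_le hab]
    exact hf.div (continuousOn_const.add (hQ.pow 2)) fun x _ => by positivity
  · apply ContinuousOn.intervalIntegrable
    rw [uIcc_of_le hab]
    exact hR'.div (continuousOn_const.add (hRc.pow 2)) fun x _ => by positivity
  · exact div_le_div₀ (hR0 x hx) (hfR x hx) (by positivity)
      (add_le_add_right (sq_le_sq.mpr (hQR x hx)) _)

/-- On `v ≥ a` the terms in `α` and `γ` are dominated by the quintic one, so `norm_oscillatory_le`
applies with `κ = √t`. The Gaussian factor is a decreasing amplitude bounded by 1, hence the bound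
does not depend on `c`; nor does it depend on `X`. -/
theorem norm_kernel_tail_le {α t X γ c a b : ℝ} (ht : 0 < t) (hc : 0 ≤ c) (ha : 0 < a)
    (hab : a ≤ b) (hα : 3 * |α| ≤ a ^ 4) (hγ : |γ| ≤ t * a ^ 10) :
    ‖∫ v in a..b, ((Real.exp (-c * v ^ 2) : ℝ) * (2 * v ^ 4 : ℝ) : ℂ) *
      Complex.exp (Complex.I * kernelPhase α t X γ v)‖ ≤ 20 / Real.sqrt t := by
  set κ := Real.sqrt t with hκd
  have hκ : 0 < κ := Real.sqrt_pos.mpr ht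
  have hκ2 : κ ^ 2 = t := Real.sq_sqrt ht.le
  have hv0 : ∀ v ∈ Icc a b, 0 < v := fun v hv => ha.trans_le hv.1
  have hvα : ∀ v ∈ Icc a b, 3 * |α| ≤ v ^ 4 := fun v hv =>
    hα.trans (pow_le_pow_left₀ ha.le hv.1 4)
  have hvγ : ∀ v ∈ Icc a b, |γ| ≤ t * v ^ 10 := fun v hv =>
    hγ.trans (mul_le_mul_of_nonneg_left (pow_le_pow_left₀ ha.le hv.1 10) ht.le)
  -- The derivative of the phase divided by the weight `2v⁴`.
  set Q : ℝ → ℝ := fun v => X / v ^ 3 + t * (5 * v ^ 5 - 3 * α * v) + γ / v ^ 5 with hQ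
  set Q' : ℝ → ℝ := fun v => -(3 * X / v ^ 4) + t * (25 * v ^ 4 - 3 * α) - 5 * γ / v ^ 6 with hQ'
  have hinvder : ∀ (Y : ℝ) (n : ℕ) (v : ℝ), 0 < v →
      HasDerivAt (fun v : ℝ => Y / v ^ (n + 1)) (-((n + 1 : ℕ) * Y / v ^ (n + 2))) v := by
    intro Y n v hv
    have h := ((hasDerivAt_pow (n + 1) v).inv (pow_pos hv _).ne').const_mul Y
    refine h.congr_deriv ?_
    have := hv.ne'
    simp only [Nat.add_sub_cancel]
    field_simp
    ring
  have hQder : ∀ v ∈ Icc a b, HasDerivAt Q (Q' v) v := by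
    intro v hv
    have h1 := hinvder X 2 v (hv0 v hv)
    have h2 := hinvder γ 4 v (hv0 v hv)
    have h3 := (((hasDerivAt_pow 5 v).const_mul 5).sub
      ((hasDerivAt_id v).const_mul (3 * α))).const_mul t
    refine ((h1.add h3).add h2).congr_deriv ?_
    simp only [hQ']
    push_cast
    ring
  have hQ'c : ContinuousOn Q' (Icc a b) := by
    have hne : ∀ n : ℕ, ∀ v ∈ Icc a b, v ^ n ≠ 0 := fun n v hv => (pow_pos (hv0 v hv) n).ne'
    refine ContinuousOn.sub (ContinuousOn.add (ContinuousOn.neg (ContinuousOn.div (by fun_prop)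
      (by fun_prop) (hne 4))) (by fun_prop)) (ContinuousOn.div (by fun_prop) (by fun_prop) (hne 6))
  have hQc : ContinuousOn Q (Icc a b) := fun x hx => (hQder x hx).continuousAt.continuousWithinAt
  have hAder : ∀ v, HasDerivAt (fun v : ℝ => Real.exp (-c * v ^ 2))
      (-(2 * c * v * Real.exp (-c * v ^ 2))) v := by
    intro v
    refine ((hasDerivAt_pow 2 v).const_mul (-c)).exp.congr_deriv ?_
    push_cast
    ring
  have hA'c : Continuous fun v : ℝ => -(2 * c * v * Real.exp (-c * v ^ 2)) := by fun_prop
  have hAi : ∫ v in a..b, |-(2 * c * v * Real.exp (-c * v ^ 2))| ≤ 1 := by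
    have h1 : ∫ v in a..b, |-(2 * c * v * Real.exp (-c * v ^ 2))| =
        -∫ v in a..b, -(2 * c * v * Real.exp (-c * v ^ 2)) := by
      rw [← intervalIntegral.integral_neg]
      refine intervalIntegral.integral_congr fun v hv => ?_
      rw [uIcc_of_le hab] at hv
      have := hv0 v hv
      simp only [abs_neg, neg_neg]
      exact abs_of_nonneg (by positivity)
    rw [h1, intervalIntegral.integral_eq_sub_of_hasDerivAt (fun v _ => hAder v)
      (hA'c.intervalIntegrable _ _)]
    have h2 : Real.exp (-c * a ^ 2) ≤ 1 := Real.exp_le_one_iff.mpr (by nlinarith [sq_nonneg a])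
    linarith [Real.exp_pos (-c * b ^ 2)]
  have hlow : ∀ v ∈ Icc a b, 19 * t * v ^ 4 ≤ t * (25 * v ^ 4 - 3 * α) - 5 * γ / v ^ 6 ∧
      t * (25 * v ^ 4 - 3 * α) - 5 * γ / v ^ 6 ≤ 31 * t * v ^ 4 := by
    intro v hv
    have hv' := hv0 v hv
    have h1 : |γ / v ^ 6| ≤ t * v ^ 4 := by
      rw [abs_div, abs_of_pos (pow_pos hv' 6), div_le_iff₀ (pow_pos hv' 6)]
      calc |γ| ≤ t * v ^ 10 := hvγ v hv
        _ = _ := by ring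
    have h2 : |t * (3 * α)| ≤ t * v ^ 4 := by
      rw [abs_mul, abs_of_pos ht, abs_mul, abs_of_pos (by norm_num : (0:ℝ) < 3)]
      exact mul_le_mul_of_nonneg_left (hvα v hv) ht.le
    rw [abs_le] at h1 h2
    have h3 : 5 * γ / v ^ 6 = 5 * (γ / v ^ 6) := by ring
    rw [h3]
    constructor <;> nlinarith
  have hW'abs : ∀ v ∈ Icc a b, κ ^ 2 * |2 * v ^ 4| = 2 * t * v ^ 4 := by
    intro v hv
    have := hv0 v hv
    rw [hκ2, abs_of_pos (by positivity)]
    ring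
  have hmain : (∫ v in a..b, |Q' v| / (κ ^ 2 + Q v ^ 2) ≤ 4 * (Real.pi / κ)) ∧
      ∫ v in a..b, κ ^ 2 * |2 * v ^ 4| / (κ ^ 2 + Q v ^ 2) ≤ Real.pi / κ := by
    have hpi : 0 < Real.pi / κ := by positivity
    -- For `X ≤ 0` the term `X/v³` is increasing like the rest, so `Q` is monotone. For `X ≥ 0`
    -- monotonicity may fail, but `Q` is then bounded below by the sum of the nonnegative functions
    -- `X/v³` and `3tv⁵`; each is monotone and serves as a minorant for its own share of `|Q'|`.
    rcases le_total X 0 with hX | hX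
    · have hQ'pos : ∀ v ∈ Icc a b, 19 * t * v ^ 4 ≤ Q' v := by
        intro v hv
        have hv' := hv0 v hv
        have : 0 ≤ -(3 * X / v ^ 4) := by
          rw [← neg_div]; exact div_nonneg (by linarith) (by positivity)
        have := (hlow v hv).1
        simp only [hQ']
        linarith
      have hQ'0 : ∀ v ∈ Icc a b, 0 ≤ Q' v := fun v hv =>
        le_trans (by have := hv0 v hv; positivity) (hQ'pos v hv)
      constructor
      · refine (abs_integral_le_of_deriv hab hκ hQ'c.abs hQc hQder hQ'c
          (fun v hv => (abs_of_nonneg (hQ'0 v hv)).le) hQ'0 fun v _ => le_rfl).trans ?_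
        linarith
      · refine abs_integral_le_of_deriv hab hκ (by fun_prop) hQc hQder hQ'c
          (fun v hv => ?_) hQ'0 fun v _ => le_rfl
        rw [hW'abs v hv]
        have := hv0 v hv
        have : 0 < t * v ^ 4 := by positivity
        linarith [hQ'pos v hv]
    · have hQlow : ∀ v ∈ Icc a b, X / v ^ 3 + 3 * t * v ^ 5 ≤ Q v := by
        intro v hv
        have hv' := hv0 v hv
        have h1 : |γ / v ^ 5| ≤ t * v ^ 5 := by
          rw [abs_div, abs_of_pos (pow_pos hv' 5), div_le_iff₀ (pow_pos hv' 5)]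
          calc |γ| ≤ t * v ^ 10 := hvγ v hv
            _ = _ := by ring
        have h2 : t * (3 * α * v) ≤ t * v ^ 5 := by
          refine mul_le_mul_of_nonneg_left ?_ ht.le
          calc 3 * α * v ≤ 3 * |α| * v := by gcongr; exact le_abs_self α
            _ ≤ v ^ 4 * v := by gcongr; exact hvα v hv
            _ = _ := by ring
        rw [abs_le] at h1
        simp only [hQ]
        nlinarith
      have hR1 : ∀ v ∈ Icc a b, HasDerivAt (fun v : ℝ => 3 * t * v ^ 5) (15 * t * v ^ 4) v := by
        intro v hv
        refine ((hasDerivAt_pow 5 v).const_mul (3 * t)).congr_deriv ?_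
        push_cast
        ring
      have hR2 : ∀ v ∈ Icc a b, HasDerivAt (fun v : ℝ => -(X / v ^ 3)) (3 * X / v ^ 4) v := by
        intro v hv
        refine (hinvder X 2 v (hv0 v hv)).neg.congr_deriv ?_
        push_cast
        ring
      have hR2c : ContinuousOn (fun v : ℝ => 3 * X / v ^ 4) (Icc a b) :=
        ContinuousOn.div (by fun_prop) (by fun_prop) fun v hv => (pow_pos (hv0 v hv) 4).ne'
      have hQR1 : ∀ v ∈ Icc a b, |3 * t * v ^ 5| ≤ |Q v| := by
        intro v hv
        have hv' := hv0 v hv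
        have h3 : 0 ≤ X / v ^ 3 := by positivity
        rw [abs_of_nonneg (by positivity)]
        exact le_trans (by linarith [hQlow v hv]) (le_abs_self _)
      have hQR2 : ∀ v ∈ Icc a b, |-(X / v ^ 3)| ≤ |Q v| := by
        intro v hv
        have hv' := hv0 v hv
        have h3 : 0 ≤ 3 * t * v ^ 5 := by positivity
        rw [abs_neg, abs_of_nonneg (by positivity)]
        exact le_trans (by linarith [hQlow v hv]) (le_abs_self _)
      have hi1 := abs_integral_le_of_deriv hab hκ (f := fun v => 15 * t * v ^ 4) (by fun_prop) hQc
        hR1 (by fun_prop) (fun v _ => le_rfl) (fun v hv => by positivity) hQR1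
      have hi2 := abs_integral_le_of_deriv hab hκ (f := fun v => 3 * X / v ^ 4) hR2c hQc
        hR2 hR2c (fun v _ => le_rfl) (fun v hv => by positivity) hQR2
      have hii : ∀ {f : ℝ → ℝ}, ContinuousOn f (Icc a b) →
          IntervalIntegrable (fun v => f v / (κ ^ 2 + Q v ^ 2)) volume a b := fun hf =>
        ContinuousOn.intervalIntegrable (by
          rw [uIcc_of_le hab]
          exact hf.div (continuousOn_const.add (hQc.pow 2)) fun x _ => by positivity)
      constructor
      -- The part of `|Q'|` not coming from `X` is at most `31tv⁴`, hence below three times `15tv⁴ =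
      -- (3tv⁵)'`.
      · have h15 : ContinuousOn (fun v : ℝ => 15 * t * v ^ 4) (Icc a b) := by fun_prop
        calc ∫ v in a..b, |Q' v| / (κ ^ 2 + Q v ^ 2)
            ≤ ∫ v in a..b, ((3 * X / v ^ 4) / (κ ^ 2 + Q v ^ 2) +
                3 * ((15 * t * v ^ 4) / (κ ^ 2 + Q v ^ 2))) := by
              refine intervalIntegral.integral_mono_on hab (hii hQ'c.abs)
                ((hii hR2c).add ((hii h15).const_mul 3)) fun v hv => ?_
              have hv' := hv0 v hv
              rw [mul_div_assoc', ← add_div]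
              gcongr
              have h1 := hlow v hv
              have h2 : 0 ≤ 3 * X / v ^ 4 := by positivity
              have h3 : 0 < t * v ^ 4 := by positivity
              simp only [hQ']
              rw [abs_le]
              constructor <;> linarith
          _ = (∫ v in a..b, (3 * X / v ^ 4) / (κ ^ 2 + Q v ^ 2)) +
                3 * ∫ v in a..b, (15 * t * v ^ 4) / (κ ^ 2 + Q v ^ 2) := by
              rw [intervalIntegral.integral_add (hii hR2c) ((hii h15).const_mul 3),
                intervalIntegral.integral_const_mul]
          _ ≤ Real.pi / κ + 3 * (Real.pi / κ) := by gcongr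
          _ = _ := by ring
      · refine abs_integral_le_of_deriv hab hκ (by fun_prop) hQc hR1 (by fun_prop)
          (fun v hv => ?_) (fun v hv => by positivity) hQR1
        rw [hW'abs v hv]
        have := hv0 v hv
        have : 0 < t * v ^ 4 := by positivity
        linarith
  have hPder : ∀ v ∈ Icc a b, HasDerivAt (kernelPhase α t X γ) (Q v * (2 * v ^ 4)) v := by
    intro v hv
    have hv' := (hv0 v hv).ne'
    have h := (((hasDerivAt_pow 2 v).const_mul X).add
      (((hasDerivAt_pow 10 v).sub ((hasDerivAt_pow 6 v).const_mul α)).const_mul t)).add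
      ((Real.hasDerivAt_log hv').const_mul (2 * γ))
    refine h.congr_deriv ?_
    simp only [hQ]
    push_cast
    field_simp
    ring
  have := norm_oscillatory_le (A := fun v => Real.exp (-c * v ^ 2)) (W' := fun v => 2 * v ^ 4)
    hab hκ (fun v _ => hAder v) hA'c.continuousOn (fun v hv => ?_) hQder hQ'c (by fun_prop)
    hPder hAi hmain.1 hmain.2
  · refine this.trans ?_
    have h4 : 3 / (2 * κ) + 4 * (Real.pi / κ) + Real.pi / κ = (3 / 2 + 5 * Real.pi) / κ := by
      field_simp
      ring
    rw [h4]
    gcongr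
    linarith [Real.pi_lt_d2]
  · rw [abs_of_pos (Real.exp_pos _)]
    exact Real.exp_le_one_iff.mpr (by nlinarith [sq_nonneg v])

theorem kernelPhase_neg (α t X γ v : ℝ) :
    kernelPhase α (-t) (-X) (-γ) v = -kernelPhase α t X γ v := by
  simp only [kernelPhase]; ring

/-- Negative times reduce to positive ones by complex conjugation, which flips the signs of `t`, `X`
and `γ` together. -/
theorem norm_kernel_tail_le_of_ne {α t X γ c a b : ℝ} (ht : t ≠ 0) (hc : 0 ≤ c) (ha : 0 < a)
    (hab : a ≤ b) (hα : 3 * |α| ≤ a ^ 4) (hγ : |γ| ≤ |t| * a ^ 10) :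
    ‖∫ v in a..b, ((Real.exp (-c * v ^ 2) : ℝ) * (2 * v ^ 4 : ℝ) : ℂ) *
      Complex.exp (Complex.I * kernelPhase α t X γ v)‖ ≤ 20 / Real.sqrt |t| := by
  rcases lt_or_gt_of_ne ht with h | h
  · have h1 := norm_kernel_tail_le (X := -X) (γ := -γ) (neg_pos.mpr h) hc ha hab hα
      (by rwa [abs_neg, ← abs_of_neg h])
    rw [abs_of_neg h]
    refine le_of_eq_of_le ?_ h1
    rw [← RCLike.norm_conj (∫ v in a..b, _)]
    congr 1
    rw [intervalIntegral.integral_of_le hab, intervalIntegral.integral_of_le hab, ← integral_conj]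
    refine integral_congr_ae (Filter.Eventually.of_forall fun v => ?_)
    simp only [map_mul, Complex.conj_ofReal, ← Complex.exp_conj, Complex.conj_I, kernelPhase_neg]
    push_cast
    ring_nf
  · rw [abs_of_pos h] at hγ ⊢
    exact norm_kernel_tail_le h hc ha hab hα hγ

theorem continuousOn_kernel (α t X γ c : ℝ) :
    ContinuousOn (fun v : ℝ => ((Real.exp (-c * v ^ 2) : ℝ) * (2 * v ^ 4 : ℝ) : ℂ) *
      Complex.exp (Complex.I * kernelPhase α t X γ v)) (Ioi 0) := by
  have h : ContinuousOn (kernelPhase α t X γ) (Ioi 0) := by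
    unfold kernelPhase
    refine ContinuousOn.add (by fun_prop) (continuousOn_const.mul ?_)
    exact Real.continuousOn_log.mono fun v hv => (mem_Ioi.mp hv).ne'
  refine ContinuousOn.mul (by fun_prop) (ContinuousOn.cexp (continuousOn_const.mul ?_))
  exact Complex.continuous_ofReal.comp_continuousOn h

theorem norm_kernel_integrand_le {α t X γ c : ℝ} (hc : 0 ≤ c) (v : ℝ) :
    ‖((Real.exp (-c * v ^ 2) : ℝ) * (2 * v ^ 4 : ℝ) : ℂ) *
      Complex.exp (Complex.I * kernelPhase α t X γ v)‖ ≤ 2 * v ^ 4 := by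
  have hexp : ‖Complex.exp (Complex.I * kernelPhase α t X γ v)‖ = 1 := by
    rw [mul_comm]; exact Complex.norm_exp_ofReal_mul_I _
  rw [norm_mul, norm_mul, hexp, mul_one, Complex.norm_real, Complex.norm_real, Real.norm_eq_abs,
    Real.norm_eq_abs, abs_of_pos (Real.exp_pos _), abs_of_nonneg (by positivity)]
  exact mul_le_of_le_one_left (by positivity) (Real.exp_le_one_iff.mpr (by nlinarith [sq_nonneg v]))

theorem integrableOn_kernel {α t X γ c : ℝ} (hc : 0 ≤ c) (b : ℝ) :
    IntegrableOn (fun v : ℝ => ((Real.exp (-c * v ^ 2) : ℝ) * (2 * v ^ 4 : ℝ) : ℂ) *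
      Complex.exp (Complex.I * kernelPhase α t X γ v)) (Ioc 0 b) := by
  refine Integrable.mono' (g := fun v : ℝ => 2 * v ^ 4) ?_ ?_
    (Filter.Eventually.of_forall fun v => norm_kernel_integrand_le hc v)
  · exact (Continuous.integrableOn_Icc (by fun_prop)).mono_set Ioc_subset_Icc_self
  · exact ((continuousOn_kernel α t X γ c).mono fun v hv => hv.1).aestronglyMeasurable
      measurableSet_Ioc

theorem norm_kernel_head_le {α t X γ c b : ℝ} (hc : 0 ≤ c) (hb : 0 ≤ b) :
    ‖∫ v in (0 : ℝ)..b, ((Real.exp (-c * v ^ 2) : ℝ) * (2 * v ^ 4 : ℝ) : ℂ) *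
      Complex.exp (Complex.I * kernelPhase α t X γ v)‖ ≤ b ^ 5 := by
  refine (intervalIntegral.norm_integral_le_of_norm_le hb (Filter.Eventually.of_forall fun v _ =>
    norm_kernel_integrand_le hc v) (Continuous.intervalIntegrable (by fun_prop) _ _)).trans ?_
  rw [intervalIntegral.integral_const_mul, integral_pow]
  have : 0 ≤ b ^ 5 := by positivity
  norm_num
  linarith

/-- The one-dimensional oscillatory integral behind the dispersive estimate. -/
theorem exists_norm_kernel_le (α : ℝ) : ∃ C : ℝ, 0 < C ∧ ∀ t X γ c b : ℝ, t ≠ 0 → |t| ≤ 2 → 0 ≤ c →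
    0 ≤ b → ‖∫ v in (0 : ℝ)..b, ((Real.exp (-c * v ^ 2) : ℝ) * (2 * v ^ 4 : ℝ) : ℂ) *
      Complex.exp (Complex.I * kernelPhase α t X γ v)‖ ≤ C * (1 + |γ|) / Real.sqrt |t| := by
  set M : ℝ := 2 * (1 + 3 * |α|) ^ 2 with hM
  have hM2 : 2 ≤ M := by nlinarith [abs_nonneg α]
  refine ⟨M + 20, by linarith, fun t X γ c b ht ht2 hc hb => ?_⟩
  have ht0 : 0 < |t| := abs_pos.mpr ht
  have hs : 0 < Real.sqrt |t| := Real.sqrt_pos.mpr ht0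
  have hs2 : Real.sqrt |t| ≤ 2 := by
    rw [Real.sqrt_le_left (by norm_num)]; linarith
  -- The integral is split at `a = s^{1/5}`, so that the trivial bound `a⁵` of the head is already
  -- of the claimed size. The choice of `M` and `√|t| ≤ 2` give `a⁵ ≥ (1 + 3|α|)²`, hence `a ≥ 1`
  -- and `a⁴ ≥ 3|α|`; moreover `|t| a¹⁰ = (M(1+|γ|))²` dominates `|γ|`. The restriction `|t| ≤ 2` is
  -- needed only for the `α` term.
  set s : ℝ := M * (1 + |γ|) / Real.sqrt |t| with hsdef
  have hγ0 := abs_nonneg γ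
  have hs0 : (1 + 3 * |α|) ^ 2 ≤ s := by
    rw [hsdef, le_div_iff₀ hs]
    nlinarith [sq_nonneg (1 + 3 * |α|)]
  have hspos : 0 < s := lt_of_lt_of_le (by positivity) hs0
  set a : ℝ := s ^ (1 / 5 : ℝ) with ha
  have ha0 : 0 < a := Real.rpow_pos_of_pos hspos _
  have ha5 : a ^ 5 = s := by
    rw [ha, ← Real.rpow_natCast, ← Real.rpow_mul hspos.le]; norm_num
  have hα0 := abs_nonneg α
  have ha1 : 1 ≤ a := by
    by_contra! h
    have h1 : a ^ 5 < 1 := pow_lt_one₀ ha0.le h (by norm_num)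
    nlinarith
  have haα : 3 * |α| ≤ a ^ 4 := by
    by_contra! h
    have h1 : a ≤ a ^ 4 := le_self_pow₀ ha1 (by norm_num)
    have h2 : a ^ 5 ≤ (3 * |α|) ^ 2 := by
      calc a ^ 5 = a * a ^ 4 := by ring
        _ ≤ (3 * |α|) * (3 * |α|) := by gcongr; linarith
        _ = _ := by ring
    nlinarith
  have haγ : |γ| ≤ |t| * a ^ 10 := by
    have h1 : a ^ 10 = s ^ 2 := by rw [← ha5]; ring
    have h2 : |t| * s ^ 2 = (M * (1 + |γ|)) ^ 2 := by
      rw [hsdef, div_pow, Real.sq_sqrt ht0.le]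
      field_simp
    rw [h1, h2]
    have h3 : 1 + |γ| ≤ M * (1 + |γ|) := by nlinarith
    nlinarith
  have hsle : s ≤ (M + 20) * (1 + |γ|) / Real.sqrt |t| := by
    rw [hsdef]; gcongr; linarith
  rcases le_total b a with hba | hba
  · refine (norm_kernel_head_le hc hb).trans (le_trans ?_ hsle)
    rw [← ha5]
    gcongr
  · have hI : ∀ x, 0 ≤ x → IntervalIntegrable (fun v : ℝ => ((Real.exp (-c * v ^ 2) : ℝ) *
        (2 * v ^ 4 : ℝ) : ℂ) * Complex.exp (Complex.I * kernelPhase α t X γ v)) volume 0 x :=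
      fun x hx => (intervalIntegrable_iff_integrableOn_Ioc_of_le hx).mpr (integrableOn_kernel hc x)
    rw [← intervalIntegral.integral_add_adjacent_intervals (hI a ha0.le)
      ((hI a ha0.le).symm.trans (hI b hb))]
    refine (norm_add_le _ _).trans ((add_le_add (norm_kernel_head_le hc ha0.le)
      (norm_kernel_tail_le_of_ne ht hc ha0 hba haα haγ)).trans ?_)
    rw [ha5, hsdef, ← add_div]
    gcongr
    nlinarith

/-- The kernel after the Gaussian integration, in the variable `ξ`. -/
theorem exists_norm_kernel_xi_le (α : ℝ) : ∃ C : ℝ, 0 < C ∧ ∀ t X γ c N : ℝ, t ≠ 0 → |t| ≤ 2 →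
    0 ≤ c → ‖∫ ξ in Ioo 0 N, Complex.exp ((3 / 2 + γ * Complex.I) * Real.log ξ) *
      Complex.exp (-c * ξ) * Complex.exp (Complex.I * (X * ξ + t * (ξ ^ 5 - α * ξ ^ 3)))‖ ≤
      C * (1 + |γ|) / Real.sqrt |t| := by
  obtain ⟨C, hC, h⟩ := exists_norm_kernel_le α
  refine ⟨C, hC, fun t X γ c N ht ht2 hc => ?_⟩
  have himage : (fun v : ℝ => v ^ 2) '' Ioo 0 (Real.sqrt N) = Ioo 0 N := by
    ext ξ
    simp only [mem_image, mem_Ioo]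
    constructor
    · rintro ⟨v, ⟨h0, h1⟩, rfl⟩
      exact ⟨by positivity, (Real.lt_sqrt h0.le).mp h1⟩
    · rintro ⟨h0, h1⟩
      exact ⟨Real.sqrt ξ, ⟨Real.sqrt_pos.mpr h0, Real.sqrt_lt_sqrt h0.le h1⟩, Real.sq_sqrt h0.le⟩
  -- Substitution `ξ = v²`: here `ξ^{3/2} dξ = 2v⁴ dv` and `ξ^{iγ}` contributes `2γ log v` to the
  -- phase.
  rw [← himage, integral_image_eq_integral_abs_deriv_smul measurableSet_Ioo
    (f' := fun v => 2 * v) (fun v _ => ?_) ?_]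
  · have := h t X γ c (Real.sqrt N) ht ht2 hc (Real.sqrt_nonneg N)
    rw [intervalIntegral.integral_of_le (Real.sqrt_nonneg N), integral_Ioc_eq_integral_Ioo] at this
    refine le_of_eq_of_le ?_ this
    congr 1
    refine setIntegral_congr_fun measurableSet_Ioo fun v hv => ?_
    have hv : 0 < v := hv.1
    have h3 : Complex.exp ((3 / 2 + γ * Complex.I) * Real.log (v ^ 2)) =
        (v : ℂ) ^ 3 * Complex.exp (Complex.I * (2 * γ * Real.log v)) := by
      rw [Real.log_pow, add_mul, Complex.exp_add]
      congr 1
      · have : (v : ℂ) ^ 3 = Complex.exp ((Real.log v : ℝ) : ℂ) ^ 3 := by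
          rw [← Complex.ofReal_exp, Real.exp_log hv]
        rw [this, ← Complex.exp_nat_mul]
        congr 1
        push_cast
        ring
      · congr 1
        push_cast
        ring
    simp only [Complex.real_smul]
    rw [h3, abs_of_pos (by positivity)]
    have h4 : Complex.exp (Complex.I * (kernelPhase α t X γ v : ℝ)) =
        Complex.exp (Complex.I * (2 * γ * Real.log v)) *
        Complex.exp (Complex.I * (X * (v ^ 2 : ℝ) + t * ((v ^ 2 : ℝ) ^ 5 - α * (v ^ 2 : ℝ) ^ 3))) := by
      rw [← Complex.exp_add]
      congr 1
      simp only [kernelPhase]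
      push_cast
      ring
    rw [h4]
    push_cast
    ring_nf
  · intro v hv w hw hvw
    exact (pow_left_inj₀ hv.1.le hw.1.le (by norm_num)).mp hvw
  · refine ((hasDerivAt_pow 2 v).congr_deriv ?_).hasDerivWithinAt
    norm_num

/-- The dispersive estimate for the (regularised) kernel of `|D_x|^{1+iγ} e^{itω(D)}`, restricted to
positive frequencies. -/
theorem exists_norm_dispersive_kernel_le (α : ℝ) : ∃ C : ℝ, 0 < C ∧ ∀ t γ ε N x y : ℝ, t ≠ 0 →
    |t| ≤ 2 → 0 < ε → ‖∫ ξ in Ioo 0 N, ∫ μ : ℝ, Complex.exp ((1 + γ * Complex.I) * Real.log ξ) *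
      Complex.exp (Complex.I * (t * omega α ξ μ + x * ξ + y * μ : ℝ)) *
      Real.exp (-ε * μ ^ 2 / ξ)‖ ≤ C * (1 + |γ|) / |t| := by
  obtain ⟨C, hC, h⟩ := exists_norm_kernel_xi_le α
  refine ⟨Real.sqrt Real.pi * C, by positivity, fun t γ ε N x y ht ht2 hε => ?_⟩
  have ht0 : 0 < |t| := abs_pos.mpr ht
  -- The regularised quadratic phase in `μ` is `-(w/ξ) μ²`. This is why the cut-off has the form
  -- `exp(-εμ²/ξ)`: the factor `ξ^{1/2}` separates exactly from a constant of size `|w|^{-1/2} ≤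
  -- |t|^{-1/2}`. The remaining `exp(-y²ξ/(4w))` is a damping `exp(-cξ)` with `c ≥ 0` and a shift of
  -- `x` by `d`, both harmless because the bound in `ξ` is uniform in them.
  set w : ℂ := ε - t * Complex.I with hw
  have hwre : w.re = ε := by simp [hw]
  have hwim : w.im = -t := by simp [hw]
  have hw0 : w ≠ 0 := fun h0 => hε.ne' (by rw [← hwre, h0]; rfl)
  have hwn : |t| ≤ ‖w‖ := by
    rw [← abs_neg, ← hwim]; exact Complex.abs_im_le_norm w
  set q : ℝ := ε ^ 2 + t ^ 2 with hq
  have hq0 : 0 < q := by positivity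
  have hqC : ((ε : ℂ) ^ 2 + (t : ℂ) ^ 2) ≠ 0 := by exact_mod_cast hq0.ne'
  set c : ℝ := y ^ 2 * ε / (4 * q) with hc
  set d : ℝ := y ^ 2 * t / (4 * q) with hd
  set D : ℂ := (Real.pi / w) ^ (1 / 2 : ℂ) with hD
  have hinner : ∀ ξ ∈ Ioo 0 N, ∫ μ : ℝ, Complex.exp ((1 + γ * Complex.I) * Real.log ξ) *
      Complex.exp (Complex.I * (t * omega α ξ μ + x * ξ + y * μ : ℝ)) *
      Real.exp (-ε * μ ^ 2 / ξ) = D * (Complex.exp ((3 / 2 + γ * Complex.I) * Real.log ξ) *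
      Complex.exp (-c * ξ) *
      Complex.exp (Complex.I * ((x - d : ℝ) * ξ + t * (ξ ^ 5 - α * ξ ^ 3)))) := by
    intro ξ hξ
    have hξ0 : 0 < ξ := hξ.1
    have hξC : (ξ : ℂ) ≠ 0 := by exact_mod_cast hξ0.ne'
    have hb : 0 < (w / ξ).re := by
      rw [Complex.div_ofReal_re, hwre]; positivity
    have hG := fourierIntegral_gaussian hb (y : ℂ)
    have h1 : ∀ μ : ℝ, Complex.exp ((1 + γ * Complex.I) * Real.log ξ) *
        Complex.exp (Complex.I * (t * omega α ξ μ + x * ξ + y * μ : ℝ)) *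
        Real.exp (-ε * μ ^ 2 / ξ) = Complex.exp ((1 + γ * Complex.I) * Real.log ξ) *
        Complex.exp (Complex.I * (x * ξ + t * (ξ ^ 5 - α * ξ ^ 3))) *
        (Complex.exp (Complex.I * y * μ) * Complex.exp (-(w / ξ) * μ ^ 2)) := by
      intro μ
      rw [Complex.ofReal_exp]
      simp only [← Complex.exp_add]
      congr 1
      simp only [omega, hw]
      push_cast
      field_simp
      ring
    simp_rw [h1]
    rw [integral_const_mul, hG]
    have h2 : (Real.pi / (w / ξ) : ℂ) ^ (1 / 2 : ℂ) = D * Complex.exp (1 / 2 * Real.log ξ) := by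
      have h3 : (Real.pi / (w / ξ) : ℂ) = ξ * (Real.pi / w) := by field_simp
      have hpw : (Real.pi / w : ℂ) ≠ 0 := div_ne_zero (by exact_mod_cast Real.pi_ne_zero) hw0
      rw [h3, hD, Complex.cpow_def_of_ne_zero (mul_ne_zero hξC hpw),
        Complex.cpow_def_of_ne_zero hpw, Complex.log_ofReal_mul hξ0 hpw, ← Complex.exp_add]
      congr 1
      ring
    have h5 : Complex.exp (-(y : ℂ) ^ 2 / (4 * (w / ξ))) =
        Complex.exp (-c * ξ) * Complex.exp (-Complex.I * d * ξ) := by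
      rw [← Complex.exp_add]
      congr 1
      have h6 : (w : ℂ)⁻¹ = (ε + t * Complex.I) / (ε ^ 2 + t ^ 2) := by
        rw [eq_div_iff hqC, inv_mul_eq_iff_eq_mul₀ hw0, hw]
        linear_combination (t : ℂ) ^ 2 * Complex.I_sq
      have h7 : -(y : ℂ) ^ 2 / (4 * (w / ξ)) = -(y ^ 2 * ξ / 4) * w⁻¹ := by
        field_simp
      rw [h7, h6, hc, hd, hq]
      push_cast
      field_simp
      ring
    rw [h2, h5]
    have h8 : Complex.exp ((3 / 2 + γ * Complex.I) * Real.log ξ) =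
        Complex.exp ((1 + γ * Complex.I) * Real.log ξ) * Complex.exp (1 / 2 * Real.log ξ) := by
      rw [← Complex.exp_add]; congr 1; ring
    have h9 : Complex.exp (Complex.I * ((x - d : ℝ) * ξ + t * (ξ ^ 5 - α * ξ ^ 3))) =
        Complex.exp (Complex.I * (x * ξ + t * (ξ ^ 5 - α * ξ ^ 3))) *
          Complex.exp (-Complex.I * d * ξ) := by
      rw [← Complex.exp_add]; congr 1; push_cast; ring
    rw [h8, h9]
    ring
  rw [setIntegral_congr_fun measurableSet_Ioo hinner, integral_const_mul, norm_mul]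
  have hDn : ‖D‖ ≤ Real.sqrt Real.pi / Real.sqrt |t| := by
    have h1 : (1 / 2 : ℂ) = ((1 / 2 : ℝ) : ℂ) := by push_cast; rfl
    have hpw : (Real.pi / w : ℂ) ≠ 0 := div_ne_zero (by exact_mod_cast Real.pi_ne_zero) hw0
    rw [hD, h1, Complex.norm_cpow_real, ← Real.sqrt_eq_rpow, norm_div, Complex.norm_real,
      Real.norm_eq_abs, abs_of_pos Real.pi_pos, ← Real.sqrt_div Real.pi_pos.le]
    gcongr
  calc ‖D‖ * _ ≤ Real.sqrt Real.pi / Real.sqrt |t| * (C * (1 + |γ|) / Real.sqrt |t|) := by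
        gcongr
        exact h t (x - d) γ c N ht ht2 (by positivity)
    _ = Real.sqrt Real.pi * C * (1 + |γ|) / (Real.sqrt |t| * Real.sqrt |t|) := by
        field_simp
    _ = _ := by rw [Real.mul_self_sqrt ht0.le]

/-! ### Interpolation of analytic families by the three lines theorem. -/

section

section Interpolation

variable {V : Type*} [MeasurableSpace V] {ν : Measure V} {b : V → ℂ} {l : V → ℝ}

theorem norm_cexp_mul_ofReal_le (z : ℂ) (h0 : 0 ≤ z.re) (h1 : z.re ≤ 1) (x : ℝ) :
    ‖Complex.exp (z * x)‖ ≤ 1 + Real.exp x := by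
  rw [Complex.norm_exp]
  have : (z * x).re = z.re * x := by simp
  rw [this]
  rcases le_total 0 x with hx | hx
  · have : Real.exp (z.re * x) ≤ Real.exp x :=
      Real.exp_le_exp.mpr (mul_le_of_le_one_left hx h1)
    linarith
  · have : Real.exp (z.re * x) ≤ 1 := Real.exp_le_one_iff.mpr (mul_nonpos_of_nonneg_of_nonpos h0 hx)
    linarith [Real.exp_pos x]

/-- At distance `δ` from the edges of the strip the factor `x` is absorbed by the spare exponential,
through `u e^{-u} ≤ 1`. This dominates the derivative in `z` under the integral. -/
theorem norm_mul_cexp_mul_ofReal_le {δ : ℝ} (hδ : 0 < δ) (z : ℂ) (h0 : δ ≤ z.re)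
    (h1 : z.re ≤ 1 - δ) (x : ℝ) : ‖(x : ℂ) * Complex.exp (z * x)‖ ≤ 1 / δ * (1 + Real.exp x) := by
  rw [norm_mul, Complex.norm_exp, Complex.norm_real, Real.norm_eq_abs]
  have h2 : (z * x).re = z.re * x := by simp
  rw [h2]
  have key : ∀ u : ℝ, δ * u * Real.exp (-(δ * u)) ≤ 1 := by
    intro u
    rw [Real.exp_neg, ← div_eq_mul_inv, div_le_one (Real.exp_pos _)]
    linarith [Real.add_one_le_exp (δ * u)]
  rw [div_mul_eq_mul_div, one_mul, le_div_iff₀ hδ]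
  rcases le_total 0 x with hx | hx
  · rw [abs_of_nonneg hx]
    have h3 : Real.exp (z.re * x) ≤ Real.exp (-(δ * x)) * Real.exp x := by
      rw [← Real.exp_add]; exact Real.exp_le_exp.mpr (by nlinarith)
    calc x * Real.exp (z.re * x) * δ ≤ x * (Real.exp (-(δ * x)) * Real.exp x) * δ := by gcongr
      _ = (δ * x * Real.exp (-(δ * x))) * Real.exp x := by ring
      _ ≤ 1 * Real.exp x := by gcongr; exact key x
      _ ≤ _ := by linarith
  · rw [abs_of_nonpos hx]
    have h3 : Real.exp (z.re * x) ≤ Real.exp (-(δ * (-x))) := Real.exp_le_exp.mpr (by nlinarith)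
    calc -x * Real.exp (z.re * x) * δ ≤ -x * Real.exp (-(δ * (-x))) * δ := by
          gcongr; linarith
      _ = δ * (-x) * Real.exp (-(δ * (-x))) := by ring
      _ ≤ 1 := key (-x)
      _ ≤ _ := by linarith [Real.exp_pos x]

theorem integrable_norm_mul_one_add_exp (hb : Integrable b ν)
    (hb1 : Integrable (fun v => b v * Complex.exp (l v)) ν) :
    Integrable (fun v => ‖b v‖ * (1 + Real.exp (l v))) ν := by
  refine (hb.norm.add hb1.norm).congr (Filter.Eventually.of_forall fun v => ?_)
  simp only [Pi.add_apply, norm_mul, Complex.norm_exp, Complex.ofReal_re]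
  ring

theorem continuousOn_integral_cexp (hl : Measurable l) (hb : Integrable b ν)
    (hb1 : Integrable (fun v => b v * Complex.exp (l v)) ν) :
    ContinuousOn (fun z : ℂ => ∫ v, b v * Complex.exp (z * l v) ∂ν) {z | 0 ≤ z.re ∧ z.re ≤ 1} := by
  refine continuousOn_of_dominated (bound := fun v => ‖b v‖ * (1 + Real.exp (l v))) ?_ ?_
    (integrable_norm_mul_one_add_exp hb hb1) ?_
  · intro z _
    exact hb.aestronglyMeasurable.mul (by fun_prop)
  · intro z hz
    refine Filter.Eventually.of_forall fun v => ?_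
    rw [norm_mul]
    gcongr
    exact norm_cexp_mul_ofReal_le z hz.1 hz.2 _
  · exact Filter.Eventually.of_forall fun v => by fun_prop

theorem differentiableAt_integral_cexp (hl : Measurable l) (hb : Integrable b ν)
    (hb1 : Integrable (fun v => b v * Complex.exp (l v)) ν) {z : ℂ} (h0 : 0 < z.re)
    (h1 : z.re < 1) : DifferentiableAt ℂ (fun z : ℂ => ∫ v, b v * Complex.exp (z * l v) ∂ν) z := by
  set δ : ℝ := min z.re (1 - z.re) / 2 with hδd
  have hδ : 0 < δ := by
    have : 0 < min z.re (1 - z.re) := lt_min h0 (by linarith)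
    positivity
  have hδ0 : 2 * δ ≤ z.re := by rw [hδd]; linarith [min_le_left z.re (1 - z.re)]
  have hδ1 : 2 * δ ≤ 1 - z.re := by rw [hδd]; linarith [min_le_right z.re (1 - z.re)]
  have hint := integrable_norm_mul_one_add_exp hb hb1
  have := hasDerivAt_integral_of_dominated_loc_of_deriv_le (μ := ν)
    (F := fun (z : ℂ) v => b v * Complex.exp (z * l v))
    (F' := fun (z : ℂ) v => b v * (l v * Complex.exp (z * l v))) (x₀ := z)
    (bound := fun v => 1 / δ * (‖b v‖ * (1 + Real.exp (l v)))) (Metric.ball_mem_nhds z hδ)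
    ?_ ?_ ?_ ?_ (hint.const_mul _) ?_
  · exact this.2.differentiableAt
  · exact Filter.Eventually.of_forall fun z => hb.aestronglyMeasurable.mul (by fun_prop)
  · refine Integrable.mono' hint (hb.aestronglyMeasurable.mul (by fun_prop))
      (Filter.Eventually.of_forall fun v => ?_)
    rw [norm_mul]
    gcongr
    exact norm_cexp_mul_ofReal_le z h0.le h1.le _
  · exact hb.aestronglyMeasurable.mul (by fun_prop)
  · refine Filter.Eventually.of_forall fun v w hw => ?_
    have hre : |w.re - z.re| < δ := by
      rw [← Complex.sub_re]
      exact (Complex.abs_re_le_norm _).trans_lt (by simpa [dist_eq_norm] using hw)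
    rw [abs_lt] at hre
    rw [norm_mul]
    calc ‖b v‖ * ‖(l v : ℂ) * Complex.exp (w * l v)‖
        ≤ ‖b v‖ * (1 / δ * (1 + Real.exp (l v))) := by
          gcongr
          exact norm_mul_cexp_mul_ofReal_le hδ w (by linarith) (by linarith) _
      _ = _ := by ring
  · refine Filter.Eventually.of_forall fun v w _ => ?_
    have h := (((hasDerivAt_id w).mul_const (l v : ℂ)).cexp).const_mul (b v)
    refine h.congr_deriv ?_
    simp only [id]
    ring

/-- Interpolation for an analytic family of integrals, with linear growth on the right line. -/
theorem norm_integral_cexp_le_interp (hl : Measurable l) (hb : Integrable b ν)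
    (hb1 : Integrable (fun v => b v * Complex.exp (l v)) ν) {A₀ A₁ θ : ℝ} (hθ0 : 0 ≤ θ)
    (hθ1 : θ ≤ 1) (hA₁ : 0 ≤ A₁)
    (h0 : ∀ γ : ℝ, ‖∫ v, b v * Complex.exp (γ * Complex.I * l v) ∂ν‖ ≤ A₀)
    (h1 : ∀ γ : ℝ, ‖∫ v, b v * Complex.exp ((1 + γ * Complex.I) * l v) ∂ν‖ ≤ A₁ * (1 + |γ|)) :
    ‖∫ v, b v * Complex.exp (θ * l v) ∂ν‖ ≤ 6 * (A₀ ^ (1 - θ) * A₁ ^ θ) := by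
  have hA₀ : 0 ≤ A₀ := (norm_nonneg _).trans (h0 0)
  -- The factor `exp(z²)` has modulus `exp((Re z)² - (Im z)²)`, which absorbs the linear growth in
  -- `γ` on the right edge. Its cost is at most `2e ≤ 6` there, and at the real point `θ` it is at
  -- least 1.
  set Φ : ℂ → ℂ := fun z => Complex.exp (z ^ 2) * ∫ v, b v * Complex.exp (z * l v) ∂ν with hΦ
  have hsq : ∀ z : ℂ, ‖Complex.exp (z ^ 2)‖ = Real.exp (z.re ^ 2 - z.im ^ 2) := fun z => by
    rw [Complex.norm_exp]; congr 1; simp [sq]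
  have hclos : closure (Complex.HadamardThreeLines.verticalStrip 0 1) ⊆
      {z : ℂ | 0 ≤ z.re ∧ z.re ≤ 1} := by
    refine closure_minimal (fun z hz => ⟨hz.1.le, hz.2.le⟩) ?_
    exact isClosed_Icc.preimage Complex.continuous_re
  have hint := integrable_norm_mul_one_add_exp hb hb1
  have hd : DiffContOnCl ℂ Φ (Complex.HadamardThreeLines.verticalStrip 0 1) := by
    constructor
    · intro z hz
      refine (DifferentiableAt.mul (by fun_prop) ?_).differentiableWithinAt
      exact differentiableAt_integral_cexp hl hb hb1 hz.1 hz.2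
    · exact ContinuousOn.mul (by fun_prop) ((continuousOn_integral_cexp hl hb hb1).mono hclos)
  have hB : BddAbove ((norm ∘ Φ) '' Complex.HadamardThreeLines.verticalClosedStrip 0 1) := by
    refine ⟨Real.exp 1 * ∫ v, ‖b v‖ * (1 + Real.exp (l v)) ∂ν, ?_⟩
    rintro _ ⟨z, hz, rfl⟩
    have hz0 : 0 ≤ z.re := hz.1
    have hz1 : z.re ≤ 1 := hz.2
    simp only [Function.comp, hΦ, norm_mul, hsq]
    gcongr
    · nlinarith [sq_nonneg z.im]
    · refine norm_integral_le_of_norm_le hint (Filter.Eventually.of_forall fun v => ?_)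
      rw [norm_mul]
      gcongr
      exact norm_cexp_mul_ofReal_le z hz0 hz1 _
  have hleft : ∀ z ∈ Complex.re ⁻¹' {0}, ‖Φ z‖ ≤ A₀ := by
    intro z hz
    have hz : z.re = 0 := hz
    have hzI : z = z.im * Complex.I := by apply Complex.ext <;> simp [hz]
    have := h0 z.im
    rw [← hzI] at this
    simp only [hΦ, norm_mul, hsq, hz]
    refine (mul_le_of_le_one_left (norm_nonneg _) ?_).trans this
    exact Real.exp_le_one_iff.mpr (by nlinarith [sq_nonneg z.im])
  have hright : ∀ z ∈ Complex.re ⁻¹' {1}, ‖Φ z‖ ≤ 2 * Real.exp 1 * A₁ := by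
    intro z hz
    have hz : z.re = 1 := hz
    have hzI : z = 1 + z.im * Complex.I := by apply Complex.ext <;> simp [hz]
    have := h1 z.im
    rw [← hzI] at this
    simp only [hΦ, norm_mul, hsq, hz]
    have h3 : 1 + |z.im| ≤ 2 * Real.exp (z.im ^ 2) := by
      have := Real.add_one_le_exp (z.im ^ 2)
      nlinarith [sq_abs z.im, sq_nonneg (|z.im| - 1)]
    calc Real.exp (1 ^ 2 - z.im ^ 2) * ‖∫ v, b v * Complex.exp (z * l v) ∂ν‖
        ≤ Real.exp (1 ^ 2 - z.im ^ 2) * (A₁ * (2 * Real.exp (z.im ^ 2))) := by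
          gcongr
          exact this.trans (by gcongr)
      _ = 2 * A₁ * (Real.exp (1 ^ 2 - z.im ^ 2) * Real.exp (z.im ^ 2)) := by ring
      _ = _ := by rw [← Real.exp_add]; ring_nf
  have h3 := Complex.HadamardThreeLines.norm_le_interp_of_mem_verticalClosedStrip₀₁' Φ
    (z := (θ : ℂ)) ⟨by simpa using hθ0, by simpa using hθ1⟩ hd hB hleft hright
  simp only [Complex.ofReal_re, hΦ, norm_mul, hsq, Complex.ofReal_im] at h3
  have h4 : (1 : ℝ) ≤ Real.exp (θ ^ 2 - 0 ^ 2) := Real.one_le_exp (by nlinarith)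
  have h5 : (2 * Real.exp 1 * A₁) ^ θ ≤ 6 * A₁ ^ θ := by
    rw [Real.mul_rpow (by positivity) hA₁]
    gcongr
    have h6 : 1 ≤ 2 * Real.exp 1 := by linarith [Real.add_one_le_exp (1 : ℝ)]
    calc (2 * Real.exp 1) ^ θ ≤ (2 * Real.exp 1) ^ (1 : ℝ) := Real.rpow_le_rpow_of_exponent_le h6 hθ1
      _ ≤ 6 := by rw [Real.rpow_one]; linarith [Real.exp_one_lt_d9]
  calc ‖∫ v, b v * Complex.exp (θ * l v) ∂ν‖
      ≤ Real.exp (θ ^ 2 - 0 ^ 2) * ‖∫ v, b v * Complex.exp (θ * l v) ∂ν‖ :=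
        le_mul_of_one_le_left (norm_nonneg _) h4
    _ ≤ _ := h3
    _ ≤ A₀ ^ (1 - θ) * (6 * A₁ ^ θ) := by gcongr
    _ = _ := by ring

end Interpolation

end

/-! ### The Hardy–Littlewood–Sobolev inequality on the line. -/

theorem lintegral_comp_abs (G : ℝ → ℝ≥0∞) :
    ∫⁻ u, G |u| = 2 * ∫⁻ u in Ioi 0, G u := by
  have h1 : ∫⁻ u in Ioi 0, G |u| = ∫⁻ u in Ioi 0, G u :=
    setLIntegral_congr_fun measurableSet_Ioi fun u hu => by rw [abs_of_pos hu]
  have h2 : ∫⁻ u in Iio 0, G |u| = ∫⁻ u in Ioi 0, G u := by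
    have h3 := (Measure.measurePreserving_neg (volume : Measure ℝ)).setLIntegral_comp_preimage_emb
      (MeasurableEquiv.neg ℝ).measurableEmbedding (fun u => G |u|) (Ioi 0)
    rw [← h1, ← h3]
    simp
  rw [← lintegral_add_compl (fun u => G |u|) (measurableSet_Ioi (a := (0 : ℝ))), compl_Ioi,
    setLIntegral_congr Iio_ae_eq_Iic.symm, h1, h2, two_mul]

theorem lintegral_near {a R : ℝ} (ha : a < 1) (hR : 0 < R) :
    ∫⁻ u in Ioc 0 R, ENNReal.ofReal (u ^ (-a)) = ENNReal.ofReal (R ^ (1 - a) / (1 - a)) := by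
  have hint : IntegrableOn (fun u : ℝ => u ^ (-a)) (Ioc 0 R) :=
    (intervalIntegrable_iff_integrableOn_Ioc_of_le hR.le).mp
      (intervalIntegral.intervalIntegrable_rpow' (by linarith))
  rw [← ofReal_integral_eq_lintegral_ofReal hint, ← intervalIntegral.integral_of_le hR.le,
    integral_rpow (Or.inl (by linarith))]
  · rw [Real.zero_rpow (by linarith), sub_zero]
    ring_nf
  · exact (ae_restrict_iff' measurableSet_Ioc).mpr (Filter.Eventually.of_forall fun u hu =>
      Real.rpow_nonneg hu.1.le _)

theorem lintegral_far {R : ℝ} (hR : 0 < R) :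
    ∫⁻ u in Ioi R, ENNReal.ofReal (u ^ (-2 : ℝ)) = ENNReal.ofReal (1 / R) := by
  have hint : IntegrableOn (fun u : ℝ => u ^ (-2 : ℝ)) (Ioi R) :=
    integrableOn_Ioi_rpow_of_lt (by norm_num) hR
  rw [← ofReal_integral_eq_lintegral_ofReal hint, integral_Ioi_rpow_of_lt (by norm_num) hR]
  · congr 1
    rw [show (-2 + 1 : ℝ) = -1 by norm_num, Real.rpow_neg_one]
    ring
  · exact (ae_restrict_iff' measurableSet_Ioi).mpr (Filter.Eventually.of_forall fun u hu =>
      Real.rpow_nonneg (hR.trans hu).le _)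

/-- Near `t` the minimum is bounded by `f t` and the kernel is integrable; far from `t` it is
bounded by `f s` and Hölder is used with exponents `2/(2-a)` and `2/a`. After multiplication by `f
t` the right-hand side becomes a multiple of `f t ^ (2/(2-a))`, which integrates to `J` again. -/
theorem hls_inner {a : ℝ} (ha0 : 0 < a) (ha1 : a < 1) {f : ℝ → ℝ} (hf : Measurable f)
    (hf0 : ∀ x, 0 ≤ f x) {J : ℝ} (hJ : 0 < J)
    (hfJ : ∫⁻ s, ENNReal.ofReal (f s ^ (2 / (2 - a))) = ENNReal.ofReal J) (t : ℝ) (ht : 0 < f t) :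
    ∫⁻ s, ENNReal.ofReal (min (f s) (f t) * |t - s| ^ (-a)) ≤
      ENNReal.ofReal ((2 / (1 - a) + 2) * (J ^ (1 - a) * f t ^ (a / (2 - a)))) := by
  set v := f t with hv
  set p : ℝ := 2 / (2 - a) with hp
  have h2a : 0 < 2 - a := by linarith
  have hp0 : 0 < p := by positivity
  -- The radius at which the near and the far contributions have the same size.
  set R : ℝ := J / v ^ p with hR
  have hR0 : 0 < R := by positivity
  set G : ℝ → ℝ≥0∞ := (Iic R).indicator fun u => ENNReal.ofReal (u ^ (-a)) with hG
  set H : ℝ → ℝ≥0∞ := (Ioi R).indicator fun u => ENNReal.ofReal (u ^ (-a)) with hH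
  have hmeas : Measurable fun u : ℝ => ENNReal.ofReal (u ^ (-a)) := by fun_prop
  have hGm : Measurable G := hmeas.indicator measurableSet_Iic
  have hHm : Measurable H := hmeas.indicator measurableSet_Ioi
  have hnear : ∫⁻ s, G |t - s| = ENNReal.ofReal (2 * (R ^ (1 - a) / (1 - a))) := by
    rw [lintegral_sub_left_eq_self (fun u => G |u|) t, lintegral_comp_abs, hG,
      lintegral_indicator measurableSet_Iic, Measure.restrict_restrict measurableSet_Iic,
      inter_comm, Ioi_inter_Iic, lintegral_near ha1 hR0, ENNReal.ofReal_mul (by norm_num)]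
    simp
  have hfar : ∫⁻ s, H |t - s| ^ (2 / a) = ENNReal.ofReal (2 * (1 / R)) := by
    rw [lintegral_sub_left_eq_self (fun u => H |u| ^ (2 / a)) t,
      lintegral_comp_abs (fun u => H u ^ (2 / a))]
    have h1 : ∀ u ∈ Ioi (0 : ℝ), H u ^ (2 / a) =
        (Ioi R).indicator (fun u => ENNReal.ofReal (u ^ (-2 : ℝ))) u := by
      intro u hu
      have hu : 0 < u := hu
      simp only [hH, indicator]
      split_ifs
      · rw [ENNReal.ofReal_rpow_of_pos (Real.rpow_pos_of_pos hu _), ← Real.rpow_mul hu.le]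
        congr 2
        field_simp
      · exact ENNReal.zero_rpow_of_pos (by positivity)
    rw [setLIntegral_congr_fun measurableSet_Ioi h1, lintegral_indicator measurableSet_Ioi,
      Measure.restrict_restrict measurableSet_Ioi, Ioi_inter_Ioi, max_eq_left hR0.le,
      lintegral_far hR0, ENNReal.ofReal_mul (by norm_num)]
    simp
  have hpt : ∀ s, ENNReal.ofReal (min (f s) v * |t - s| ^ (-a)) ≤
      ENNReal.ofReal v * G |t - s| + ENNReal.ofReal (f s) * H |t - s| := by
    intro s
    have hpos : 0 ≤ |t - s| ^ (-a) := Real.rpow_nonneg (abs_nonneg _) _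
    by_cases h : |t - s| ≤ R
    · refine le_trans ?_ le_self_add
      simp only [hG, indicator, mem_Iic, h, if_true]
      rw [← ENNReal.ofReal_mul ht.le]
      exact ENNReal.ofReal_le_ofReal (mul_le_mul_of_nonneg_right (min_le_right _ _) hpos)
    · refine le_trans ?_ le_add_self
      simp only [hH, indicator, mem_Ioi, not_le.mp h, if_true]
      rw [← ENNReal.ofReal_mul (hf0 s)]
      exact ENNReal.ofReal_le_ofReal (mul_le_mul_of_nonneg_right (min_le_left _ _) hpos)
  have hconj : p.HolderConjugate (2 / a) := by
    rw [Real.holderConjugate_iff]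
    constructor
    · rw [hp, lt_div_iff₀ h2a]; linarith
    · rw [hp]; field_simp; ring
  have hholder := ENNReal.lintegral_mul_le_Lp_mul_Lq volume hconj
    (f := fun s => ENNReal.ofReal (f s)) (g := fun s => H |t - s|) (by fun_prop)
    (hHm.comp (by fun_prop)).aemeasurable
  have hfp : ∫⁻ s, ENNReal.ofReal (f s) ^ p = ENNReal.ofReal J := by
    rw [← hfJ]
    exact lintegral_congr fun s => ENNReal.ofReal_rpow_of_nonneg (hf0 s) hp0.le
  rw [hfp, hfar, ENNReal.ofReal_rpow_of_pos hJ, ENNReal.ofReal_rpow_of_pos (by positivity),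
    ← ENNReal.ofReal_mul (by positivity)] at hholder
  calc ∫⁻ s, ENNReal.ofReal (min (f s) v * |t - s| ^ (-a))
      ≤ ∫⁻ s, (ENNReal.ofReal v * G |t - s| + ENNReal.ofReal (f s) * H |t - s|) :=
        lintegral_mono hpt
    _ = ENNReal.ofReal v * (∫⁻ s, G |t - s|) + ∫⁻ s, ENNReal.ofReal (f s) * H |t - s| := by
        have hGm' : Measurable fun s => G |t - s| := hGm.comp (by fun_prop)
        rw [lintegral_add_left (hGm'.const_mul _), lintegral_const_mul _ hGm']
    _ ≤ ENNReal.ofReal (v * (2 * (R ^ (1 - a) / (1 - a)))) +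
        ENNReal.ofReal (J ^ (1 / p) * (2 * (1 / R)) ^ (1 / (2 / a))) := by
        rw [hnear, ← ENNReal.ofReal_mul ht.le]
        gcongr
        exact hholder
    _ ≤ _ := by
        have h1a : 0 < 1 - a := by linarith
        rw [← ENNReal.ofReal_add (by positivity) (by positivity)]
        refine ENNReal.ofReal_le_ofReal ?_
        have e1 : v * R ^ (1 - a) = J ^ (1 - a) * v ^ (a / (2 - a)) := by
          rw [hR, Real.div_rpow hJ.le (by positivity), ← Real.rpow_mul ht.le,
            mul_div_assoc', mul_comm v, mul_div_assoc]
          congr 1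
          rw [eq_comm, eq_div_iff (by positivity), ← Real.rpow_add ht]
          nth_rewrite 2 [← Real.rpow_one v]
          congr 1
          rw [hp]; field_simp; ring
        have e2 : J ^ (1 / p) * (1 / R) ^ (1 / (2 / a)) = J ^ (1 - a) * v ^ (a / (2 - a)) := by
          have hRinv : 1 / R = v ^ p / J := by rw [hR, one_div_div]
          rw [hRinv, Real.div_rpow (by positivity) hJ.le, ← Real.rpow_mul ht.le,
            mul_div_assoc', mul_comm (J ^ _), mul_div_assoc, ← Real.rpow_sub hJ, mul_comm]
          congr 2
          · rw [hp]; field_simp; ring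
          · rw [hp]; field_simp
        have e3 : (2 * (1 / R)) ^ (1 / (2 / a)) ≤ 2 * (1 / R) ^ (1 / (2 / a)) := by
          rw [Real.mul_rpow (by norm_num) (by positivity)]
          gcongr
          calc (2 : ℝ) ^ (1 / (2 / a)) ≤ 2 ^ (1 : ℝ) := by
                apply Real.rpow_le_rpow_of_exponent_le (by norm_num)
                rw [one_div_div]; linarith
            _ = 2 := Real.rpow_one 2
        calc v * (2 * (R ^ (1 - a) / (1 - a))) + J ^ (1 / p) * (2 * (1 / R)) ^ (1 / (2 / a))
            ≤ 2 / (1 - a) * (v * R ^ (1 - a)) + J ^ (1 / p) * (2 * (1 / R) ^ (1 / (2 / a))) := by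
              refine add_le_add (le_of_eq (by ring)) (mul_le_mul_of_nonneg_left e3 (by positivity))
          _ = 2 / (1 - a) * (v * R ^ (1 - a)) + 2 * (J ^ (1 / p) * (1 / R) ^ (1 / (2 / a))) := by
              ring
          _ = _ := by rw [e1, e2]; ring

/-- The diagonal case of the Hardy–Littlewood–Sobolev inequality on the line. -/
theorem hardy_littlewood_sobolev {a : ℝ} (ha0 : 0 ≤ a) (ha1 : a < 1) {f : ℝ → ℝ}
    (hf : Measurable f) (hf0 : ∀ x, 0 ≤ f x) (hfi : Integrable fun s => f s ^ (2 / (2 - a))) :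
    ∫⁻ t, ∫⁻ s, ENNReal.ofReal (f t * f s * |t - s| ^ (-a)) ≤
      ENNReal.ofReal (2 * (2 / (1 - a) + 2) * (∫ s, f s ^ (2 / (2 - a))) ^ (2 - a)) := by
  set J := ∫ s, f s ^ (2 / (2 - a)) with hJd
  have h2a : 0 < 2 - a := by linarith
  have h1a : 0 < 1 - a := by linarith
  have hJ0 : 0 ≤ J := integral_nonneg fun s => Real.rpow_nonneg (hf0 s) _
  have hfJ : ∫⁻ s, ENNReal.ofReal (f s ^ (2 / (2 - a))) = ENNReal.ofReal J :=
    (ofReal_integral_eq_lintegral_ofReal hfi (Filter.Eventually.of_forall fun s =>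
      Real.rpow_nonneg (hf0 s) _)).symm
  -- For `a = 0` the exponent `2/a` is not available, but the kernel is 1 and the double integral is
  -- `(∫ f)²`.
  rcases ha0.eq_or_lt with rfl | ha0
  · simp only [neg_zero, Real.rpow_zero, mul_one, sub_zero, div_self (two_ne_zero' ℝ),
      Real.rpow_one] at hfJ ⊢
    have h1 : ∀ t, ∫⁻ s, ENNReal.ofReal (f t * f s) = ENNReal.ofReal (f t) * ENNReal.ofReal J := by
      intro t
      simp_rw [ENNReal.ofReal_mul (hf0 t)]
      rw [lintegral_const_mul _ (by fun_prop), hfJ]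
    simp_rw [h1]
    rw [lintegral_mul_const _ (by fun_prop), hfJ, ← ENNReal.ofReal_mul hJ0]
    refine ENNReal.ofReal_le_ofReal ?_
    norm_num
    nlinarith [mul_nonneg hJ0 hJ0]
  rcases hJ0.eq_or_lt with hJ | hJ
  · have h0 : ∀ᵐ s, f s = 0 := by
      have h1 : ∀ᵐ s, f s ^ (2 / (2 - a)) = 0 :=
        (integral_eq_zero_iff_of_nonneg (fun s => Real.rpow_nonneg (hf0 s) _) hfi).mp hJ.symm
      filter_upwards [h1] with s hs
      exact (Real.rpow_eq_zero (hf0 s) (by positivity)).mp hs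
    have h2 : ∫⁻ t, ∫⁻ s, ENNReal.ofReal (f t * f s * |t - s| ^ (-a)) = 0 := by
      refine (lintegral_congr_ae (g := fun _ => 0) ?_).trans lintegral_zero
      filter_upwards [h0] with t ht
      simp [ht]
    rw [h2]
    exact zero_le
  -- By symmetry it suffices to integrate where `f s ≤ f t`; the minimum in `A` encodes this
  -- restriction and makes `hls_inner` applicable.
  set A : ℝ → ℝ → ℝ≥0∞ := fun t s => ENNReal.ofReal (f t * (min (f s) (f t) * |t - s| ^ (-a)))
    with hA
  have hAm : Measurable (Function.uncurry A) := by
    simp only [hA, Function.uncurry_def]; fun_prop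
  have hpt : ∀ t s, ENNReal.ofReal (f t * f s * |t - s| ^ (-a)) ≤ A t s + A s t := by
    intro t s
    have hpos : 0 ≤ |t - s| ^ (-a) := Real.rpow_nonneg (abs_nonneg _) _
    rcases le_total (f s) (f t) with h | h
    · refine le_trans (le_of_eq ?_) le_self_add
      simp only [hA, min_eq_left h]; ring_nf
    · refine le_trans (le_of_eq ?_) le_add_self
      simp only [hA, min_eq_left h, abs_sub_comm s t]; ring_nf
  have hAint : ∫⁻ t, ∫⁻ s, A t s ≤ ENNReal.ofReal ((2 / (1 - a) + 2) * J ^ (2 - a)) := by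
    have h1 : ∀ t, ∫⁻ s, A t s ≤ ENNReal.ofReal ((2 / (1 - a) + 2) * J ^ (1 - a)) *
        ENNReal.ofReal (f t ^ (2 / (2 - a))) := by
      intro t
      rcases (hf0 t).eq_or_lt with ht | ht
      · simp [hA, ← ht]
      · simp only [hA, ENNReal.ofReal_mul ht.le]
        rw [lintegral_const_mul _ (by fun_prop)]
        refine (mul_le_mul_right (hls_inner ha0 ha1 hf hf0 hJ hfJ t ht) _).trans (le_of_eq ?_)
        rw [← ENNReal.ofReal_mul ht.le, ← ENNReal.ofReal_mul (by positivity)]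
        congr 1
        have h5 : f t ^ (2 / (2 - a)) = f t * f t ^ (a / (2 - a)) := by
          nth_rewrite 2 [← Real.rpow_one (f t)]
          rw [← Real.rpow_add ht]
          congr 1
          field_simp
          ring
        rw [h5]
        ring
    refine (lintegral_mono h1).trans (le_of_eq ?_)
    rw [lintegral_const_mul _ (by fun_prop), hfJ, ← ENNReal.ofReal_mul (by positivity)]
    congr 1
    have h5 : J ^ (2 - a) = J ^ (1 - a) * J := by
      nth_rewrite 3 [← Real.rpow_one J]
      rw [← Real.rpow_add hJ]
      congr 1
      ring
    rw [h5]
    ring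
  calc ∫⁻ t, ∫⁻ s, ENNReal.ofReal (f t * f s * |t - s| ^ (-a))
      ≤ ∫⁻ t, ∫⁻ s, (A t s + A s t) := lintegral_mono fun t => lintegral_mono fun s => hpt t s
    _ = (∫⁻ t, ∫⁻ s, A t s) + ∫⁻ t, ∫⁻ s, A s t := by
        have h1 : ∀ t, ∫⁻ s, (A t s + A s t) = (∫⁻ s, A t s) + ∫⁻ s, A s t := fun t =>
          lintegral_add_left (hAm.comp measurable_prodMk_left) _
        simp_rw [h1]
        exact lintegral_add_left hAm.lintegral_prod_right _
    _ = (∫⁻ t, ∫⁻ s, A t s) + ∫⁻ t, ∫⁻ s, A t s := by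
        congr 1
        exact lintegral_lintegral_swap (f := fun t s => A s t)
          (hAm.comp measurable_swap).aemeasurable
    _ ≤ _ := by
        rw [← two_mul, mul_assoc, ENNReal.ofReal_mul (by norm_num)]
        simp only [ENNReal.ofReal_ofNat]
        gcongr

/-! ### Test functions, planar Fourier integrals and Bessel's inequality. -/

section

/-- Bounded measurable functions with bounded support. -/
structure IsTest {X : Type*} [NormedAddCommGroup X] [MeasurableSpace X] (F : X → ℂ) : Prop where
  measurable : Measurable F
  bounded : ∃ M : ℝ, ∀ x, ‖F x‖ ≤ M
  bounded_support : ∃ R : ℝ, ∀ x, F x ≠ 0 → ‖x‖ ≤ R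

section Test

variable {X : Type*} [NormedAddCommGroup X] [MeasurableSpace X]

theorem IsTest.exists_bound {F : X → ℂ} (hF : IsTest F) :
    ∃ M R : ℝ, 0 ≤ M ∧ 0 ≤ R ∧ ∀ x, ‖F x‖ ≤ (Metric.closedBall (0 : X) R).indicator (fun _ => M) x := by
  obtain ⟨M, hM⟩ := hF.bounded
  obtain ⟨R, hR⟩ := hF.bounded_support
  refine ⟨max M 0, max R 0, le_max_right _ _, le_max_right _ _, fun x => ?_⟩
  by_cases hx : F x = 0
  · rw [hx, norm_zero]
    exact indicator_nonneg (fun _ _ => le_max_right _ _) x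
  · rw [indicator_of_mem]
    · exact (hM x).trans (le_max_left _ _)
    · simpa using Or.inl (hR x hx)

theorem IsTest.comp {F : X → ℂ} (hF : IsTest F) {φ : ℂ → ℂ} (hφ : Measurable φ) (h0 : φ 0 = 0)
    (hb : ∀ M : ℝ, ∃ B : ℝ, ∀ w : ℂ, ‖w‖ ≤ M → ‖φ w‖ ≤ B) : IsTest (fun x => φ (F x)) := by
  refine ⟨hφ.comp hF.measurable, ?_, ?_⟩
  · obtain ⟨M, hM⟩ := hF.bounded
    obtain ⟨B, hB⟩ := hb M
    exact ⟨B, fun x => hB _ (hM x)⟩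
  · obtain ⟨R, hR⟩ := hF.bounded_support
    exact ⟨R, fun x hx => hR x fun h => hx (by rw [h, h0])⟩

theorem IsTest.conj {F : X → ℂ} (hF : IsTest F) : IsTest (fun x => (starRingEnd ℂ) (F x)) :=
  hF.comp (Complex.continuous_conj.measurable) (map_zero _) fun M => ⟨M, fun w hw => by simpa using hw⟩

variable [BorelSpace X] [ProperSpace X]

theorem IsTest.integrable_rpow {F : X → ℂ} (hF : IsTest F) (μ : Measure X)
    [IsFiniteMeasureOnCompacts μ] {p : ℝ} (hp : 0 < p) :
    Integrable (fun x => ‖F x‖ ^ p) μ := by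
  obtain ⟨M, R, hM, hR, h⟩ := hF.exists_bound
  have hi : Integrable ((Metric.closedBall (0 : X) R).indicator fun _ => M ^ p) μ := by
    rw [integrable_indicator_iff Metric.isClosed_closedBall.measurableSet]
    exact integrableOn_const (isCompact_closedBall (0 : X) R).measure_lt_top.ne
  refine hi.mono' ?_ (Filter.Eventually.of_forall fun x => ?_)
  · exact (hF.measurable.norm.pow_const p).aestronglyMeasurable
  · rw [Real.norm_of_nonneg (by positivity)]
    refine (Real.rpow_le_rpow (norm_nonneg _) (h x) hp.le).trans (le_of_eq ?_)
    by_cases hx : x ∈ Metric.closedBall (0 : X) R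
    · simp only [indicator_of_mem hx]
    · simp only [indicator_of_notMem hx, Real.zero_rpow hp.ne']

theorem IsTest.integrable {F : X → ℂ} (hF : IsTest F) (μ : Measure X)
    [IsFiniteMeasureOnCompacts μ] : Integrable F μ := by
  refine (integrable_norm_iff hF.measurable.aestronglyMeasurable).mp ?_
  simpa using hF.integrable_rpow μ one_pos

end Test

/-- The pairing of a position and an angular frequency in the plane. -/
def dot (k z : ℝ × ℝ) : ℝ := z.1 * k.1 + z.2 * k.2

theorem measurable_dot : Measurable fun p : (ℝ × ℝ) × (ℝ × ℝ) => dot p.1 p.2 := by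
  unfold dot; fun_prop

theorem norm_cexp_I_mul (x : ℝ) : ‖Complex.exp (Complex.I * x)‖ = 1 := by
  rw [mul_comm]; exact Complex.norm_exp_ofReal_mul_I _

/-- The planar Fourier integral with kernel `exp(i k·z)`. -/
def planeFourier (F : ℝ × ℝ → ℂ) (k : ℝ × ℝ) : ℂ :=
  ∫ z, Complex.exp (Complex.I * dot k z) * F z

theorem planeFourier_conj (F : ℝ × ℝ → ℂ) (k : ℝ × ℝ) :
    planeFourier (fun z => (starRingEnd ℂ) (F z)) (-k) = (starRingEnd ℂ) (planeFourier F k) := by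
  unfold planeFourier
  rw [← integral_conj]
  refine integral_congr_ae (Filter.Eventually.of_forall fun z => ?_)
  simp only [map_mul, ← Complex.exp_conj, Complex.conj_I, Complex.conj_ofReal, dot]
  simp only [Prod.fst_neg, Prod.snd_neg]
  push_cast
  ring_nf

theorem measurable_planeFourier {F : ℝ × ℝ → ℂ} (hF : Measurable F) :
    Measurable (planeFourier F) := by
  unfold planeFourier
  refine (StronglyMeasurable.integral_prod_right (f := fun (k z : ℝ × ℝ) =>
    Complex.exp (Complex.I * dot k z) * F z) ?_).measurable
  refine Measurable.stronglyMeasurable ?_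
  have := measurable_dot
  simp only [Function.uncurry_def]
  fun_prop

theorem norm_planeFourier_le (F : ℝ × ℝ → ℂ) (k : ℝ × ℝ) :
    ‖planeFourier F k‖ ≤ ∫ z, ‖F z‖ := by
  unfold planeFourier
  refine (norm_integral_le_integral_norm _).trans (le_of_eq ?_)
  simp only [norm_mul, norm_cexp_I_mul, one_mul]

section Expansion

variable {σ : Measure (ℝ × ℝ)} {m : ℝ × ℝ → ℂ} {F H : ℝ × ℝ → ℂ}

/-- Absolute integrability in two positions and one frequency. The two orders of integration give a
form with the convolution kernel, used for `L¹ → L^∞` bounds, and a form with Fourier transforms,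
used for `L²` bounds. -/
theorem integrable_expansion (hm : Integrable m σ) (hF : Integrable F) (hH : Integrable H) :
    Integrable (fun p : ((ℝ × ℝ) × (ℝ × ℝ)) × (ℝ × ℝ) => F p.1.1 * H p.1.2 *
      (m p.2 * Complex.exp (Complex.I * dot p.2 (p.1.1 - p.1.2)))) ((volume.prod volume).prod σ) := by
  have h1 := (hF.mul_prod hH).mul_prod hm
  have hmeas : Measurable fun p : ((ℝ × ℝ) × (ℝ × ℝ)) × (ℝ × ℝ) =>
      Complex.exp (Complex.I * dot p.2 (p.1.1 - p.1.2)) := by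
    unfold dot; fun_prop
  have h2 := h1.mul_bdd (c := 1) hmeas.aestronglyMeasurable
    (Filter.Eventually.of_forall fun p => (norm_cexp_I_mul _).le)
  refine h2.congr (Filter.Eventually.of_forall fun p => ?_)
  simp only []
  ring

theorem integral_expansion_eq_kernel [SFinite σ] (hm : Integrable m σ) (hF : Integrable F)
    (hH : Integrable H) :
    ∫ p : ((ℝ × ℝ) × (ℝ × ℝ)) × (ℝ × ℝ), F p.1.1 * H p.1.2 *
      (m p.2 * Complex.exp (Complex.I * dot p.2 (p.1.1 - p.1.2))) ∂((volume.prod volume).prod σ) =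
    ∫ q : (ℝ × ℝ) × (ℝ × ℝ), F q.1 * H q.2 *
      ∫ k, m k * Complex.exp (Complex.I * dot k (q.1 - q.2)) ∂σ ∂(volume.prod volume) := by
  rw [integral_prod _ (integrable_expansion hm hF hH)]
  simp_rw [integral_const_mul]

theorem integral_expansion_eq_fourier [SFinite σ] (hm : Integrable m σ) (hF : Integrable F)
    (hH : Integrable H) :
    ∫ p : ((ℝ × ℝ) × (ℝ × ℝ)) × (ℝ × ℝ), F p.1.1 * H p.1.2 *
      (m p.2 * Complex.exp (Complex.I * dot p.2 (p.1.1 - p.1.2))) ∂((volume.prod volume).prod σ) =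
    ∫ k, m k * (planeFourier F k * planeFourier H (-k)) ∂σ := by
  rw [integral_prod_symm _ (integrable_expansion hm hF hH)]
  refine integral_congr_ae (Filter.Eventually.of_forall fun k => ?_)
  simp only []
  unfold planeFourier
  rw [← integral_prod_mul, ← integral_const_mul]
  refine integral_congr_ae (Filter.Eventually.of_forall fun q => ?_)
  simp only []
  have : Complex.exp (Complex.I * dot k (q.1 - q.2)) =
      Complex.exp (Complex.I * dot k q.1) * Complex.exp (Complex.I * dot (-k) q.2) := by
    rw [← Complex.exp_add]
    congr 1
    simp only [dot, Prod.fst_sub, Prod.snd_sub, Prod.fst_neg, Prod.snd_neg]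
    push_cast
    ring
  rw [this]
  ring

end Expansion

section Bessel

theorem integral_gaussian_mul_cexp {ε : ℝ} (hε : 0 < ε) (y : ℝ) :
    ∫ x : ℝ, (Real.exp (-ε * x ^ 2) : ℂ) * Complex.exp (Complex.I * (y * x : ℝ)) =
      (Real.sqrt (Real.pi / ε) * Real.exp (-y ^ 2 / (4 * ε)) : ℝ) := by
  have h := fourierIntegral_gaussian (b := (ε : ℂ)) (by simpa using hε) (y : ℂ)
  have h2 : ∀ x : ℝ, (Real.exp (-ε * x ^ 2) : ℂ) * Complex.exp (Complex.I * (y * x : ℝ)) =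
      Complex.exp (Complex.I * y * x) * Complex.exp (-ε * x ^ 2) := by
    intro x
    push_cast
    rw [mul_comm, mul_assoc]
  simp_rw [h2]
  rw [h, Real.sqrt_eq_rpow]
  push_cast
  rw [Complex.ofReal_cpow (by positivity)]
  push_cast
  rfl

theorem integral_gaussian_plane {ε : ℝ} (hε : 0 < ε) (w : ℝ × ℝ) :
    ∫ k : ℝ × ℝ, ((Real.exp (-ε * k.1 ^ 2) * Real.exp (-ε * k.2 ^ 2) : ℝ) : ℂ) *
      Complex.exp (Complex.I * dot k w) =
      ((Real.sqrt (Real.pi / ε) * Real.exp (-w.1 ^ 2 / (4 * ε))) *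
        (Real.sqrt (Real.pi / ε) * Real.exp (-w.2 ^ 2 / (4 * ε))) : ℝ) := by
  have h : ∀ k : ℝ × ℝ, ((Real.exp (-ε * k.1 ^ 2) * Real.exp (-ε * k.2 ^ 2) : ℝ) : ℂ) *
      Complex.exp (Complex.I * dot k w) =
      ((Real.exp (-ε * k.1 ^ 2) : ℂ) * Complex.exp (Complex.I * (w.1 * k.1 : ℝ))) *
      ((Real.exp (-ε * k.2 ^ 2) : ℂ) * Complex.exp (Complex.I * (w.2 * k.2 : ℝ))) := by
    intro k
    have : Complex.exp (Complex.I * dot k w) = Complex.exp (Complex.I * (w.1 * k.1 : ℝ)) *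
        Complex.exp (Complex.I * (w.2 * k.2 : ℝ)) := by
      rw [← Complex.exp_add]
      congr 1
      simp only [dot]
      push_cast
      ring
    rw [this]
    push_cast
    ring
  simp_rw [h]
  rw [Measure.volume_eq_prod, integral_prod_mul (fun x : ℝ => (Real.exp (-ε * x ^ 2) : ℂ) *
      Complex.exp (Complex.I * (w.1 * x : ℝ))) (fun x : ℝ => (Real.exp (-ε * x ^ 2) : ℂ) *
      Complex.exp (Complex.I * (w.2 * x : ℝ))), integral_gaussian_mul_cexp hε,
    integral_gaussian_mul_cexp hε]
  push_cast
  ring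

theorem lintegral_heat_kernel {ε : ℝ} (hε : 0 < ε) :
    ∫⁻ w : ℝ × ℝ, ENNReal.ofReal ((Real.sqrt (Real.pi / ε) * Real.exp (-w.1 ^ 2 / (4 * ε))) *
        (Real.sqrt (Real.pi / ε) * Real.exp (-w.2 ^ 2 / (4 * ε)))) =
      ENNReal.ofReal (4 * Real.pi ^ 2) := by
  have hg : ∀ x : ℝ, Real.exp (-x ^ 2 / (4 * ε)) = Real.exp (-(1 / (4 * ε)) * x ^ 2) := by
    intro x; congr 1; ring
  have hint : Integrable fun x : ℝ => Real.sqrt (Real.pi / ε) * Real.exp (-x ^ 2 / (4 * ε)) := by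
    simp_rw [hg]
    exact (integrable_exp_neg_mul_sq (by positivity)).const_mul _
  rw [Measure.volume_eq_prod, ← ofReal_integral_eq_lintegral_ofReal (hint.mul_prod hint)
    (Filter.Eventually.of_forall fun w => by positivity),
    integral_prod_mul (fun x : ℝ => Real.sqrt (Real.pi / ε) * Real.exp (-x ^ 2 / (4 * ε)))
      (fun x : ℝ => Real.sqrt (Real.pi / ε) * Real.exp (-x ^ 2 / (4 * ε)))]
  congr 1
  simp_rw [hg]
  rw [integral_const_mul, integral_gaussian]
  have h1 : Real.pi / (1 / (4 * ε)) = 4 * ε * Real.pi := by field_simp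
  rw [h1, ← Real.sqrt_mul (by positivity), Real.mul_self_sqrt (by positivity)]
  field_simp

/-- With a Gaussian weight, expanding the square gives the pairing of `F` with its convolution by a
heat kernel of total mass `4π²`. Schur's test, that is `2|F(z)F(z')| ≤ |F(z)|² + |F(z')|²`, bounds
it uniformly in `ε`. -/
theorem integral_norm_planeFourier_sq_gaussian_le {F : ℝ × ℝ → ℂ} (hF : IsTest F) {ε : ℝ}
    (hε : 0 < ε) :
    ∫⁻ k : ℝ × ℝ, ENNReal.ofReal (Real.exp (-ε * k.1 ^ 2) * Real.exp (-ε * k.2 ^ 2) *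
      ‖planeFourier F k‖ ^ 2) ≤ ENNReal.ofReal (4 * Real.pi ^ 2 * ∫ z, ‖F z‖ ^ 2) := by
  set g : ℝ × ℝ → ℝ := fun w => (Real.sqrt (Real.pi / ε) * Real.exp (-w.1 ^ 2 / (4 * ε))) *
        (Real.sqrt (Real.pi / ε) * Real.exp (-w.2 ^ 2 / (4 * ε))) with hg
  have hg0 : ∀ w, 0 ≤ g w := fun w => by positivity
  have hgm : Measurable g := by simp only [hg]; fun_prop
  have hFm := hF.measurable
  have hgauss : Integrable fun x : ℝ => Real.exp (-ε * x ^ 2) := integrable_exp_neg_mul_sq hε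
  have hm : Integrable (fun k : ℝ × ℝ => ((Real.exp (-ε * k.1 ^ 2) * Real.exp (-ε * k.2 ^ 2) : ℝ) : ℂ)) :=
    (hgauss.mul_prod hgauss).ofReal
  have hFi := hF.integrable volume
  have hHi := hF.conj.integrable volume
  have hF2 : Integrable (fun z => ‖F z‖ ^ 2) := by
    simpa using hF.integrable_rpow volume (p := 2) (by norm_num)
  have hreal : ∀ k, ((Real.exp (-ε * k.1 ^ 2) * Real.exp (-ε * k.2 ^ 2) : ℝ) : ℂ) *
      (planeFourier F k * planeFourier (fun z => (starRingEnd ℂ) (F z)) (-k)) =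
      ((Real.exp (-ε * k.1 ^ 2) * Real.exp (-ε * k.2 ^ 2) * ‖planeFourier F k‖ ^ 2 : ℝ) : ℂ) := by
    intro k
    rw [planeFourier_conj, Complex.mul_conj, Complex.normSq_eq_norm_sq]
    push_cast
    ring
  have hint : Integrable fun k : ℝ × ℝ => Real.exp (-ε * k.1 ^ 2) * Real.exp (-ε * k.2 ^ 2) *
      ‖planeFourier F k‖ ^ 2 := by
    refine (hgauss.mul_prod hgauss).mul_bdd (c := (∫ z, ‖F z‖) ^ 2) ?_
      (Filter.Eventually.of_forall fun k => ?_)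
    · exact ((measurable_planeFourier hFm).norm.pow_const 2).aestronglyMeasurable
    · rw [norm_pow, norm_norm]
      gcongr
      exact norm_planeFourier_le F k
  have hkey : ((∫ k : ℝ × ℝ, Real.exp (-ε * k.1 ^ 2) * Real.exp (-ε * k.2 ^ 2) *
      ‖planeFourier F k‖ ^ 2 : ℝ) : ℂ) = ∫ q : (ℝ × ℝ) × (ℝ × ℝ), F q.1 *
        (starRingEnd ℂ) (F q.2) * (g (q.1 - q.2) : ℝ) ∂(volume.prod volume) := by
    rw [← integral_complex_ofReal]
    simp_rw [← hreal]
    rw [← integral_expansion_eq_fourier hm hFi hHi, integral_expansion_eq_kernel hm hFi hHi]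
    simp_rw [integral_gaussian_plane hε]
    rfl
  rw [← ofReal_integral_eq_lintegral_ofReal hint (Filter.Eventually.of_forall fun k => by positivity)]
  have h1 : ENNReal.ofReal (∫ k : ℝ × ℝ, Real.exp (-ε * k.1 ^ 2) * Real.exp (-ε * k.2 ^ 2) *
      ‖planeFourier F k‖ ^ 2) = ‖∫ q : (ℝ × ℝ) × (ℝ × ℝ), F q.1 *
        (starRingEnd ℂ) (F q.2) * (g (q.1 - q.2) : ℝ) ∂(volume.prod volume)‖ₑ := by
    rw [← hkey, ← ofReal_norm, Complex.norm_real, Real.norm_of_nonneg]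
    exact integral_nonneg fun k => by positivity
  have hAmeas : Measurable fun q : (ℝ × ℝ) × (ℝ × ℝ) =>
      ENNReal.ofReal (‖F q.1‖ ^ 2 / 2) * ENNReal.ofReal (g (q.1 - q.2)) := by fun_prop
  have hBmeas : Measurable fun q : (ℝ × ℝ) × (ℝ × ℝ) =>
      ENNReal.ofReal (‖F q.2‖ ^ 2 / 2) * ENNReal.ofReal (g (q.1 - q.2)) := by fun_prop
  have hsum : ∫⁻ z, ENNReal.ofReal (‖F z‖ ^ 2 / 2) = ENNReal.ofReal ((∫ z, ‖F z‖ ^ 2) / 2) := by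
    rw [← ofReal_integral_eq_lintegral_ofReal (hF2.div_const 2)
      (Filter.Eventually.of_forall fun k => by positivity), integral_div]
  have hgint : ∫⁻ w, ENNReal.ofReal (g w) = ENNReal.ofReal (4 * Real.pi ^ 2) :=
    lintegral_heat_kernel hε
  have hA : ∫⁻ q, ENNReal.ofReal (‖F q.1‖ ^ 2 / 2) * ENNReal.ofReal (g (q.1 - q.2))
      ∂((volume : Measure (ℝ × ℝ)).prod (volume : Measure (ℝ × ℝ))) =
      ENNReal.ofReal ((∫ z, ‖F z‖ ^ 2) / 2) * ENNReal.ofReal (4 * Real.pi ^ 2) := by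
    rw [lintegral_prod _ hAmeas.aemeasurable]
    have : ∀ z : ℝ × ℝ, ∫⁻ z' : ℝ × ℝ, ENNReal.ofReal (‖F z‖ ^ 2 / 2) * ENNReal.ofReal (g (z - z')) =
        ENNReal.ofReal (‖F z‖ ^ 2 / 2) * ENNReal.ofReal (4 * Real.pi ^ 2) := by
      intro z
      rw [lintegral_const_mul _ (by fun_prop),
        lintegral_sub_left_eq_self (fun w => ENNReal.ofReal (g w)) z, hgint]
    simp_rw [this]
    rw [lintegral_mul_const _ (by fun_prop), hsum]
  have hB : ∫⁻ q, ENNReal.ofReal (‖F q.2‖ ^ 2 / 2) * ENNReal.ofReal (g (q.1 - q.2))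
      ∂((volume : Measure (ℝ × ℝ)).prod (volume : Measure (ℝ × ℝ))) =
      ENNReal.ofReal ((∫ z, ‖F z‖ ^ 2) / 2) * ENNReal.ofReal (4 * Real.pi ^ 2) := by
    rw [lintegral_prod_symm _ hBmeas.aemeasurable]
    have : ∀ z' : ℝ × ℝ, ∫⁻ z : ℝ × ℝ, ENNReal.ofReal (‖F z'‖ ^ 2 / 2) * ENNReal.ofReal (g (z - z')) =
        ENNReal.ofReal (‖F z'‖ ^ 2 / 2) * ENNReal.ofReal (4 * Real.pi ^ 2) := by
      intro z'
      rw [lintegral_const_mul _ (by fun_prop),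
        lintegral_sub_right_eq_self (fun w => ENNReal.ofReal (g w)) z', hgint]
    simp_rw [this]
    rw [lintegral_mul_const _ (by fun_prop), hsum]
  rw [h1]
  refine (enorm_integral_le_lintegral_enorm _).trans ?_
  calc ∫⁻ q, ‖F q.1 * (starRingEnd ℂ) (F q.2) * (g (q.1 - q.2) : ℝ)‖ₑ
        ∂((volume : Measure (ℝ × ℝ)).prod (volume : Measure (ℝ × ℝ)))
      ≤ ∫⁻ q, (ENNReal.ofReal (‖F q.1‖ ^ 2 / 2) * ENNReal.ofReal (g (q.1 - q.2)) +
        ENNReal.ofReal (‖F q.2‖ ^ 2 / 2) * ENNReal.ofReal (g (q.1 - q.2)))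
        ∂((volume : Measure (ℝ × ℝ)).prod (volume : Measure (ℝ × ℝ))) := by
        refine lintegral_mono fun q => ?_
        rw [← add_mul, ← ENNReal.ofReal_add (by positivity) (by positivity),
          ← ENNReal.ofReal_mul (by positivity), ← ofReal_norm]
        refine ENNReal.ofReal_le_ofReal ?_
        rw [norm_mul, norm_mul, RCLike.norm_conj, Complex.norm_real, Real.norm_of_nonneg (hg0 _)]
        gcongr
        nlinarith [sq_nonneg (‖F q.1‖ - ‖F q.2‖)]
    _ = _ := by
        rw [lintegral_add_left hAmeas, hA, hB, ← two_mul, ← ENNReal.ofReal_mul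
          (by have := integral_nonneg (μ := volume) (f := fun z => ‖F z‖ ^ 2) fun z => by positivity
              positivity)]
        rw [show (2 : ℝ≥0∞) = ENNReal.ofReal 2 by simp, ← ENNReal.ofReal_mul (by norm_num)]
        congr 1
        ring

/-- Bessel's inequality for the planar Fourier integral. -/
theorem lintegral_norm_planeFourier_sq_le {F : ℝ × ℝ → ℂ} (hF : IsTest F) :
    ∫⁻ k : ℝ × ℝ, ENNReal.ofReal (‖planeFourier F k‖ ^ 2) ≤
      ENNReal.ofReal (4 * Real.pi ^ 2 * ∫ z, ‖F z‖ ^ 2) := by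
  have hm := (measurable_planeFourier hF.measurable)
  have hlim := lintegral_liminf_le (u := Filter.atTop) (μ := (volume : Measure (ℝ × ℝ)))
    (f := fun (n : ℕ) (k : ℝ × ℝ) => ENNReal.ofReal (Real.exp (-(1 / ((n : ℝ) + 1)) * k.1 ^ 2) *
      Real.exp (-(1 / ((n : ℝ) + 1)) * k.2 ^ 2) * ‖planeFourier F k‖ ^ 2)) (fun n => by fun_prop)
  have hpt : ∀ k : ℝ × ℝ, Filter.liminf (fun n : ℕ =>
      ENNReal.ofReal (Real.exp (-(1 / ((n : ℝ) + 1)) * k.1 ^ 2) *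
      Real.exp (-(1 / ((n : ℝ) + 1)) * k.2 ^ 2) * ‖planeFourier F k‖ ^ 2)) Filter.atTop =
      ENNReal.ofReal (‖planeFourier F k‖ ^ 2) := by
    intro k
    refine Filter.Tendsto.liminf_eq ?_
    refine ENNReal.tendsto_ofReal ?_
    have h0 : Filter.Tendsto (fun n : ℕ => 1 / ((n : ℝ) + 1)) Filter.atTop (nhds 0) :=
      tendsto_one_div_add_atTop_nhds_zero_nat
    have hc : Continuous fun e : ℝ => Real.exp (-e * k.1 ^ 2) * Real.exp (-e * k.2 ^ 2) *
      ‖planeFourier F k‖ ^ 2 := by fun_prop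
    have := (hc.tendsto 0).comp h0
    simpa [Function.comp_def] using this
  simp_rw [hpt] at hlim
  -- Fatou's lemma as `ε = 1/(n+1)` tends to zero; the Gaussian bound does not depend on `n`.
  refine hlim.trans (Filter.liminf_le_of_le (by isBoundedDefault) fun b hb => ?_)
  obtain ⟨n, hn⟩ := hb.exists
  exact hn.trans (integral_norm_planeFourier_sq_gaussian_le hF (by positivity))

end Bessel

end

/-! ### Analytic families and the fixed time estimate. -/

/-- An integrable regularisation of the indicator function of the half plane `ξ > 0`. -/
def freqCutoff (N ε : ℝ) (k : ℝ × ℝ) : ℝ :=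
  (Ioo 0 N).indicator (fun ξ => Real.exp (-ε * k.2 ^ 2 / ξ)) k.1

theorem freqCutoff_nonneg (N ε : ℝ) (k : ℝ × ℝ) : 0 ≤ freqCutoff N ε k :=
  indicator_nonneg (fun _ _ => (Real.exp_pos _).le) _

theorem freqCutoff_le_one (N : ℝ) {ε : ℝ} (hε : 0 < ε) (k : ℝ × ℝ) : freqCutoff N ε k ≤ 1 := by
  refine indicator_le' (fun ξ hξ => ?_) (fun _ _ => zero_le_one) k.1
  have : 0 < ξ := hξ.1
  refine Real.exp_le_one_iff.mpr ?_
  rw [neg_mul, neg_div, neg_nonpos]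
  positivity

theorem measurable_freqCutoff (N ε : ℝ) : Measurable (freqCutoff N ε) := by
  have : freqCutoff N ε = (Ioo 0 N ×ˢ univ).indicator
      fun k : ℝ × ℝ => Real.exp (-ε * k.2 ^ 2 / k.1) := by
    ext k
    simp [freqCutoff, indicator]
  rw [this]
  exact Measurable.indicator (by fun_prop) (measurableSet_Ioo.prod MeasurableSet.univ)

/-- For `0 < ξ < N` the factor `exp(-εμ²/ξ)` is below the Gaussian `exp(-εμ²/N)`, so the bound `N`
on `ξ` is what makes the cut-off integrable. -/
theorem integrable_freqCutoff (N : ℝ) {ε : ℝ} (hε : 0 < ε) : Integrable (freqCutoff N ε) := by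
  rcases le_or_gt N 0 with hN | hN
  · have : freqCutoff N ε = fun _ => 0 := by
      ext k; simp [freqCutoff, Ioo_eq_empty (not_lt.mpr hN)]
    rw [this]
    exact integrable_zero _ _ _
  have h1 : Integrable ((Ioo 0 N).indicator fun _ => (1 : ℝ)) := by
    rw [integrable_indicator_iff measurableSet_Ioo]
    exact integrableOn_const (by simp)
  have h2 : Integrable fun μ : ℝ => Real.exp (-(ε / N) * μ ^ 2) :=
    integrable_exp_neg_mul_sq (by positivity)
  refine (h1.mul_prod h2).mono' (measurable_freqCutoff N ε).aestronglyMeasurable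
    (Filter.Eventually.of_forall fun k => ?_)
  rw [Real.norm_of_nonneg (freqCutoff_nonneg _ _ _)]
  by_cases hk : k.1 ∈ Ioo 0 N
  · simp only [freqCutoff, indicator_of_mem hk, one_mul]
    refine Real.exp_le_exp.mpr ?_
    have h0 : 0 < k.1 := hk.1
    rw [neg_mul, neg_div, neg_mul, neg_le_neg_iff, div_mul_eq_mul_div]
    exact div_le_div_of_nonneg_left (by positivity) h0 hk.2.le
  · simp only [freqCutoff, indicator_of_notMem hk, zero_mul, le_refl]

/-- The symbol `ξ^z e^{itω(ξ,μ)}`, cut off to positive bounded `ξ`. -/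
def freqSymbol (α t N ε : ℝ) (z : ℂ) (k : ℝ × ℝ) : ℂ :=
  freqCutoff N ε k * Complex.exp (Complex.I * (t * omega α k.1 k.2 : ℝ)) *
    Complex.exp (z * Real.log k.1)

theorem measurable_omega (α : ℝ) : Measurable fun k : ℝ × ℝ => omega α k.1 k.2 := by
  unfold omega; fun_prop

theorem measurable_freqSymbol (α t N ε : ℝ) (z : ℂ) : Measurable (freqSymbol α t N ε z) := by
  have h1 := measurable_omega α
  have h2 := measurable_freqCutoff N ε
  unfold freqSymbol
  fun_prop

theorem norm_freqSymbol (α t N ε : ℝ) (z : ℂ) (k : ℝ × ℝ) :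
    ‖freqSymbol α t N ε z k‖ = freqCutoff N ε k * Real.exp (z.re * Real.log k.1) := by
  unfold freqSymbol
  rw [norm_mul, norm_mul, norm_cexp_I_mul, Complex.norm_real,
    Real.norm_of_nonneg (freqCutoff_nonneg _ _ _), Complex.norm_exp, mul_one]
  simp

theorem integrable_freqSymbol (α t N : ℝ) {ε : ℝ} (hε : 0 < ε) {z : ℂ} (hz : 0 ≤ z.re) :
    Integrable (freqSymbol α t N ε z) := by
  refine ((integrable_freqCutoff N hε).mul_const (Real.exp (z.re * Real.log N))).mono'
    (measurable_freqSymbol α t N ε z).aestronglyMeasurable (Filter.Eventually.of_forall fun k => ?_)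
  rw [norm_freqSymbol]
  by_cases hk : k.1 ∈ Ioo 0 N
  · have := freqCutoff_nonneg N ε k
    gcongr
    · exact hk.1
    · exact hk.2.le
  · simp [freqCutoff, indicator_of_notMem hk]

theorem integral_freqSymbol_eq (α t N : ℝ) {ε : ℝ} (hε : 0 < ε) (γ : ℝ) (w : ℝ × ℝ) :
    ∫ k, freqSymbol α t N ε (1 + γ * Complex.I) k * Complex.exp (Complex.I * dot k w) =
    ∫ ξ in Ioo 0 N, ∫ μ : ℝ, Complex.exp ((1 + γ * Complex.I) * Real.log ξ) *
      Complex.exp (Complex.I * (t * omega α ξ μ + w.1 * ξ + w.2 * μ : ℝ)) *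
      Real.exp (-ε * μ ^ 2 / ξ) := by
  have hi : Integrable fun k => freqSymbol α t N ε (1 + γ * Complex.I) k *
      Complex.exp (Complex.I * dot k w) := by
    refine (integrable_freqSymbol α t N hε (by simp)).mul_bdd (c := 1) ?_
      (Filter.Eventually.of_forall fun k => (norm_cexp_I_mul _).le)
    refine Measurable.aestronglyMeasurable ?_
    unfold dot; fun_prop
  rw [Measure.volume_eq_prod] at hi ⊢
  rw [integral_prod _ hi, ← integral_indicator measurableSet_Ioo]
  refine integral_congr_ae (Filter.Eventually.of_forall fun ξ => ?_)
  by_cases hξ : ξ ∈ Ioo 0 N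
  · simp only [indicator_of_mem hξ]
    refine integral_congr_ae (Filter.Eventually.of_forall fun μ => ?_)
    simp only [freqSymbol, freqCutoff, indicator_of_mem hξ, dot]
    have : Complex.exp (Complex.I * (t * omega α ξ μ + w.1 * ξ + w.2 * μ : ℝ)) =
        Complex.exp (Complex.I * (t * omega α ξ μ : ℝ)) *
        Complex.exp (Complex.I * (w.1 * ξ + w.2 * μ : ℝ)) := by
      rw [← Complex.exp_add]; congr 1; push_cast; ring
    rw [this]
    ring
  · simp only [indicator_of_notMem hξ]
    simp [freqSymbol, freqCutoff, indicator_of_notMem hξ]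

/-- The analytic family `|w|^{ρ(1+z)/2} sgn w`. -/
def powFamily (ρ : ℝ) (z : ℂ) (w : ℂ) : ℂ :=
  w / ‖w‖ * (‖w‖ ^ (ρ / 2) : ℝ) * Complex.exp (z * (ρ / 2 * Real.log ‖w‖ : ℝ))

theorem powFamily_zero (ρ : ℝ) (z : ℂ) : powFamily ρ z 0 = 0 := by simp [powFamily]

theorem measurable_powFamily (ρ : ℝ) (z : ℂ) : Measurable (powFamily ρ z) := by
  unfold powFamily; fun_prop

/-- The modulus does not see `Im z`. On `Re z = 0` its square is `|w|^ρ`, on `Re z = 1` it is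
`|w|^ρ` itself, so the `L²` and `L¹` norms needed on the two edges both reduce to `∫ |F|^ρ`. -/
theorem norm_powFamily {ρ : ℝ} (hρ : 0 < ρ) {z : ℂ} (hz : 0 ≤ z.re) (w : ℂ) :
    ‖powFamily ρ z w‖ = ‖w‖ ^ (ρ / 2 * (1 + z.re)) := by
  rcases eq_or_ne w 0 with rfl | hw
  · rw [powFamily_zero, norm_zero, Real.zero_rpow (by positivity)]
  have hw0 : 0 < ‖w‖ := norm_pos_iff.mpr hw
  unfold powFamily
  rw [norm_mul, norm_mul, norm_div, Complex.norm_real, norm_norm, div_self hw0.ne', one_mul,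
    Complex.norm_real, Real.norm_of_nonneg (by positivity), Complex.norm_exp,
    Complex.re_mul_ofReal, mul_add, Real.rpow_add hw0, mul_one]
  congr 1
  rw [Real.rpow_def_of_pos hw0]
  congr 1
  ring

theorem powFamily_eq_self {ρ θ : ℝ} (h : ρ / 2 * (1 + θ) = 1) (w : ℂ) :
    powFamily ρ θ w = w := by
  rcases eq_or_ne w 0 with rfl | hw
  · exact powFamily_zero _ _
  have hw0 : 0 < ‖w‖ := norm_pos_iff.mpr hw
  have hwC : (‖w‖ : ℂ) ≠ 0 := by exact_mod_cast hw0.ne'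
  have h1 : (‖w‖ ^ (ρ / 2) : ℝ) * Real.exp (θ * (ρ / 2 * Real.log ‖w‖)) = ‖w‖ := by
    have h2 : Real.exp (θ * (ρ / 2 * Real.log ‖w‖)) = ‖w‖ ^ (ρ / 2 * θ) := by
      rw [Real.rpow_def_of_pos hw0]; congr 1; ring
    rw [h2, ← Real.rpow_add hw0]
    have : ρ / 2 + ρ / 2 * θ = 1 := by rw [← h]; ring
    rw [this, Real.rpow_one]
  unfold powFamily
  rw [← Complex.ofReal_mul, ← Complex.ofReal_exp, mul_assoc, ← Complex.ofReal_mul, h1]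
  field_simp

theorem IsTest.powFamily {X : Type*} [NormedAddCommGroup X] [MeasurableSpace X] {F : X → ℂ}
    (hF : IsTest F) {ρ : ℝ} (hρ : 0 < ρ) {z : ℂ} (hz : 0 ≤ z.re) :
    IsTest (fun x => powFamily ρ z (F x)) := by
  refine hF.comp (measurable_powFamily ρ z) (powFamily_zero ρ z) fun M =>
    ⟨M ^ (ρ / 2 * (1 + z.re)), fun w hw => ?_⟩
  rw [norm_powFamily hρ hz]
  gcongr

/-- Cauchy–Schwarz and Bessel. This is the `L²` endpoint of the interpolation, where the symbol has
modulus at most 1. -/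
theorem norm_integral_planeFourier_mul_le {m F H : ℝ × ℝ → ℂ} (hm : ∀ k, ‖m k‖ ≤ 1)
    (hF : IsTest F) (hH : IsTest H) :
    ‖∫ k, m k * (planeFourier F k * planeFourier H (-k))‖ ≤
      4 * Real.pi ^ 2 * ((∫ z, ‖F z‖ ^ 2) ^ (1 / 2 : ℝ) * (∫ z, ‖H z‖ ^ 2) ^ (1 / 2 : ℝ)) := by
  have hFm := measurable_planeFourier hF.measurable
  have hHm := measurable_planeFourier hH.measurable
  have hI : ∀ G : ℝ × ℝ → ℂ, 0 ≤ ∫ z, ‖G z‖ ^ 2 := fun G => integral_nonneg fun z => by positivity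
  have hFI := hI F
  have hHI := hI H
  rw [← ENNReal.ofReal_le_ofReal_iff (by positivity), ofReal_norm]
  refine (enorm_integral_le_lintegral_enorm _).trans ?_
  have hsq : ∀ (c : ℂ), (‖c‖ₑ : ℝ≥0∞) ^ (2 : ℝ) = ENNReal.ofReal (‖c‖ ^ 2) := by
    intro c
    rw [← ofReal_norm, ENNReal.ofReal_rpow_of_nonneg (norm_nonneg _) (by norm_num)]
    norm_num
  calc ∫⁻ k, ‖m k * (planeFourier F k * planeFourier H (-k))‖ₑ
      ≤ ∫⁻ k, ((fun k => ‖planeFourier F k‖ₑ) * fun k => ‖planeFourier H (-k)‖ₑ) k := by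
        refine lintegral_mono fun k => ?_
        simp only [Pi.mul_apply, enorm_mul]
        refine mul_le_of_le_one_left' ?_
        rw [← ofReal_norm]
        exact ENNReal.ofReal_le_one.mpr (hm k)
    _ ≤ (∫⁻ k, ‖planeFourier F k‖ₑ ^ (2 : ℝ)) ^ (1 / 2 : ℝ) *
        (∫⁻ k, ‖planeFourier H (-k)‖ₑ ^ (2 : ℝ)) ^ (1 / 2 : ℝ) :=
        ENNReal.lintegral_mul_le_Lp_mul_Lq _ Real.HolderConjugate.two_two (by fun_prop)
          (by fun_prop)
    _ = (∫⁻ k, ENNReal.ofReal (‖planeFourier F k‖ ^ 2)) ^ (1 / 2 : ℝ) *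
        (∫⁻ k, ENNReal.ofReal (‖planeFourier H k‖ ^ 2)) ^ (1 / 2 : ℝ) := by
        simp_rw [hsq]
        rw [lintegral_neg_eq_self (fun k => ENNReal.ofReal (‖planeFourier H k‖ ^ 2))]
    _ ≤ (ENNReal.ofReal (4 * Real.pi ^ 2 * ∫ z, ‖F z‖ ^ 2)) ^ (1 / 2 : ℝ) *
        (ENNReal.ofReal (4 * Real.pi ^ 2 * ∫ z, ‖H z‖ ^ 2)) ^ (1 / 2 : ℝ) := by
        gcongr
        · exact lintegral_norm_planeFourier_sq_le hF
        · exact lintegral_norm_planeFourier_sq_le hH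
    _ = _ := by
        rw [ENNReal.ofReal_rpow_of_nonneg (by positivity) (by norm_num),
          ENNReal.ofReal_rpow_of_nonneg (by positivity) (by norm_num),
          ← ENNReal.ofReal_mul (by positivity), Real.mul_rpow (by positivity) hFI,
          Real.mul_rpow (by positivity) hHI]
        congr 1
        have : ((4 * Real.pi ^ 2) ^ (1 / 2 : ℝ)) * ((4 * Real.pi ^ 2) ^ (1 / 2 : ℝ)) =
            4 * Real.pi ^ 2 := by
          rw [← Real.sqrt_eq_rpow, Real.mul_self_sqrt (by positivity)]
        nth_rewrite 3 [← this]
        ring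

/-- The fixed time estimate: `|D_x|^θ e^{itω(D)}` maps `L^ρ` to `L^{ρ'}`, `ρ = 2/(1+θ)`, with norm
`O(|t|^{-θ})`. -/
theorem exists_fixed_time_estimate (α : ℝ) {θ : ℝ} (hθ0 : 0 ≤ θ) (hθ1 : θ ≤ 1) :
    ∃ C : ℝ, 0 < C ∧ ∀ (t N ε : ℝ) (F H : ℝ × ℝ → ℂ), t ≠ 0 → |t| ≤ 2 → 0 < ε → IsTest F → IsTest H →
      ‖∫ k, freqSymbol α t N ε θ k * (planeFourier F k * planeFourier H (-k))‖ ≤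
        C * ((∫ z, ‖F z‖ ^ (2 / (1 + θ))) ^ ((1 + θ) / 2) *
          (∫ z, ‖H z‖ ^ (2 / (1 + θ))) ^ ((1 + θ) / 2) * |t| ^ (-θ)) := by
  obtain ⟨C, hC, hK⟩ := exists_norm_dispersive_kernel_le α
  refine ⟨6 * ((4 * Real.pi ^ 2) ^ (1 - θ) * C ^ θ), by positivity,
    fun t N ε F H ht ht2 hε hF hH => ?_⟩
  have ht0 : 0 < |t| := abs_pos.mpr ht
  set ρ : ℝ := 2 / (1 + θ) with hρd
  have hρ : 0 < ρ := by positivity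
  have hρθ : ρ / 2 * (1 + θ) = 1 := by rw [hρd]; field_simp
  set A := ∫ z, ‖F z‖ ^ ρ with hA
  set B := ∫ z, ‖H z‖ ^ ρ with hB
  have hA0 : 0 ≤ A := integral_nonneg fun z => by positivity
  have hB0 : 0 ≤ B := integral_nonneg fun z => by positivity
  -- The whole dependence on `z`, in both functions and in the symbol, is collected into one factor
  -- `exp(z l)`. The values of `Real.log` at zeros of `F` or `H` and at `ξ ≤ 0` are irrelevant,
  -- since `b` vanishes there.
  set b : ((ℝ × ℝ) × (ℝ × ℝ)) × (ℝ × ℝ) → ℂ := fun p =>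
    powFamily ρ 0 (F p.1.1) * powFamily ρ 0 (H p.1.2) *
      (freqSymbol α t N ε 0 p.2 * Complex.exp (Complex.I * dot p.2 (p.1.1 - p.1.2))) with hb
  set l : ((ℝ × ℝ) × (ℝ × ℝ)) × (ℝ × ℝ) → ℝ := fun p =>
    ρ / 2 * Real.log ‖F p.1.1‖ + ρ / 2 * Real.log ‖H p.1.2‖ + Real.log p.2.1 with hl
  have hFm := hF.measurable
  have hHm := hH.measurable
  have hlm : Measurable l := by simp only [hl]; fun_prop
  have hbl : ∀ (z : ℂ) p, b p * Complex.exp (z * l p) =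
      powFamily ρ z (F p.1.1) * powFamily ρ z (H p.1.2) *
      (freqSymbol α t N ε z p.2 * Complex.exp (Complex.I * dot p.2 (p.1.1 - p.1.2))) := by
    intro z p
    have : Complex.exp (z * l p) = Complex.exp (z * (ρ / 2 * Real.log ‖F p.1.1‖ : ℝ)) *
        Complex.exp (z * (ρ / 2 * Real.log ‖H p.1.2‖ : ℝ)) * Complex.exp (z * Real.log p.2.1) := by
      rw [← Complex.exp_add, ← Complex.exp_add]
      congr 1
      simp only [hl]
      push_cast
      ring
    rw [this]
    simp only [hb, powFamily, freqSymbol, zero_mul, Complex.exp_zero, mul_one]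
    ring
  have hFi : ∀ z : ℂ, 0 ≤ z.re → Integrable fun x => powFamily ρ z (F x) := fun z hz =>
    (hF.powFamily hρ hz).integrable volume
  have hHi : ∀ z : ℂ, 0 ≤ z.re → Integrable fun x => powFamily ρ z (H x) := fun z hz =>
    (hH.powFamily hρ hz).integrable volume
  have hbi : ∀ z : ℂ, 0 ≤ z.re → Integrable (fun p => b p * Complex.exp (z * l p))
      ((volume.prod volume).prod volume) := by
    intro z hz
    simp_rw [hbl]
    exact integrable_expansion (σ := volume) (m := freqSymbol α t N ε z)
      (F := fun x => powFamily ρ z (F x)) (H := fun x => powFamily ρ z (H x))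
      (integrable_freqSymbol α t N hε hz) (hFi z hz) (hHi z hz)
  have hfourier : ∀ z : ℂ, 0 ≤ z.re → ∫ p, b p * Complex.exp (z * l p)
      ∂((volume.prod volume).prod volume) = ∫ k, freqSymbol α t N ε z k *
        (planeFourier (fun x => powFamily ρ z (F x)) k *
          planeFourier (fun x => powFamily ρ z (H x)) (-k)) := by
    intro z hz
    simp_rw [hbl]
    exact integral_expansion_eq_fourier (σ := volume) (m := freqSymbol α t N ε z)
      (F := fun x => powFamily ρ z (F x)) (H := fun x => powFamily ρ z (H x))
      (integrable_freqSymbol α t N hε hz) (hFi z hz) (hHi z hz)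
  have hleft : ∀ γ : ℝ, ‖∫ p, b p * Complex.exp (γ * Complex.I * l p)
      ∂((volume.prod volume).prod volume)‖ ≤
      4 * Real.pi ^ 2 * (A ^ (1 / 2 : ℝ) * B ^ (1 / 2 : ℝ)) := by
    intro γ
    have hre : ((γ : ℂ) * Complex.I).re = 0 := by simp
    rw [hfourier _ hre.ge]
    refine (norm_integral_planeFourier_mul_le (fun k => ?_) (hF.powFamily hρ hre.ge)
      (hH.powFamily hρ hre.ge)).trans (le_of_eq ?_)
    · rw [norm_freqSymbol, hre, zero_mul, Real.exp_zero, mul_one]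
      exact freqCutoff_le_one N hε k
    · have h1 : ∀ w : ℂ, ‖powFamily ρ (γ * Complex.I) w‖ ^ 2 = ‖w‖ ^ ρ := by
        intro w
        rw [norm_powFamily hρ hre.ge, hre, ← Real.rpow_natCast, ← Real.rpow_mul (norm_nonneg _)]
        congr 1
        push_cast
        ring
      simp_rw [h1]
      rfl
  have hright : ∀ γ : ℝ, ‖∫ p, b p * Complex.exp ((1 + γ * Complex.I) * l p)
      ∂((volume.prod volume).prod volume)‖ ≤ C / |t| * (A * B) * (1 + |γ|) := by
    intro γ
    have hre : ((1 : ℂ) + γ * Complex.I).re = 1 := by simp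
    have hre0 : 0 ≤ ((1 : ℂ) + γ * Complex.I).re := by rw [hre]; norm_num
    simp_rw [hbl]
    rw [integral_expansion_eq_kernel (σ := volume) (m := freqSymbol α t N ε (1 + γ * Complex.I))
      (F := fun x => powFamily ρ (1 + γ * Complex.I) (F x))
      (H := fun x => powFamily ρ (1 + γ * Complex.I) (H x)) (integrable_freqSymbol α t N hε hre0) (hFi _ hre0)
      (hHi _ hre0)]
    have h1 : ∀ w : ℂ, ‖powFamily ρ (1 + γ * Complex.I) w‖ = ‖w‖ ^ ρ := by
      intro w
      rw [norm_powFamily hρ hre0, hre]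
      congr 1
      ring
    calc _ ≤ ∫ q : (ℝ × ℝ) × (ℝ × ℝ), ‖F q.1‖ ^ ρ * ‖H q.2‖ ^ ρ * (C * (1 + |γ|) / |t|)
          ∂(volume.prod volume) := by
          refine norm_integral_le_of_norm_le ?_ (Filter.Eventually.of_forall fun q => ?_)
          · exact ((hF.integrable_rpow volume hρ).mul_prod (hH.integrable_rpow volume hρ)).mul_const _
          · rw [norm_mul, norm_mul, h1, h1, integral_freqSymbol_eq α t N hε]
            gcongr
            exact hK t γ ε N _ _ ht ht2 hε
      _ = A * B * (C * (1 + |γ|) / |t|) := by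
          rw [integral_mul_const, integral_prod_mul (fun z => ‖F z‖ ^ ρ) (fun z => ‖H z‖ ^ ρ)]
      _ = _ := by ring
  have h := norm_integral_cexp_le_interp (ν := (volume.prod volume).prod volume) (b := b) hlm
    (by simpa using hbi 0 (by simp)) (by simpa using hbi 1 (by simp)) hθ0 hθ1
    (by positivity) hleft hright
  have hθre : 0 ≤ (θ : ℂ).re := by simpa using hθ0
  rw [hfourier _ hθre] at h
  simp_rw [powFamily_eq_self hρθ] at h
  refine h.trans (le_of_eq ?_)
  rw [Real.mul_rpow (by positivity) (by positivity), Real.mul_rpow (by positivity) (by positivity),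
    Real.mul_rpow (by positivity) (by positivity),
    Real.mul_rpow (x := C / |t|) (by positivity) (by positivity), Real.div_rpow hC.le ht0.le,
    Real.mul_rpow hA0 hB0, ← Real.rpow_mul hA0, ← Real.rpow_mul hB0, Real.rpow_neg ht0.le]
  -- The edges contribute `A^{(1-θ)/2}` and `A^θ`, whose product is the `L^ρ` norm because `1/ρ =
  -- (1+θ)/2`.
  have hpow : ∀ x : ℝ, 0 ≤ x → x ^ ((1 + θ) / 2) = x ^ (1 / 2 * (1 - θ)) * x ^ θ := by
    intro x hx
    rw [← Real.rpow_add_of_nonneg hx (by nlinarith) hθ0]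
    congr 1
    ring
  rw [hpow A hA0, hpow B hB0]
  field_simp

/-! ### Restriction to the characteristic surface by `TT*`. -/

section

/-- The space-time Fourier integral with kernel `exp(i(k·z + tτ))`. -/
def spaceTimeFourier (F : (ℝ × ℝ) × ℝ → ℂ) (q : (ℝ × ℝ) × ℝ) : ℂ :=
  ∫ p : (ℝ × ℝ) × ℝ, Complex.exp (Complex.I * (dot q.1 p.1 + p.2 * q.2 : ℝ)) * F p

/-- `‖F(·,t)‖_{L^ρ}` for `ρ = 2/(1+θ)`. -/
def sliceNorm (θ : ℝ) (F : (ℝ × ℝ) × ℝ → ℂ) (t : ℝ) : ℝ :=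
  (∫ z, ‖F (z, t)‖ ^ (2 / (1 + θ))) ^ ((1 + θ) / 2)

/-- The norm of `F` in `L^p_t L^ρ` for `p = 2/(2-θ)` and `ρ = 2/(1+θ)`. -/
def dualNorm (θ : ℝ) (F : (ℝ × ℝ) × ℝ → ℂ) : ℝ :=
  (∫ t, sliceNorm θ F t ^ (2 / (2 - θ))) ^ ((2 - θ) / 2)

theorem sliceNorm_nonneg (θ : ℝ) (F : (ℝ × ℝ) × ℝ → ℂ) (t : ℝ) : 0 ≤ sliceNorm θ F t :=
  Real.rpow_nonneg (integral_nonneg fun _ => by positivity) _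

theorem dualNorm_nonneg (θ : ℝ) (F : (ℝ × ℝ) × ℝ → ℂ) : 0 ≤ dualNorm θ F :=
  Real.rpow_nonneg (integral_nonneg fun t => Real.rpow_nonneg (sliceNorm_nonneg θ F t) _) _

variable {F : (ℝ × ℝ) × ℝ → ℂ}

theorem IsTest.slice (hF : IsTest F) (t : ℝ) : IsTest fun z => F (z, t) := by
  refine ⟨hF.measurable.comp (by fun_prop), ?_, ?_⟩
  · obtain ⟨M, hM⟩ := hF.bounded
    exact ⟨M, fun z => hM _⟩
  · obtain ⟨R, hR⟩ := hF.bounded_support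
    exact ⟨R, fun z hz => (norm_fst_le (z, t)).trans (hR _ hz)⟩

theorem measurable_sliceNorm (hF : Measurable F) (θ : ℝ) : Measurable (sliceNorm θ F) := by
  unfold sliceNorm
  have h : Measurable fun t => ∫ z, ‖F (z, t)‖ ^ (2 / (1 + θ)) := by
    refine (StronglyMeasurable.integral_prod_right (f := fun (t : ℝ) (z : ℝ × ℝ) =>
      ‖F (z, t)‖ ^ (2 / (1 + θ))) ?_).measurable
    refine Measurable.stronglyMeasurable ?_
    simp only [Function.uncurry_def]
    fun_prop
  fun_prop

theorem sliceNorm_eq_zero {θ : ℝ} (hθ : -1 < θ) {t : ℝ} (h : ∀ z, F (z, t) = 0) :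
    sliceNorm θ F t = 0 := by
  have : 0 < 1 + θ := by linarith
  unfold sliceNorm
  simp only [h, norm_zero]
  rw [Real.zero_rpow (by positivity), integral_zero, Real.zero_rpow (by positivity)]

/-- The cast to `ℂ` makes the function of slice norms a test function in time, so its powers are
integrable. The range `θ > -1` leaves room for `-θ`, which is used for the conjugate exponent. -/
theorem IsTest.sliceNorm (hF : IsTest F) {θ : ℝ} (hθ : -1 < θ) :
    IsTest fun t => (sliceNorm θ F t : ℂ) := by
  obtain ⟨M, R, hM, hR, h⟩ := hF.exists_bound
  have hθ' : 0 < 1 + θ := by linarith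
  have hρ : 0 < 2 / (1 + θ) := by positivity
  have hF0 : ∀ z t, ¬ (‖z‖ ≤ R ∧ ‖t‖ ≤ R) → F (z, t) = 0 := by
    intro z t hzt
    have h1 := h (z, t)
    rw [indicator_of_notMem] at h1
    · exact norm_le_zero_iff.mp h1
    · rw [mem_closedBall_zero_iff, Prod.norm_mk, max_le_iff]
      exact hzt
  refine ⟨Complex.measurable_ofReal.comp (measurable_sliceNorm hF.measurable θ), ?_, R, ?_⟩
  · have hi : Integrable ((Metric.closedBall (0 : ℝ × ℝ) R).indicator fun _ => M ^ (2 / (1 + θ))) := by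
      rw [integrable_indicator_iff Metric.isClosed_closedBall.measurableSet]
      exact integrableOn_const (isCompact_closedBall (0 : ℝ × ℝ) R).measure_lt_top.ne
    refine ⟨(∫ z, (Metric.closedBall (0 : ℝ × ℝ) R).indicator (fun _ => M ^ (2 / (1 + θ))) z) ^
      ((1 + θ) / 2), fun t => ?_⟩
    rw [Complex.norm_real, Real.norm_of_nonneg (sliceNorm_nonneg _ _ _)]
    unfold KP.sliceNorm
    refine Real.rpow_le_rpow (integral_nonneg fun _ => by positivity) ?_ (by positivity)
    refine integral_mono ((hF.slice t).integrable_rpow volume hρ) hi fun z => ?_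
    by_cases hz : ‖z‖ ≤ R
    · rw [indicator_of_mem (mem_closedBall_zero_iff.mpr hz)]
      refine Real.rpow_le_rpow (norm_nonneg _) ((h _).trans ?_) hρ.le
      exact indicator_le_self' (fun _ _ => hM) _
    · simp only []
      rw [hF0 z t fun h => hz h.1, norm_zero, Real.zero_rpow hρ.ne']
      exact indicator_nonneg (fun _ _ => by positivity) _
  · intro t ht
    by_contra hR
    exact ht (by rw [sliceNorm_eq_zero hθ fun z => hF0 z t fun h => hR h.2, Complex.ofReal_zero])

theorem IsTest.integrable_sliceNorm_rpow (hF : IsTest F) {θ p : ℝ} (hθ : -1 < θ) (hp : 0 < p) :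
    Integrable fun t => KP.sliceNorm θ F t ^ p := by
  have := (hF.sliceNorm hθ).integrable_rpow volume hp
  simpa only [Complex.norm_real, Real.norm_of_nonneg (sliceNorm_nonneg _ _ _)] using this

theorem spaceTimeFourier_eq (hF : IsTest F) (k : ℝ × ℝ) (τ : ℝ) :
    spaceTimeFourier F (k, τ) =
      ∫ t, Complex.exp (Complex.I * (t * τ : ℝ)) * planeFourier (fun z => F (z, t)) k := by
  unfold spaceTimeFourier planeFourier
  have hi : Integrable (fun p : (ℝ × ℝ) × ℝ =>
      Complex.exp (Complex.I * (dot k p.1 + p.2 * τ : ℝ)) * F p) := by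
    refine (hF.integrable volume).bdd_mul (c := 1) ?_
      (Filter.Eventually.of_forall fun p => (norm_cexp_I_mul _).le)
    refine Measurable.aestronglyMeasurable ?_
    unfold dot; fun_prop
  rw [Measure.volume_eq_prod] at hi ⊢
  simp only []
  rw [integral_prod_symm _ hi]
  refine integral_congr_ae (Filter.Eventually.of_forall fun t => ?_)
  simp only []
  rw [← integral_const_mul]
  refine integral_congr_ae (Filter.Eventually.of_forall fun z => ?_)
  simp only []
  rw [← mul_assoc, ← Complex.exp_add]
  congr 2
  push_cast
  ring

theorem measurable_spaceTimeFourier (hF : Measurable F) : Measurable (spaceTimeFourier F) := by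
  unfold spaceTimeFourier
  refine (StronglyMeasurable.integral_prod_right (f := fun (q p : (ℝ × ℝ) × ℝ) =>
    Complex.exp (Complex.I * (dot q.1 p.1 + p.2 * q.2 : ℝ)) * F p) ?_).measurable
  refine Measurable.stronglyMeasurable ?_
  simp only [Function.uncurry_def, dot]
  fun_prop

theorem spaceTimeFourier_conj (F : (ℝ × ℝ) × ℝ → ℂ) (q : (ℝ × ℝ) × ℝ) :
    spaceTimeFourier (fun p => (starRingEnd ℂ) (F p)) (-q) =
      (starRingEnd ℂ) (spaceTimeFourier F q) := by
  unfold spaceTimeFourier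
  rw [← integral_conj]
  refine integral_congr_ae (Filter.Eventually.of_forall fun z => ?_)
  simp only [map_mul, ← Complex.exp_conj, Complex.conj_I, Complex.conj_ofReal, dot]
  simp only [Prod.fst_neg, Prod.snd_neg]
  push_cast
  ring_nf

theorem measurable_planeFourier_slice (hF : Measurable F) :
    Measurable fun p : (ℝ × ℝ) × ℝ => planeFourier (fun z => F (z, p.2)) p.1 := by
  unfold planeFourier
  refine (StronglyMeasurable.integral_prod_right (f := fun (p : (ℝ × ℝ) × ℝ) (z : ℝ × ℝ) =>
    Complex.exp (Complex.I * dot p.1 z) * F (z, p.2)) ?_).measurable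
  refine Measurable.stronglyMeasurable ?_
  simp only [Function.uncurry_def, dot]
  fun_prop

theorem freqSymbol_ofReal_mul (α t N ε θ : ℝ) (k : ℝ × ℝ) :
    freqSymbol α t N ε θ k = ((freqCutoff N ε k * Real.exp (θ * Real.log k.1) : ℝ) : ℂ) *
      Complex.exp (Complex.I * (t * omega α k.1 k.2 : ℝ)) := by
  unfold freqSymbol
  push_cast
  ring

/-- The `TT*` identity. -/
theorem integral_cutoff_spaceTimeFourier_sq (α : ℝ) {θ : ℝ} (hθ : 0 ≤ θ) (N : ℝ) {ε : ℝ}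
    (hε : 0 < ε) (hF : IsTest F) (s : ℝ) :
    Integrable (fun k : ℝ × ℝ => freqCutoff N ε k * Real.exp (θ * Real.log k.1) *
      ‖spaceTimeFourier F (k, omega α k.1 k.2 + s)‖ ^ 2) ∧
    ((∫ k : ℝ × ℝ, freqCutoff N ε k * Real.exp (θ * Real.log k.1) *
      ‖spaceTimeFourier F (k, omega α k.1 k.2 + s)‖ ^ 2 : ℝ) : ℂ) =
    ∫ p : ℝ × ℝ, Complex.exp (Complex.I * ((p.1 - p.2) * s : ℝ)) *
      ∫ k, freqSymbol α (p.1 - p.2) N ε θ k * (planeFourier (fun z => F (z, p.1)) k *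
        planeFourier (fun z => (starRingEnd ℂ) (F (z, p.2))) (-k)) ∂volume := by
  have hFm := hF.measurable
  have hω := measurable_omega α
  set W : ℝ × ℝ → ℝ := fun k => freqCutoff N ε k * Real.exp (θ * Real.log k.1) with hW
  have hW0 : ∀ k, 0 ≤ W k := fun k => mul_nonneg (freqCutoff_nonneg _ _ _) (Real.exp_pos _).le
  have hWm : Measurable W := by
    have := measurable_freqCutoff N ε
    simp only [hW]; fun_prop
  have hWi : Integrable W := by
    have h := (integrable_freqSymbol α 0 N hε (z := (θ : ℂ)) (by simpa using hθ)).norm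
    refine h.congr (Filter.Eventually.of_forall fun k => ?_)
    simp only [norm_freqSymbol, Complex.ofReal_re, hW]
  set n : ℝ → ℝ := fun t => ∫ z, ‖F (z, t)‖ with hn
  have hni : Integrable n := by
    have := (hF.integrable volume).norm
    rw [Measure.volume_eq_prod] at this
    exact this.integral_prod_right
  have hP : ∀ k t, ‖planeFourier (fun z => F (z, t)) k‖ ≤ n t := fun k t => norm_planeFourier_le _ _
  set A : ℝ × ℝ → ℝ → ℂ := fun k t => Complex.exp (Complex.I * (t * (omega α k.1 k.2 + s) : ℝ)) *
    planeFourier (fun z => F (z, t)) k with hA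
  have hAm : Measurable fun p : (ℝ × ℝ) × ℝ => A p.1 p.2 := by
    have h1 := measurable_planeFourier_slice hFm
    have h2 : Measurable fun p : (ℝ × ℝ) × ℝ => omega α p.1.1 p.1.2 := hω.comp measurable_fst
    simp only [hA]
    fun_prop
  have hAn : ∀ k t, ‖A k t‖ ≤ n t := fun k t => by
    simp only [hA, norm_mul, norm_cexp_I_mul, one_mul]; exact hP k t
  have hST : ∀ k, spaceTimeFourier F (k, omega α k.1 k.2 + s) = ∫ t, A k t := fun k =>
    spaceTimeFourier_eq hF k _
  set n₁ := ∫ t, n t with hn1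
  have hSTn : ∀ k, ‖∫ t, A k t‖ ≤ n₁ := fun k =>
    norm_integral_le_of_norm_le hni (Filter.Eventually.of_forall fun t => hAn k t)
  have hSTm : Measurable fun k : ℝ × ℝ => ∫ t, A k t :=
    (StronglyMeasurable.integral_prod_right (f := A) hAm.stronglyMeasurable).measurable
  have hsq : ∀ k, ((W k * ‖spaceTimeFourier F (k, omega α k.1 k.2 + s)‖ ^ 2 : ℝ) : ℂ) =
      ∫ p : ℝ × ℝ, (W k : ℂ) * (A k p.1 * (starRingEnd ℂ) (A k p.2)) := by
    intro k
    rw [hST, integral_const_mul, Measure.volume_eq_prod, integral_prod_mul (fun t => A k t)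
      (fun t => (starRingEnd ℂ) (A k t)), integral_conj, Complex.mul_conj,
      Complex.normSq_eq_norm_sq]
    push_cast
    rfl
  constructor
  · refine hWi.mul_bdd (c := n₁ ^ 2) ?_ (Filter.Eventually.of_forall fun k => ?_)
    · simp_rw [hST]
      exact (hSTm.norm.pow_const 2).aestronglyMeasurable
    · rw [norm_pow, norm_norm, hST]
      gcongr
      exact hSTn k
  rw [← integral_complex_ofReal]
  have hcongr : ∀ k : ℝ × ℝ, ((freqCutoff N ε k * Real.exp (θ * Real.log k.1) *
      ‖spaceTimeFourier F (k, omega α k.1 k.2 + s)‖ ^ 2 : ℝ) : ℂ) =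
      ∫ p : ℝ × ℝ, (W k : ℂ) * (A k p.1 * (starRingEnd ℂ) (A k p.2)) := hsq
  simp_rw [hcongr]
  -- With the frequency integral innermost, the phases at the two times merge into the symbol at
  -- time `p.1 - p.2` and the unimodular factor `exp(i(p.1 - p.2)s)`.
  rw [integral_integral_swap]
  · refine integral_congr_ae (Filter.Eventually.of_forall fun p => ?_)
    simp only []
    rw [← integral_const_mul]
    refine integral_congr_ae (Filter.Eventually.of_forall fun k => ?_)
    simp only []
    rw [planeFourier_conj, freqSymbol_ofReal_mul]
    simp only [hA, map_mul, ← Complex.exp_conj, Complex.conj_I, Complex.conj_ofReal]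
    have : Complex.exp (Complex.I * ((p.1 - p.2) * s : ℝ)) *
        Complex.exp (Complex.I * ((p.1 - p.2) * omega α k.1 k.2 : ℝ)) =
        Complex.exp (Complex.I * (p.1 * (omega α k.1 k.2 + s) : ℝ)) *
        Complex.exp (-Complex.I * (p.2 * (omega α k.1 k.2 + s) : ℝ)) := by
      rw [← Complex.exp_add, ← Complex.exp_add]
      congr 1
      push_cast
      ring
    linear_combination (-(W k : ℂ) * planeFourier (fun z => F (z, p.1)) k *
      (starRingEnd ℂ) (planeFourier (fun z => F (z, p.2)) k)) * this
  · have hb : Integrable (fun q : (ℝ × ℝ) × (ℝ × ℝ) => W q.1 * (n q.2.1 * n q.2.2))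
        (volume.prod volume) := by
      have := hWi.mul_prod (hni.mul_prod hni)
      simpa [Measure.volume_eq_prod] using this
    refine hb.mono' ?_ (Filter.Eventually.of_forall fun q => ?_)
    · refine Measurable.aestronglyMeasurable ?_
      have h1 : Measurable fun q : (ℝ × ℝ) × (ℝ × ℝ) => A q.1 q.2.1 :=
        hAm.comp (measurable_fst.prodMk (measurable_fst.comp measurable_snd))
      have h2 : Measurable fun q : (ℝ × ℝ) × (ℝ × ℝ) => (starRingEnd ℂ) (A q.1 q.2.2) :=
        Complex.continuous_conj.measurable.comp
          (hAm.comp (measurable_fst.prodMk (measurable_snd.comp measurable_snd)))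
      exact (Complex.measurable_ofReal.comp (hWm.comp measurable_fst)).mul (h1.mul h2)
    · simp only [Function.uncurry_def]
      rw [norm_mul, norm_mul, RCLike.norm_conj, Complex.norm_real, Real.norm_of_nonneg (hW0 _)]
      have hn0 : 0 ≤ n q.2.1 := (norm_nonneg _).trans (hAn q.1 q.2.1)
      exact mul_le_mul_of_nonneg_left
        (mul_le_mul (hAn _ _) (hAn _ _) (norm_nonneg _) hn0) (hW0 _)

/-- The `TT*` identity, the fixed time estimate at each pair of times, and Hardy–Littlewood–Sobolev
with exponent `θ < 1`. The shift `s` enters only through a unimodular factor, so the constant is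
uniform in `s` as well as in `N` and `ε`. The support condition keeps time differences at most 2. -/
theorem exists_cutoff_restriction_estimate (α : ℝ) {θ : ℝ} (hθ0 : 0 ≤ θ) (hθ1 : θ < 1) :
    ∃ C : ℝ, 0 < C ∧ ∀ (N ε s : ℝ) (F : (ℝ × ℝ) × ℝ → ℂ), 0 < ε → IsTest F →
      (∀ z t, F (z, t) ≠ 0 → |t| ≤ 1) →
      ∫⁻ k : ℝ × ℝ, ENNReal.ofReal (freqCutoff N ε k * Real.exp (θ * Real.log k.1) *
        ‖spaceTimeFourier F (k, omega α k.1 k.2 + s)‖ ^ 2) ≤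
        ENNReal.ofReal (C * dualNorm θ F ^ 2) := by
  obtain ⟨C, hC, hfix⟩ := exists_fixed_time_estimate α hθ0 hθ1.le
  have h1θ : 0 < 1 - θ := by linarith
  refine ⟨C * (2 * (2 / (1 - θ) + 2)), by positivity, fun N ε s F hε hF hsupp => ?_⟩
  obtain ⟨hi, heq⟩ := integral_cutoff_spaceTimeFourier_sq α hθ0 N hε hF s
  rw [← ofReal_integral_eq_lintegral_ofReal hi (Filter.Eventually.of_forall fun k =>
    mul_nonneg (mul_nonneg (freqCutoff_nonneg _ _ _) (Real.exp_pos _).le) (by positivity))]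
  refine (ENNReal.ofReal_le_ofReal (le_abs_self _)).trans ?_
  rw [← Real.norm_eq_abs, ← Complex.norm_real, heq, ofReal_norm]
  refine (enorm_integral_le_lintegral_enorm _).trans ?_
  set h := sliceNorm θ F with hh
  have hhm : Measurable h := measurable_sliceNorm hF.measurable θ
  have hconj : ∀ t, (∫ z, ‖(starRingEnd ℂ) (F (z, t))‖ ^ (2 / (1 + θ))) ^ ((1 + θ) / 2) = h t := by
    intro t
    simp only [RCLike.norm_conj, hh, sliceNorm]
  have hzero : ∀ t, 1 < |t| → ∀ z, F (z, t) = 0 := fun t ht z => by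
    by_contra hz
    exact absurd (hsupp z t hz) (not_le.mpr ht)
  have hpt : ∀ t s' : ℝ, s' ≠ t → ‖Complex.exp (Complex.I * ((t - s') * s : ℝ)) *
      ∫ k, freqSymbol α (t - s') N ε θ k * (planeFourier (fun z => F (z, t)) k *
        planeFourier (fun z => (starRingEnd ℂ) (F (z, s'))) (-k))‖ₑ ≤
      ENNReal.ofReal (C * (h t * h s' * |t - s'| ^ (-θ))) := by
    intro t s' hts
    rw [← ofReal_norm]
    refine ENNReal.ofReal_le_ofReal ?_
    rw [norm_mul, norm_cexp_I_mul, one_mul]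
    by_cases ht : 1 < |t|
    · have h0 : planeFourier (fun z => F (z, t)) = fun _ => 0 := by
        ext k; simp [planeFourier, hzero t ht]
      rw [h0]
      simp only [zero_mul, mul_zero, integral_zero, norm_zero]
      have := sliceNorm_nonneg θ F
      have h1 := this t
      have h2 := this s'
      positivity
    by_cases hs : 1 < |s'|
    · have h0 : planeFourier (fun z => (starRingEnd ℂ) (F (z, s'))) = fun _ => 0 := by
        ext k; simp [planeFourier, hzero s' hs]
      rw [h0]
      simp only [mul_zero, integral_zero, norm_zero]
      have := sliceNorm_nonneg θ F
      have h1 := this t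
      have h2 := this s'
      positivity
    have hle : |t - s'| ≤ 2 := by
      calc |t - s'| ≤ |t| + |s'| := abs_sub _ _
        _ ≤ 2 := by linarith
    have := hfix (t - s') N ε _ _ (sub_ne_zero.mpr hts.symm) hle hε (hF.slice t) (hF.slice s').conj
    rwa [hconj] at this
  have hls := hardy_littlewood_sobolev hθ0 hθ1 hhm (sliceNorm_nonneg θ F)
    (hF.integrable_sliceNorm_rpow (neg_one_lt_zero.trans_le hθ0) 
      (div_pos two_pos (by linarith)))
  -- The dispersive bound says nothing at equal times, but the diagonal is a null set.
  have hdiag : ∀ᵐ p : ℝ × ℝ, p.2 ≠ p.1 := by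
    rw [Measure.volume_eq_prod]
    refine (Measure.ae_prod_iff_ae_ae (p := fun p : ℝ × ℝ => p.2 ≠ p.1) ?_).mpr
      (Filter.Eventually.of_forall fun t => ?_)
    · exact (measurableSet_eq_fun measurable_snd measurable_fst).compl
    · exact Measure.ae_ne volume t
  refine (lintegral_mono_ae (g := fun p : ℝ × ℝ =>
    ENNReal.ofReal (C * (h p.1 * h p.2 * |p.1 - p.2| ^ (-θ)))) ?_).trans ?_
  · filter_upwards [hdiag] with p hp
    exact hpt p.1 p.2 hp
  have hm2 : Measurable fun p : ℝ × ℝ => ENNReal.ofReal (h p.1 * h p.2 * |p.1 - p.2| ^ (-θ)) := by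
    fun_prop
  simp_rw [ENNReal.ofReal_mul hC.le]
  rw [lintegral_const_mul _ hm2, Measure.volume_eq_prod, lintegral_prod _ hm2.aemeasurable]
  refine (mul_le_mul_right hls _).trans (le_of_eq ?_)
  have h0 : 0 ≤ ∫ t, h t ^ (2 / (2 - θ)) :=
    integral_nonneg fun t => Real.rpow_nonneg (sliceNorm_nonneg θ F t) _
  have hD : dualNorm θ F ^ 2 = (∫ t, h t ^ (2 / (2 - θ))) ^ (2 - θ) := by
    unfold dualNorm
    rw [← Real.rpow_natCast, ← Real.rpow_mul h0]
    congr 1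
    push_cast
    ring
  rw [hD, ← ENNReal.ofReal_mul hC.le]
  congr 1
  ring

end

/-! ### Removing the cut-off and thickening the surface. -/

theorem tendsto_freqCutoff {k : ℝ × ℝ} (hk : 0 < k.1) :
    Filter.Tendsto (fun n : ℕ => freqCutoff n (1 / ((n : ℝ) + 1)) k) Filter.atTop (nhds 1) := by
  have h0 : Filter.Tendsto (fun n : ℕ => 1 / ((n : ℝ) + 1)) Filter.atTop (nhds 0) :=
    tendsto_one_div_add_atTop_nhds_zero_nat
  have hc : Continuous fun e : ℝ => Real.exp (-e * k.2 ^ 2 / k.1) := by fun_prop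
  have h1 := (hc.tendsto 0).comp h0
  simp only [neg_zero, zero_mul, zero_div, Real.exp_zero] at h1
  refine h1.congr' ?_
  obtain ⟨n₀, hn₀⟩ := exists_nat_gt k.1
  filter_upwards [Filter.eventually_ge_atTop n₀] with n hn
  have hmem : k.1 ∈ Ioo (0 : ℝ) n := ⟨hk, hn₀.trans_le (by exact_mod_cast hn)⟩
  simp only [freqCutoff, indicator_of_mem hmem, Function.comp]

/-- Fatou's lemma in the cut-off, whose constant is uniform. -/
theorem exists_half_restriction_estimate (α : ℝ) {θ : ℝ} (hθ0 : 0 ≤ θ) (hθ1 : θ < 1) :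
    ∃ C : ℝ, 0 < C ∧ ∀ (s : ℝ) (F : (ℝ × ℝ) × ℝ → ℂ), IsTest F →
      (∀ z t, F (z, t) ≠ 0 → |t| ≤ 1) →
      ∫⁻ k : ℝ × ℝ, {k : ℝ × ℝ | 0 < k.1}.indicator (fun k => ENNReal.ofReal (|k.1| ^ θ *
        ‖spaceTimeFourier F (k, omega α k.1 k.2 + s)‖ ^ 2)) k ≤
        ENNReal.ofReal (C * dualNorm θ F ^ 2) := by
  obtain ⟨C, hC, hres⟩ := exists_cutoff_restriction_estimate α hθ0 hθ1
  refine ⟨C, hC, fun s F hF hsupp => ?_⟩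
  set f : ℕ → ℝ × ℝ → ℝ≥0∞ := fun n k => ENNReal.ofReal (freqCutoff n (1 / ((n : ℝ) + 1)) k *
    Real.exp (θ * Real.log k.1) * ‖spaceTimeFourier F (k, omega α k.1 k.2 + s)‖ ^ 2) with hf
  have hfm : ∀ n, Measurable (f n) := by
    intro n
    have h1 := measurable_freqCutoff n (1 / ((n : ℝ) + 1))
    have h2 := measurable_spaceTimeFourier hF.measurable
    have h3 := measurable_omega α
    have h4 : Measurable fun k : ℝ × ℝ => spaceTimeFourier F (k, omega α k.1 k.2 + s) :=
      h2.comp (measurable_id.prodMk (h3.add_const s))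
    simp only [hf]
    fun_prop
  calc ∫⁻ k : ℝ × ℝ, {k : ℝ × ℝ | 0 < k.1}.indicator (fun k => ENNReal.ofReal (|k.1| ^ θ *
        ‖spaceTimeFourier F (k, omega α k.1 k.2 + s)‖ ^ 2)) k
      ≤ ∫⁻ k, Filter.liminf (fun n => f n k) Filter.atTop := by
        refine lintegral_mono fun k => ?_
        by_cases hk : 0 < k.1
        · rw [indicator_of_mem (by exact hk)]
          refine le_of_eq (Filter.Tendsto.liminf_eq ?_).symm
          refine ENNReal.tendsto_ofReal ?_
          have hexp : Real.exp (θ * Real.log k.1) = |k.1| ^ θ := by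
            rw [abs_of_pos hk, Real.rpow_def_of_pos hk, mul_comm]
          rw [hexp]
          simpa using ((tendsto_freqCutoff hk).mul_const (|k.1| ^ θ)).mul_const
            (‖spaceTimeFourier F (k, omega α k.1 k.2 + s)‖ ^ 2)
        · rw [indicator_of_notMem (by exact hk)]
          exact zero_le
    _ ≤ Filter.liminf (fun n => ∫⁻ k, f n k) Filter.atTop := lintegral_liminf_le hfm
    _ ≤ _ := by
        refine Filter.liminf_le_of_le (by isBoundedDefault) fun b hb => ?_
        obtain ⟨n, hn⟩ := hb.exists
        exact hn.trans (hres n _ s F (by positivity) hF hsupp)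

/-- The frequencies within `L` of the characteristic surface. -/
def tube (α L : ℝ) : Set ((ℝ × ℝ) × ℝ) := {q | |q.2 - omega α q.1.1 q.1.2| ≤ L}

theorem measurableSet_tube (α L : ℝ) : MeasurableSet (tube α L) := by
  have h : Measurable fun q : (ℝ × ℝ) × ℝ => omega α q.1.1 q.1.2 :=
    (measurable_omega α).comp measurable_fst
  exact measurableSet_le (by fun_prop) measurable_const

/-- The tube is foliated by the translates `τ = ω + s` with `|s| ≤ L`. Each satisfies the same
bound, so the total is the bound times the length `2L`. -/
theorem exists_half_tube_estimate (α : ℝ) {θ : ℝ} (hθ0 : 0 ≤ θ) (hθ1 : θ < 1) :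
    ∃ C : ℝ, 0 < C ∧ ∀ (L : ℝ) (F : (ℝ × ℝ) × ℝ → ℂ), 0 ≤ L → IsTest F →
      (∀ z t, F (z, t) ≠ 0 → |t| ≤ 1) →
      ∫⁻ q in tube α L ∩ {q | 0 < q.1.1}, ENNReal.ofReal (|q.1.1| ^ θ *
        ‖spaceTimeFourier F q‖ ^ 2) ≤ ENNReal.ofReal (C * L * dualNorm θ F ^ 2) := by
  obtain ⟨C, hC, hres⟩ := exists_half_restriction_estimate α hθ0 hθ1
  refine ⟨2 * C, by positivity, fun L F hL hF hsupp => ?_⟩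
  have hSm := measurable_spaceTimeFourier hF.measurable
  have hgm : Measurable fun q : (ℝ × ℝ) × ℝ => ENNReal.ofReal (|q.1.1| ^ θ *
      ‖spaceTimeFourier F q‖ ^ 2) := by fun_prop
  have hset : MeasurableSet (tube α L ∩ {q : (ℝ × ℝ) × ℝ | 0 < q.1.1}) :=
    (measurableSet_tube α L).inter (measurableSet_lt measurable_const (by fun_prop))
  have hshift : Measurable fun p : (ℝ × ℝ) × ℝ => (p.1, omega α p.1.1 p.1.2 + p.2) :=
    measurable_fst.prodMk (((measurable_omega α).comp measurable_fst).add measurable_snd)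
  rw [← lintegral_indicator hset]
  set I : (ℝ × ℝ) × ℝ → ℝ≥0∞ := (tube α L ∩ {q : (ℝ × ℝ) × ℝ | 0 < q.1.1}).indicator fun q =>
    ENNReal.ofReal (|q.1.1| ^ θ * ‖spaceTimeFourier F q‖ ^ 2) with hI
  have hIm : Measurable I := hgm.indicator hset
  rw [Measure.volume_eq_prod, lintegral_prod _ hIm.aemeasurable]
  have h1 : ∀ k : ℝ × ℝ, ∫⁻ τ, I (k, τ) = ∫⁻ s, I (k, omega α k.1 k.2 + s) := fun k =>
    (lintegral_add_left_eq_self (fun τ => I (k, τ)) _).symm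
  simp_rw [h1]
  rw [lintegral_lintegral_swap (f := fun (k : ℝ × ℝ) s => I (k, omega α k.1 k.2 + s))
    (hIm.comp hshift).aemeasurable]
  calc ∫⁻ s, ∫⁻ k : ℝ × ℝ, I (k, omega α k.1 k.2 + s)
      ≤ ∫⁻ s, (Icc (-L) L).indicator (fun _ => ENNReal.ofReal (C * dualNorm θ F ^ 2)) s := by
        refine lintegral_mono fun s => ?_
        by_cases hs : |s| ≤ L
        · rw [indicator_of_mem (mem_Icc.mpr (abs_le.mp hs))]
          refine le_trans (lintegral_mono fun k => ?_) (hres s F hF hsupp)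
          simp only [hI, indicator, mem_inter_iff, mem_ofPred_eq]
          split_ifs with ha hb hb
          · exact le_rfl
          · exact absurd ha.2 hb
          · exact zero_le
          · exact le_rfl
        · have : ∀ k : ℝ × ℝ, I (k, omega α k.1 k.2 + s) = 0 := by
            intro k
            refine indicator_of_notMem (fun h => hs ?_) _
            simpa [tube] using h.1
          simp [this]
    _ = ENNReal.ofReal (C * dualNorm θ F ^ 2) * ENNReal.ofReal (2 * L) := by
        rw [lintegral_indicator measurableSet_Icc, setLIntegral_const, Real.volume_Icc]
        congr 2
        ring
    _ = _ := by
        have := dualNorm_nonneg θ F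
        rw [← ENNReal.ofReal_mul (by positivity)]
        congr 1
        ring

theorem omega_neg (α ξ μ : ℝ) : omega α (-ξ) (-μ) = -omega α ξ μ := by
  simp only [omega, div_neg]
  ring

theorem dualNorm_conj (θ : ℝ) (F : (ℝ × ℝ) × ℝ → ℂ) :
    dualNorm θ (fun p => (starRingEnd ℂ) (F p)) = dualNorm θ F := by
  simp only [dualNorm, sliceNorm, RCLike.norm_conj]

/-- The dual estimate: the weighted `L²` norm of the Fourier transform of `F` on a neighbourhood of
the characteristic surface is bounded by the mixed norm of `F`. -/
theorem exists_tube_estimate (α : ℝ) {θ : ℝ} (hθ0 : 0 ≤ θ) (hθ1 : θ < 1) :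
    ∃ C : ℝ, 0 < C ∧ ∀ (L : ℝ) (F : (ℝ × ℝ) × ℝ → ℂ), 0 ≤ L → IsTest F →
      (∀ z t, F (z, t) ≠ 0 → |t| ≤ 1) →
      ∫⁻ q in tube α L, ENNReal.ofReal (|q.1.1| ^ θ * ‖spaceTimeFourier F q‖ ^ 2) ≤
        ENNReal.ofReal (C * L * dualNorm θ F ^ 2) := by
  obtain ⟨C, hC, hres⟩ := exists_half_tube_estimate α hθ0 hθ1
  refine ⟨2 * C, by positivity, fun L F hL hF hsupp => ?_⟩
  have hSm := measurable_spaceTimeFourier hF.measurable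
  set g : (ℝ × ℝ) × ℝ → ℝ≥0∞ := fun q => ENNReal.ofReal (|q.1.1| ^ θ *
      ‖spaceTimeFourier F q‖ ^ 2) with hg
  have hpos := hres L F hL hF hsupp
  -- Conjugating `F` reflects its Fourier transform, and the tube is symmetric because `ω` is odd
  -- under `(ξ, μ) ↦ (-ξ, -μ)`; thus negative frequencies reduce to positive ones.
  have hneg : ∫⁻ q in tube α L ∩ {q | q.1.1 < 0}, g q ≤
      ENNReal.ofReal (C * L * dualNorm θ F ^ 2) := by
    have h1 := hres L _ hL hF.conj (fun z t h => hsupp z t fun h0 => h (by rw [h0, map_zero]))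
    rw [dualNorm_conj] at h1
    refine le_of_eq_of_le ?_ h1
    have : (volume : Measure ((ℝ × ℝ) × ℝ)).IsAddHaarMeasure := by
      rw [Measure.volume_eq_prod]; infer_instance
    have h3 := (Measure.measurePreserving_neg (volume : Measure ((ℝ × ℝ) × ℝ))).setLIntegral_comp_preimage_emb
      (MeasurableEquiv.neg ((ℝ × ℝ) × ℝ)).measurableEmbedding
      (fun q => ENNReal.ofReal (|q.1.1| ^ θ *
        ‖spaceTimeFourier (fun p => (starRingEnd ℂ) (F p)) q‖ ^ 2)) (tube α L ∩ {q | 0 < q.1.1})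
    rw [← h3]
    have hset : (fun q : (ℝ × ℝ) × ℝ => -q) ⁻¹' (tube α L ∩ {q | 0 < q.1.1}) =
        tube α L ∩ {q | q.1.1 < 0} := by
      ext q
      simp only [tube, mem_preimage, mem_inter_iff, mem_ofPred_eq, Prod.fst_neg, Prod.snd_neg,
        omega_neg, neg_pos]
      rw [← abs_neg]
      ring_nf
    rw [hset]
    refine lintegral_congr fun q => ?_
    simp only [hg, spaceTimeFourier_conj, RCLike.norm_conj, Prod.fst_neg, abs_neg]
  have hnull : ∀ᵐ q : (ℝ × ℝ) × ℝ, q.1.1 ≠ 0 := by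
    have h1 : ∀ᵐ x : ℝ, x ≠ 0 := Measure.ae_ne volume 0
    have h2 : ∀ᵐ k : ℝ × ℝ, k.1 ≠ 0 := by
      rw [Measure.volume_eq_prod]
      exact Measure.quasiMeasurePreserving_fst.ae h1
    rw [Measure.volume_eq_prod]
    exact Measure.quasiMeasurePreserving_fst.ae h2
  have hae : tube α L ≤ᵐ[volume] (tube α L ∩ {q | 0 < q.1.1} ∪ tube α L ∩ {q | q.1.1 < 0} :
      Set ((ℝ × ℝ) × ℝ)) := by
    filter_upwards [hnull] with q hq hqt
    rcases lt_or_gt_of_ne hq with h | h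
    · exact Or.inr ⟨hqt, h⟩
    · exact Or.inl ⟨hqt, h⟩
  calc ∫⁻ q in tube α L, g q
      ≤ ∫⁻ q in (tube α L ∩ {q | 0 < q.1.1} ∪ tube α L ∩ {q | q.1.1 < 0}), g q :=
        lintegral_mono' (Measure.restrict_mono_ae hae) le_rfl
    _ ≤ (∫⁻ q in tube α L ∩ {q | 0 < q.1.1}, g q) + ∫⁻ q in tube α L ∩ {q | q.1.1 < 0}, g q :=
        lintegral_union_le _ _ _
    _ ≤ ENNReal.ofReal (C * L * dualNorm θ F ^ 2) + ENNReal.ofReal (C * L * dualNorm θ F ^ 2) :=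
        add_le_add hpos hneg
    _ = _ := by
        have := dualNorm_nonneg θ F
        rw [← ENNReal.ofReal_add (by positivity) (by positivity)]
        congr 1
        ring

/-! ### Duality: pairing amplitudes with test functions. -/

section

/-- The estimate `‖w F̂‖_{L²(Ω)} ≤ K ‖F‖` for test functions `F` supported in `|t| ≤ 1`. -/
def RestrictionBound (θ K : ℝ) (Ω : Set ((ℝ × ℝ) × ℝ)) (w : (ℝ × ℝ) × ℝ → ℝ) : Prop :=
  ∀ F : (ℝ × ℝ) × ℝ → ℂ, IsTest F → (∀ z t, F (z, t) ≠ 0 → |t| ≤ 1) →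
    ∫⁻ q in Ω, ENNReal.ofReal ((w q * ‖spaceTimeFourier F q‖) ^ 2) ≤
      ENNReal.ofReal ((K * dualNorm θ F) ^ 2)

variable {θ K : ℝ} {Ω : Set ((ℝ × ℝ) × ℝ)} {w : (ℝ × ℝ) × ℝ → ℝ} {a F : (ℝ × ℝ) × ℝ → ℂ}

/-- Cauchy–Schwarz on `Ω`. It gives both the absolute convergence and the size of the pairing that
defines the distribution with Fourier transform `w a`. -/
theorem RestrictionBound.lintegral_le (hB : RestrictionBound θ K Ω w) (hK : 0 ≤ K)
    (hΩ : MeasurableSet Ω) (hw : Measurable w) (hw0 : ∀ q, 0 ≤ w q)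
    (ha : Measurable a) (ha2 : Integrable fun q => ‖a q‖ ^ 2) (haΩ : ∀ q, q ∉ Ω → a q = 0)
    (hF : IsTest F) (hsupp : ∀ z t, F (z, t) ≠ 0 → |t| ≤ 1) :
    ∫⁻ q, ‖(w q : ℂ) * a q * spaceTimeFourier F q‖ₑ ≤
      ENNReal.ofReal (K * √(∫ q, ‖a q‖ ^ 2) * dualNorm θ F) := by
  have hFm := measurable_spaceTimeFourier hF.measurable
  have hD := dualNorm_nonneg θ F
  have h1 : ∫⁻ q, ‖(w q : ℂ) * a q * spaceTimeFourier F q‖ₑ =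
      ∫⁻ q in Ω, ENNReal.ofReal ‖a q‖ * ENNReal.ofReal (w q * ‖spaceTimeFourier F q‖) := by
    rw [← lintegral_indicator hΩ]
    refine lintegral_congr fun q => ?_
    by_cases hq : q ∈ Ω
    · rw [indicator_of_mem hq, ← ENNReal.ofReal_mul (norm_nonneg _), ← ofReal_norm,
        norm_mul, norm_mul, Complex.norm_real, Real.norm_of_nonneg (hw0 q)]
      congr 1; ring
    · rw [indicator_of_notMem hq, haΩ q hq]; simp
  have h2 := ENNReal.lintegral_mul_le_Lp_mul_Lq (volume.restrict Ω) Real.HolderConjugate.two_two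
    (f := fun q => ENNReal.ofReal ‖a q‖)
    (g := fun q => ENNReal.ofReal (w q * ‖spaceTimeFourier F q‖)) (by fun_prop) (by fun_prop)
  have h3 : ∫⁻ q in Ω, ENNReal.ofReal ‖a q‖ ^ (2 : ℝ) ≤
      ENNReal.ofReal (∫ q, ‖a q‖ ^ 2) := by
    rw [ofReal_integral_eq_lintegral_ofReal ha2 (Filter.Eventually.of_forall fun q => sq_nonneg _)]
    refine (setLIntegral_le_lintegral _ _).trans (le_of_eq (lintegral_congr fun q => ?_))
    rw [ENNReal.ofReal_pow (norm_nonneg _)]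
    exact_mod_cast ENNReal.rpow_natCast (ENNReal.ofReal ‖a q‖) 2
  have h4 : ∫⁻ q in Ω, ENNReal.ofReal (w q * ‖spaceTimeFourier F q‖) ^ (2 : ℝ) ≤
      ENNReal.ofReal ((K * dualNorm θ F) ^ 2) := by
    refine (le_of_eq (lintegral_congr fun q => ?_)).trans (hB F hF hsupp)
    rw [ENNReal.ofReal_pow (mul_nonneg (hw0 q) (norm_nonneg _))]
    exact_mod_cast ENNReal.rpow_natCast (ENNReal.ofReal (w q * ‖spaceTimeFourier F q‖)) 2
  rw [h1]
  refine h2.trans ((mul_le_mul' (ENNReal.rpow_le_rpow h3 (by norm_num))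
    (ENNReal.rpow_le_rpow h4 (by norm_num))).trans (le_of_eq ?_))
  rw [ENNReal.ofReal_rpow_of_nonneg (integral_nonneg fun _ => sq_nonneg _) (by norm_num),
    ENNReal.ofReal_rpow_of_nonneg (sq_nonneg _) (by norm_num),
    ← Real.sqrt_eq_rpow, ← Real.sqrt_eq_rpow, Real.sqrt_sq (mul_nonneg hK hD),
    ← ENNReal.ofReal_mul (Real.sqrt_nonneg _)]
  congr 1; ring

theorem RestrictionBound.integrable (hB : RestrictionBound θ K Ω w) (hK : 0 ≤ K)
    (hΩ : MeasurableSet Ω) (hw : Measurable w) (hw0 : ∀ q, 0 ≤ w q)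
    (ha : Measurable a) (ha2 : Integrable fun q => ‖a q‖ ^ 2) (haΩ : ∀ q, q ∉ Ω → a q = 0)
    (hF : IsTest F) (hsupp : ∀ z t, F (z, t) ≠ 0 → |t| ≤ 1) :
    Integrable fun q => (w q : ℂ) * a q * spaceTimeFourier F q := by
  have hFm := measurable_spaceTimeFourier hF.measurable
  refine ⟨Measurable.aestronglyMeasurable (by fun_prop), ?_⟩
  exact (hB.lintegral_le hK hΩ hw hw0 ha ha2 haΩ hF hsupp).trans_lt ENNReal.ofReal_lt_top

theorem RestrictionBound.norm_integral_le (hB : RestrictionBound θ K Ω w) (hK : 0 ≤ K)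
    (hΩ : MeasurableSet Ω) (hw : Measurable w) (hw0 : ∀ q, 0 ≤ w q)
    (ha : Measurable a) (ha2 : Integrable fun q => ‖a q‖ ^ 2) (haΩ : ∀ q, q ∉ Ω → a q = 0)
    (hF : IsTest F) (hsupp : ∀ z t, F (z, t) ≠ 0 → |t| ≤ 1) :
    ‖∫ q, (w q : ℂ) * a q * spaceTimeFourier F q‖ ≤
      K * √(∫ q, ‖a q‖ ^ 2) * dualNorm θ F := by
  have hD := dualNorm_nonneg θ F
  rw [← ENNReal.ofReal_le_ofReal_iff (by positivity), ofReal_norm]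
  exact (enorm_integral_le_lintegral_enorm _).trans
    (hB.lintegral_le hK hΩ hw hw0 ha ha2 haΩ hF hsupp)

/-- The kernel `exp(i(k·z + tτ))` is symmetric in its two arguments, so Fubini moves the transform
from one factor to the other. -/
theorem integral_spaceTimeFourier_mul {A : (ℝ × ℝ) × ℝ → ℂ} (hA : Integrable A)
    (hF : Integrable F) :
    Integrable (fun p => spaceTimeFourier A p * F p) ∧
    ∫ p, spaceTimeFourier A p * F p = ∫ q, A q * spaceTimeFourier F q := by
  set k : ((ℝ × ℝ) × ℝ) → ((ℝ × ℝ) × ℝ) → ℂ := fun p q =>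
    Complex.exp (Complex.I * (dot p.1 q.1 + q.2 * p.2 : ℝ)) with hk
  have hkm : Measurable fun x : ((ℝ × ℝ) × ℝ) × ((ℝ × ℝ) × ℝ) => k x.1 x.2 := by
    simp only [hk, dot]; fun_prop
  have hsymm : ∀ p q, k p q = k q p := by
    intro p q; simp only [hk, dot]; congr 3; ring
  have hint : Integrable (fun x : ((ℝ × ℝ) × ℝ) × ((ℝ × ℝ) × ℝ) => k x.1 x.2 * (F x.1 * A x.2))
      (volume.prod volume) := by
    refine (hF.mul_prod hA).bdd_mul (c := 1) hkm.aestronglyMeasurable ?_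
    exact Filter.Eventually.of_forall fun x => (norm_cexp_I_mul _).le
  have e1 : ∀ p, spaceTimeFourier A p * F p = ∫ q, k p q * (F p * A q) := by
    intro p
    rw [spaceTimeFourier, ← integral_mul_const]
    refine integral_congr_ae (Filter.Eventually.of_forall fun q => ?_)
    simp only [hk]; ring
  have e2 : ∀ q, A q * spaceTimeFourier F q = ∫ p, k p q * (F p * A q) := by
    intro q
    rw [spaceTimeFourier, ← integral_const_mul]
    refine integral_congr_ae (Filter.Eventually.of_forall fun p => ?_)
    simp only [hsymm p q]
    simp only [hk]; ring
  constructor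
  · simp only [e1]
    exact hint.integral_prod_left
  · simp only [e1, e2]
    exact integral_integral_swap (f := fun p q => k p q * (F p * A q)) hint

theorem dualNorm_congr {F G : (ℝ × ℝ) × ℝ → ℂ} (h : ∀ p, ‖F p‖ = ‖G p‖) :
    dualNorm θ F = dualNorm θ G := by
  unfold dualNorm sliceNorm
  simp only [h]

/-- The amplitude-weighted oscillatory integral is controlled in absolute value against test
functions. -/
theorem RestrictionBound.integral_norm_mul_le (hB : RestrictionBound θ K Ω w) (hK : 0 ≤ K)
    (hΩ : MeasurableSet Ω) (hw : Measurable w) (hw0 : ∀ q, 0 ≤ w q)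
    (ha : Measurable a) (ha2 : Integrable fun q => ‖a q‖ ^ 2) (haΩ : ∀ q, q ∉ Ω → a q = 0)
    (hwa : Integrable fun q => (w q : ℂ) * a q)
    (hF : IsTest F) (hsupp : ∀ z t, F (z, t) ≠ 0 → |t| ≤ 1) :
    ∫ p, ‖spaceTimeFourier (fun q => (w q : ℂ) * a q) p * F p‖ ≤
      K * √(∫ q, ‖a q‖ ^ 2) * dualNorm θ F := by
  set d := spaceTimeFourier (fun q => (w q : ℂ) * a q) with hd
  have hdm : Measurable d := measurable_spaceTimeFourier (by fun_prop)
  -- Multiplying `F` by the conjugate phase of `d` makes `d G = |d F|`. The modulus is unchanged,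
  -- hence so is the dual norm; where `d` vanishes `F` is kept, to preserve the modulus there too.
  set G : (ℝ × ℝ) × ℝ → ℂ := fun p =>
    if d p = 0 then F p else (starRingEnd ℂ) (d p) / ‖d p‖ * ‖F p‖ with hG
  have hnorm : ∀ p, ‖G p‖ = ‖F p‖ := by
    intro p
    by_cases h : d p = 0
    · simp [hG, h]
    · simp only [hG, if_neg h, norm_mul, norm_div, RCLike.norm_conj, Complex.norm_real, norm_norm]
      rw [div_self (norm_ne_zero_iff.mpr h), one_mul]
  have hne : ∀ p, G p ≠ 0 → F p ≠ 0 := fun p h => by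
    rw [← norm_ne_zero_iff] at h ⊢
    rwa [← hnorm]
  have hGt : IsTest G := by
    refine ⟨?_, ?_, ?_⟩
    · refine Measurable.ite (hdm (measurableSet_singleton 0)) hF.measurable ?_
      have := hF.measurable
      have hc : Measurable fun p => (starRingEnd ℂ) (d p) :=
        Complex.continuous_conj.measurable.comp hdm
      fun_prop
    · obtain ⟨M, hM⟩ := hF.bounded
      exact ⟨M, fun p => (hnorm p).trans_le (hM p)⟩
    · obtain ⟨R, hR⟩ := hF.bounded_support
      exact ⟨R, fun p hp => hR p (hne p hp)⟩
  have hGs : ∀ z t, G (z, t) ≠ 0 → |t| ≤ 1 := fun z t h => hsupp z t (hne _ h)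
  have hdG : ∀ p, d p * G p = (‖d p * F p‖ : ℝ) := by
    intro p
    by_cases h : d p = 0
    · simp [h]
    · simp only [hG, if_neg h, norm_mul, Complex.ofReal_mul]
      have h0 : (‖d p‖ : ℂ) ≠ 0 := by exact_mod_cast norm_ne_zero_iff.mpr h
      have h1 : d p * (starRingEnd ℂ) (d p) = (‖d p‖ : ℂ) * ‖d p‖ := by
        rw [Complex.mul_conj, Complex.normSq_eq_norm_sq]; push_cast; ring
      field_simp
      rw [h1]; ring
  have hfl := (integral_spaceTimeFourier_mul hwa (hGt.integrable volume)).2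
  have hb := hB.norm_integral_le hK hΩ hw hw0 ha ha2 haΩ hGt hGs
  rw [← hfl, dualNorm_congr hnorm] at hb
  simp only [← hd, hdG] at hb
  rw [integral_complex_ofReal, Complex.norm_real] at hb
  exact (Real.le_norm_self _).trans hb

end

/-! ### Realising the distribution as a function. -/

section

/-- Radii growing so fast that the mass of `h` outside the `k`-th ball is at most `4^{-k}`; the
pieces are the resulting shells. For `h = |a|²` the `L²` norms of the pieces of `a` are then
summable, which square integrability alone does not give for an arbitrary partition. -/
theorem exists_summable_sqrt_partition {X : Type*} [NormedAddCommGroup X] [MeasurableSpace X]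
    [BorelSpace X] {μ : Measure X} {h : X → ℝ} (hi : Integrable h μ) (h0 : ∀ x, 0 ≤ h x) :
    ∃ B : ℕ → Set X, (∀ k, MeasurableSet (B k)) ∧ Pairwise (Function.onFun Disjoint B) ∧
      ⋃ k, B k = univ ∧ (∀ k, ∃ R : ℝ, ∀ x ∈ B k, ‖x‖ ≤ R) ∧
      Summable fun k => √(∫ x in B k, h x ∂μ) := by
  have hlim : Filter.Tendsto (fun n : ℕ => ∫ x in {x | (n : ℝ) ≤ ‖x‖}, h x ∂μ) Filter.atTop
      (nhds 0) := by
    have ht := tendsto_setIntegral_of_antitone (μ := μ) (f := h)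
      (s := fun n : ℕ => {x : X | (n : ℝ) ≤ ‖x‖})
      (fun n => measurableSet_le measurable_const measurable_norm)
      (fun m n hmn x hx => by
        simp only [mem_ofPred_eq] at hx ⊢
        exact (Nat.cast_le.mpr hmn).trans hx) ⟨0, hi.integrableOn⟩
    have he : ⋂ n : ℕ, {x : X | (n : ℝ) ≤ ‖x‖} = ∅ := by
      refine eq_empty_of_forall_notMem fun x hx => ?_
      obtain ⟨n, hn⟩ := exists_nat_gt ‖x‖
      exact absurd (mem_iInter.mp hx n) (not_le.mpr hn)
    rwa [he, setIntegral_empty] at ht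
  obtain ⟨N, hN, hNb⟩ := Filter.extraction_forall_of_eventually
    (P := fun k n => ∫ x in {x | (n : ℝ) ≤ ‖x‖}, h x ∂μ ≤ ((1 / 2 : ℝ) ^ k) ^ 2)
    (fun k => (hlim.eventually_lt_const (by positivity)).mono fun n hn => hn.le)
  set f : ℕ → Set X := fun k => Metric.ball (0 : X) (N k) with hf
  refine ⟨disjointed f, fun k => ?_, disjoint_disjointed f, ?_, fun k => ⟨N k, fun x hx => ?_⟩, ?_⟩
  · exact MeasurableSet.disjointed (fun i => Metric.isOpen_ball.measurableSet) k
  · rw [iUnion_disjointed]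
    refine eq_univ_of_forall fun x => mem_iUnion.mpr ?_
    obtain ⟨n, hn⟩ := exists_nat_gt ‖x‖
    refine ⟨n, ?_⟩
    rw [hf, mem_ball_zero_iff]
    exact hn.trans_le (Nat.cast_le.mpr hN.le_apply)
  · have := disjointed_subset f k hx
    rw [hf, mem_ball_zero_iff] at this
    exact this.le
  -- The index is shifted because piece `k + 1` lies outside ball `k`, while the first piece has no
  -- smallness.
  · refine (summable_nat_add_iff 1).mp ?_
    refine Summable.of_nonneg_of_le (fun k => Real.sqrt_nonneg _) (fun k => ?_)
      (summable_geometric_of_lt_one (by norm_num) (by norm_num : (1 / 2 : ℝ) < 1))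
    refine Real.sqrt_le_iff.mpr ⟨by positivity, le_trans ?_ (hNb k)⟩
    refine setIntegral_mono_set hi.integrableOn (Filter.Eventually.of_forall h0) ?_
    refine LE.le.eventuallyLE fun x hx => ?_
    rw [disjointed_apply] at hx
    by_contra hlt
    refine hx.2 ?_
    have : f k ≤ (Finset.Iio (k + 1)).sup f := Finset.le_sup (Finset.mem_Iio.mpr k.lt_succ_self)
    refine this ?_
    rw [hf, mem_ball_zero_iff]
    exact not_le.mp hlt

theorem integrable_of_integrable_sq {X : Type*} [NormedAddCommGroup X] [MeasurableSpace X]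
    [BorelSpace X] [ProperSpace X] {μ : Measure X} [IsFiniteMeasureOnCompacts μ] {b : X → ℂ}
    (hb : Measurable b) (hb2 : Integrable (fun x => ‖b x‖ ^ 2) μ) {R : ℝ}
    (hR : ∀ x, b x ≠ 0 → ‖x‖ ≤ R) : Integrable b μ := by
  have hi : Integrable ((Metric.closedBall (0 : X) R).indicator fun _ => (1 : ℝ)) μ := by
    rw [integrable_indicator_iff Metric.isClosed_closedBall.measurableSet]
    exact integrableOn_const (isCompact_closedBall (0 : X) R).measure_lt_top.ne
  refine (hi.add hb2).mono' hb.aestronglyMeasurable (Filter.Eventually.of_forall fun x => ?_)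
  by_cases hx : b x = 0
  · simp only [hx, norm_zero, Pi.add_apply]
    have : 0 ≤ (Metric.closedBall (0 : X) R).indicator (fun _ => (1 : ℝ)) x :=
      indicator_nonneg (fun _ _ => zero_le_one) x
    positivity
  · have hmem : x ∈ Metric.closedBall (0 : X) R := mem_closedBall_zero_iff.mpr (hR x hx)
    rw [Pi.add_apply, indicator_of_mem hmem]
    nlinarith [sq_nonneg (‖b x‖ - 1), norm_nonneg (b x)]

variable {θ K : ℝ} {Ω : Set ((ℝ × ℝ) × ℝ)} {w : (ℝ × ℝ) × ℝ → ℝ} {a : (ℝ × ℝ) × ℝ → ℂ}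

/-- The distribution with Fourier transform `w a` is a measurable function that is integrable
against test functions. -/
theorem RestrictionBound.exists_function (hB : RestrictionBound θ K Ω w) (hK : 0 ≤ K)
    (hΩ : MeasurableSet Ω) (hw : Measurable w) (hw0 : ∀ q, 0 ≤ w q)
    (hwb : ∀ R : ℝ, ∃ M : ℝ, ∀ q, ‖q‖ ≤ R → w q ≤ M)
    (ha : Measurable a) (ha2 : Integrable fun q => ‖a q‖ ^ 2) (haΩ : ∀ q, q ∉ Ω → a q = 0) :
    ∃ g : (ℝ × ℝ) × ℝ → ℂ, Measurable g ∧ ∀ F : (ℝ × ℝ) × ℝ → ℂ, IsTest F →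
      (∀ z t, F (z, t) ≠ 0 → |t| ≤ 1) →
      Integrable (fun p => g p * F p) ∧
      ∫ p, g p * F p = ∫ q, (w q : ℂ) * a q * spaceTimeFourier F q ∧
      ‖∫ p, g p * F p‖ ≤ K * √(∫ q, ‖a q‖ ^ 2) * dualNorm θ F := by
  obtain ⟨B, hBm, hBd, hBu, hBb, hBs⟩ :=
    exists_summable_sqrt_partition ha2 (fun q => sq_nonneg ‖a q‖)
  set b : ℕ → (ℝ × ℝ) × ℝ → ℂ := fun k => (B k).indicator a with hb
  have hbm : ∀ k, Measurable (b k) := fun k => ha.indicator (hBm k)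
  have hbsq : ∀ k q, ‖b k q‖ ^ 2 = (B k).indicator (fun q => ‖a q‖ ^ 2) q := by
    intro k q
    by_cases hq : q ∈ B k
    · simp only [hb, indicator_of_mem hq]
    · simp [hb, indicator_of_notMem hq]
  have hb2 : ∀ k, Integrable fun q => ‖b k q‖ ^ 2 := fun k => by
    simp only [hbsq k]; exact ha2.indicator (hBm k)
  have hbi : ∀ k, ∫ q, ‖b k q‖ ^ 2 = ∫ q in B k, ‖a q‖ ^ 2 := fun k => by
    simp only [hbsq k]; exact integral_indicator (hBm k)
  have hbΩ : ∀ k q, q ∉ Ω → b k q = 0 := by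
    intro k q hq
    by_cases hk : q ∈ B k
    · simp only [hb, indicator_of_mem hk, haΩ q hq]
    · simp only [hb, indicator_of_notMem hk]
  have hbne : ∀ k q, b k q ≠ 0 → q ∈ B k := fun k q h => mem_of_indicator_ne_zero h
  have hwbi : ∀ k, Integrable fun q => (w q : ℂ) * b k q := by
    intro k
    obtain ⟨R, hR⟩ := hBb k
    obtain ⟨M, hM⟩ := hwb R
    have hbint : Integrable (b k) :=
      integrable_of_integrable_sq (hbm k) (hb2 k) (R := R) fun q hq => hR q (hbne k q hq)
    have := hbm k
    refine (hbint.norm.const_mul M).mono' (Measurable.aestronglyMeasurable (by fun_prop))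
      (Filter.Eventually.of_forall fun q => ?_)
    rw [norm_mul, Complex.norm_real, Real.norm_of_nonneg (hw0 q)]
    by_cases hq : b k q = 0
    · simp [hq]
    · exact mul_le_mul_of_nonneg_right (hM q (hR q (hbne k q hq))) (norm_nonneg _)
  set d : ℕ → (ℝ × ℝ) × ℝ → ℂ := fun k => spaceTimeFourier fun q => (w q : ℂ) * b k q with hd
  have hdm : ∀ k, Measurable (d k) := fun k => by
    have := hbm k
    exact measurable_spaceTimeFourier (by fun_prop)
  -- The amplitude `w a` need not be integrable, so its transform is defined piece by piece. Against
  -- a test function the `k`-th piece costs at most a constant times the `L²` norm of `a` on `B k`,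
  -- and these are summable; hence the series can be integrated termwise.
  refine ⟨fun p => ∑' k, d k p, Measurable.tsum hdm, fun F hF hsupp => ?_⟩
  have hFi := hF.integrable volume
  have hFm := hF.measurable
  have hflip := fun k => integral_spaceTimeFourier_mul (hwbi k) hFi
  have hle : ∀ k, ∫ p, ‖d k p * F p‖ ≤ K * √(∫ q in B k, ‖a q‖ ^ 2) * dualNorm θ F := by
    intro k
    rw [← hbi k]
    exact hB.integral_norm_mul_le hK hΩ hw hw0 (hbm k) (hb2 k) (hbΩ k) (hwbi k) hF hsupp
  have hsum : Summable fun k => ∫ p, ‖d k p * F p‖ :=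
    Summable.of_nonneg_of_le (fun k => integral_nonneg fun _ => norm_nonneg _) hle
      ((hBs.mul_left K).mul_right _)
  have hgF : ∀ p, (∑' k, d k p) * F p = ∑' k, d k p * F p := fun p => tsum_mul_right.symm
  have hint := hB.integrable hK hΩ hw hw0 ha ha2 haΩ hF hsupp
  have heq : ∫ p, (∑' k, d k p) * F p = ∫ q, (w q : ℂ) * a q * spaceTimeFourier F q := by
    simp only [hgF]
    have h1 := hasSum_integral_of_summable_integral_norm (fun k => (hflip k).1) hsum
    have h2 := hasSum_integral_iUnion hBm hBd (f := fun q => (w q : ℂ) * a q * spaceTimeFourier F q)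
      (μ := volume) hint.integrableOn
    rw [hBu, setIntegral_univ] at h2
    refine h1.unique (h2.congr_fun fun k => ?_)
    rw [(hflip k).2, ← integral_indicator (hBm k)]
    refine integral_congr_ae (Filter.Eventually.of_forall fun q => ?_)
    by_cases hq : q ∈ B k
    · simp only [hb, indicator_of_mem hq]
    · simp [hb, indicator_of_notMem hq]
  refine ⟨⟨?_, ?_⟩, heq, ?_⟩
  · exact ((Measurable.tsum hdm).mul hFm).aestronglyMeasurable
  · simp only [hgF]
    refine lt_of_le_of_lt (lintegral_mono fun p => enorm_tsum_le_tsum_enorm) ?_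
    rw [lintegral_tsum (f := fun k p => ‖d k p * F p‖ₑ)
      fun k => ((hdm k).mul hFm).enorm.aemeasurable]
    have : ∀ k, ∫⁻ p, ‖d k p * F p‖ₑ = ENNReal.ofReal (∫ p, ‖d k p * F p‖) := fun k =>
      (ofReal_integral_norm_eq_lintegral_enorm (hflip k).1).symm
    simp only [this]
    rw [← ENNReal.ofReal_tsum_of_nonneg (fun k => integral_nonneg fun _ => norm_nonneg _) hsum]
    exact ENNReal.ofReal_lt_top
  · rw [heq]
    exact hB.norm_integral_le hK hΩ hw hw0 ha ha2 haΩ hF hsupp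

end

/-! ### Recovering the mixed norm from pairings. -/

section

variable {θ : ℝ} {G g : (ℝ × ℝ) × ℝ → ℂ}

/-- Replacing `θ` by `-θ` turns `2/(1+θ)` into its conjugate exponent `r = 2/(1-θ)`, so `sliceNorm
(-θ)` is the `L^r` norm of a slice. -/
theorem integral_norm_rpow_eq_sliceNorm (G : (ℝ × ℝ) × ℝ → ℂ) (hθ1 : θ < 1) (t : ℝ) :
    ∫ z, ‖G (z, t)‖ ^ (2 / (1 - θ)) = sliceNorm (-θ) G t ^ (2 / (1 - θ)) := by
  have h1 : 0 < 1 - θ := by linarith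
  unfold sliceNorm
  rw [← sub_eq_add_neg, ← Real.rpow_mul (integral_nonneg fun _ => by positivity)]
  rw [show (1 - θ) / 2 * (2 / (1 - θ)) = 1 by field_simp, Real.rpow_one]

theorem IsTest.eLpNorm_slice (hG : IsTest G) (hθ1 : θ < 1) (t : ℝ) :
    eLpNorm (fun z => G (z, t)) (ENNReal.ofReal (2 / (1 - θ))) volume =
      ENNReal.ofReal (KP.sliceNorm (-θ) G t) := by
  have h1 : 0 < 1 - θ := by linarith
  have hr : 0 < 2 / (1 - θ) := by positivity
  have hs := hG.slice t
  rw [eLpNorm_eq_lintegral_rpow_enorm_toReal (by simpa using h1) ENNReal.ofReal_ne_top,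
    ENNReal.toReal_ofReal hr.le]
  have hl : ∫⁻ z, ‖G (z, t)‖ₑ ^ (2 / (1 - θ)) =
      ENNReal.ofReal (∫ z, ‖G (z, t)‖ ^ (2 / (1 - θ))) := by
    rw [ofReal_integral_eq_lintegral_ofReal (hs.integrable_rpow volume hr)
      (Filter.Eventually.of_forall fun _ => by positivity)]
    refine lintegral_congr fun z => ?_
    rw [← ENNReal.ofReal_rpow_of_nonneg (norm_nonneg _) hr.le, ofReal_norm]
  rw [hl, ENNReal.ofReal_rpow_of_nonneg (integral_nonneg fun _ => by positivity) (by positivity)]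
  unfold KP.sliceNorm
  rw [← sub_eq_add_neg, one_div_div]

/-- Testing against `conj G ‖G‖^{r-2}` with an arbitrary weight in time. -/
theorem IsTest.integral_sliceNorm_mul_le (hG : IsTest G) (hθ0 : 0 ≤ θ) (hθ1 : θ < 1) {T A : ℝ}
    (hGT : ∀ z t, G (z, t) ≠ 0 → |t| ≤ T) (hGg : ∀ p, G p ≠ 0 → g p = G p)
    (hdual : ∀ F : (ℝ × ℝ) × ℝ → ℂ, IsTest F → (∀ z t, F (z, t) ≠ 0 → |t| ≤ T) →
      ‖∫ p, g p * F p‖ ≤ A * dualNorm θ F)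
    {h : ℝ → ℝ} (hm : Measurable h) (h0 : ∀ t, 0 ≤ h t) {M δ : ℝ} (hM : ∀ t, h t ≤ M)
    (hδ : 0 < δ) (hN : ∀ t, h t ≠ 0 → δ ≤ KP.sliceNorm (-θ) G t) :
    ∫ t, KP.sliceNorm (-θ) G t * h t ≤ A * (∫ t, h t ^ (2 / (2 - θ))) ^ ((2 - θ) / 2) := by
  have hc1 : 0 < 1 - θ := by linarith
  have hc2 : 0 < 1 + θ := by linarith
  set r : ℝ := 2 / (1 - θ) with hr
  have hr2 : 2 ≤ r := by
    rw [hr, le_div_iff₀ hc1]; linarith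
  have hr1 : r - 1 = (1 + θ) / (1 - θ) := by rw [hr]; field_simp; ring
  set N : ℝ → ℝ := KP.sliceNorm (-θ) G with hNdef
  have hN0 : ∀ t, 0 ≤ N t := sliceNorm_nonneg _ _
  have hNm : Measurable N := measurable_sliceNorm hG.measurable _
  -- With this factor the slice of `F = conj G |G|^{r-2} c` has `L^{r'}` norm `N^{r-1} c = h`, and
  -- its pairing with `G` is `N h`. The floor `δ` on `N` where `h ≠ 0` keeps `c` bounded, so that
  -- `F` is a test function.
  set c : ℝ → ℝ := fun t => h t / N t ^ (r - 1) with hc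
  have hcm : Measurable c := by simp only [hc]; fun_prop
  have hc0 : ∀ t, 0 ≤ c t := fun t => div_nonneg (h0 t) (Real.rpow_nonneg (hN0 t) _)
  have hM0 : 0 ≤ M := (h0 0).trans (hM 0)
  have hcM : ∀ t, c t ≤ M / δ ^ (r - 1) := by
    intro t
    by_cases ht : h t = 0
    · simp only [hc, ht, zero_div]; positivity
    · exact div_le_div₀ hM0 (hM t) (by positivity)
        (Real.rpow_le_rpow hδ.le (hN t ht) (by linarith))
  have hcN : ∀ t, c t * N t ^ (r - 1) = h t := by
    intro t
    by_cases ht : h t = 0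
    · simp only [hc, ht, zero_div, zero_mul]
    · have : 0 < N t := hδ.trans_le (hN t ht)
      simp only [hc]
      rw [div_mul_cancel₀ _ (by positivity)]
  set F : (ℝ × ℝ) × ℝ → ℂ := fun p =>
    (starRingEnd ℂ) (G p) * ((‖G p‖ ^ (r - 2) * c p.2 : ℝ) : ℂ) with hF
  have hFnorm : ∀ p, ‖F p‖ = ‖G p‖ ^ (r - 1) * c p.2 := by
    intro p
    have : ‖G p‖ * ‖G p‖ ^ (r - 2) = ‖G p‖ ^ (r - 1) := by
      rcases eq_or_ne (‖G p‖) 0 with h | h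
      · rw [h, zero_mul, Real.zero_rpow (by linarith)]
      · nth_rewrite 1 [← Real.rpow_one ‖G p‖]
        rw [← Real.rpow_add (lt_of_le_of_ne (norm_nonneg _) h.symm)]
        congr 1; ring
    rw [hF]
    simp only []
    rw [norm_mul, RCLike.norm_conj, Complex.norm_real, Real.norm_of_nonneg (by have := hc0 p.2; positivity), ← mul_assoc, this]
  have hne : ∀ p, F p ≠ 0 → G p ≠ 0 := fun p hp hG0 => hp (by simp [hF, hG0])
  have hGm := hG.measurable
  have hFt : IsTest F := by
    refine ⟨?_, ?_, ?_⟩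
    · have hcj : Measurable fun p => (starRingEnd ℂ) (G p) :=
        Complex.continuous_conj.measurable.comp hGm
      simp only [hF]; fun_prop
    · obtain ⟨B, hB⟩ := hG.bounded
      refine ⟨B ^ (r - 1) * (M / δ ^ (r - 1)), fun p => ?_⟩
      rw [hFnorm]
      have hB0 : 0 ≤ B := (norm_nonneg _).trans (hB p)
      exact mul_le_mul (Real.rpow_le_rpow (norm_nonneg _) (hB p) (by linarith)) (hcM _) (hc0 _)
        (by positivity)
    · obtain ⟨R, hR⟩ := hG.bounded_support
      exact ⟨R, fun p hp => hR p (hne p hp)⟩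
  have hslice : ∀ t, KP.sliceNorm θ F t = h t := by
    intro t
    have e1 : ∀ z, ‖F (z, t)‖ ^ (2 / (1 + θ)) = ‖G (z, t)‖ ^ r * c t ^ (2 / (1 + θ)) := by
      intro z
      rw [hFnorm, Real.mul_rpow (by positivity) (hc0 t), ← Real.rpow_mul (norm_nonneg _)]
      congr 2
      rw [hr1, hr]; field_simp
    have e2 : KP.sliceNorm θ F t = N t ^ (r - 1) * c t := by
      rw [KP.sliceNorm]
      simp only [e1]
      rw [integral_mul_const, hr, integral_norm_rpow_eq_sliceNorm G hθ1 t, ← hr,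
        Real.mul_rpow (Real.rpow_nonneg (hN0 t) _) (Real.rpow_nonneg (hc0 t) _),
        ← Real.rpow_mul (hN0 t), ← Real.rpow_mul (hc0 t)]
      rw [show 2 / (1 + θ) * ((1 + θ) / 2) = 1 by field_simp, Real.rpow_one]
      congr 2
      rw [hr1, hr]; field_simp
    rw [e2, mul_comm, hcN]
  have hgF : ∀ p, g p * F p = ((‖G p‖ ^ r * c p.2 : ℝ) : ℂ) := by
    intro p
    by_cases hp : G p = 0
    · simp [hF, hp, Real.zero_rpow (by linarith : r ≠ 0)]
    · rw [hGg p hp]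
      have h1 : G p * (starRingEnd ℂ) (G p) = ((‖G p‖ ^ (2 : ℝ) : ℝ) : ℂ) := by
        rw [Complex.mul_conj, Complex.normSq_eq_norm_sq]; norm_cast
      simp only [hF]
      rw [← mul_assoc, h1, ← Complex.ofReal_mul, ← mul_assoc,
        ← Real.rpow_add (norm_pos_iff.mpr hp)]
      congr 4; ring
  have hint : Integrable (fun p : (ℝ × ℝ) × ℝ => ‖G p‖ ^ r * c p.2) := by
    refine (hG.integrable_rpow volume (by linarith : 0 < r)).mul_bdd (c := M / δ ^ (r - 1))
      (Measurable.aestronglyMeasurable (by fun_prop)) (Filter.Eventually.of_forall fun p => ?_)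
    rw [Real.norm_of_nonneg (hc0 _)]; exact hcM _
  have hval : ∫ p, g p * F p = ((∫ t, N t * h t : ℝ) : ℂ) := by
    simp only [hgF]
    rw [integral_complex_ofReal]
    congr 1
    rw [Measure.volume_eq_prod] at hint ⊢
    rw [integral_prod_symm _ hint]
    refine integral_congr_ae (Filter.Eventually.of_forall fun t => ?_)
    simp only []
    rw [integral_mul_const, hr, integral_norm_rpow_eq_sliceNorm G hθ1 t, ← hr, ← hcN t]
    rcases eq_or_lt_of_le (hN0 t) with h | h
    · have h' : KP.sliceNorm (-θ) G t = 0 := h.symm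
      rw [h', ← h, Real.zero_rpow (by linarith)]; ring
    · have : N t ^ r = N t * N t ^ (r - 1) := by
        nth_rewrite 2 [← Real.rpow_one (N t)]
        rw [← Real.rpow_add h]; congr 1; ring
      change N t ^ r * c t = _
      rw [this]; ring
  have hfin := hdual F hFt fun z t hF => hGT z t (hne _ hF)
  rw [hval, Complex.norm_real, dualNorm] at hfin
  simp only [hslice] at hfin
  exact (Real.le_norm_self _).trans hfin

end

section

variable {θ : ℝ} {G g : (ℝ × ℝ) × ℝ → ℂ}

/-- Endpoint `θ = 0`, with values in `L^∞` in time. Testing with the indicator of `E = {N ≥ A + δ}`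
gives `(A + δ)|E| ≤ A|E|`, and `|E|` is finite, so `E` is null. -/
theorem IsTest.ae_sliceNorm_le (hG : IsTest G) {T A : ℝ} (hA : 0 ≤ A)
    (hGT : ∀ z t, G (z, t) ≠ 0 → |t| ≤ T) (hGg : ∀ p, G p ≠ 0 → g p = G p)
    (hdual : ∀ F : (ℝ × ℝ) × ℝ → ℂ, IsTest F → (∀ z t, F (z, t) ≠ 0 → |t| ≤ T) →
      ‖∫ p, g p * F p‖ ≤ A * dualNorm 0 F) :
    ∀ᵐ t, KP.sliceNorm (-0) G t ≤ A := by
  set N : ℝ → ℝ := KP.sliceNorm (-0) G with hN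
  have hNm : Measurable N := measurable_sliceNorm hG.measurable _
  have hN0 : ∀ t, 0 ≤ N t := sliceNorm_nonneg _ _
  have hNi : Integrable N := by
    simpa only [Real.rpow_one] using
      hG.integrable_sliceNorm_rpow (θ := -0) (by norm_num) one_pos
  have key : ∀ δ : ℝ, 0 < δ → ∀ᵐ t, N t < A + δ := by
    intro δ hδ
    set E : Set ℝ := {t | A + δ ≤ N t} with hE
    have hEm : MeasurableSet E := measurableSet_le measurable_const hNm
    set h : ℝ → ℝ := E.indicator fun _ => 1 with hh
    have hhm : Measurable h := measurable_const.indicator hEm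
    have hh0 : ∀ t, 0 ≤ h t := fun t => indicator_nonneg (fun _ _ => zero_le_one) t
    have hh1 : ∀ t, h t ≤ 1 := fun t => indicator_le_self' (fun _ _ => zero_le_one) t
    have hhE : ∀ t, h t ≠ 0 → A + δ ≤ N t := fun t ht => by
      have : t ∈ E := mem_of_indicator_ne_zero ht
      exact this
    have hle := hG.integral_sliceNorm_mul_le le_rfl one_pos hGT hGg hdual hhm hh0 hh1
      (δ := A + δ) (by linarith) hhE
    rw [← hN] at hle
    simp only [sub_zero, div_self (two_ne_zero' ℝ), Real.rpow_one] at hle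
    have hNhi : Integrable fun t => N t * h t := by
      refine hNi.mul_bdd (c := 1) hhm.aestronglyMeasurable (Filter.Eventually.of_forall fun t => ?_)
      rw [Real.norm_of_nonneg (hh0 t)]; exact hh1 t
    have hpt : ∀ t, (A + δ) * h t ≤ N t * h t := by
      intro t
      by_cases ht : h t = 0
      · rw [ht, mul_zero, mul_zero]
      · exact mul_le_mul_of_nonneg_right (hhE t ht) (hh0 t)
    have hhi : Integrable h := by
      refine (hNhi.const_mul (A + δ)⁻¹).mono' hhm.aestronglyMeasurable
        (Filter.Eventually.of_forall fun t => ?_)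
      rw [Real.norm_of_nonneg (hh0 t), le_inv_mul_iff₀ (by linarith)]
      exact hpt t
    have h2 : (A + δ) * ∫ t, h t ≤ ∫ t, N t * h t := by
      rw [← integral_const_mul]
      exact integral_mono (hhi.const_mul _) hNhi hpt
    have h3 : 0 ≤ ∫ t, h t := integral_nonneg hh0
    have h4 : ∫ t, h t = 0 := by nlinarith
    rw [integral_eq_zero_iff_of_nonneg hh0 hhi] at h4
    filter_upwards [h4] with t ht
    by_contra hlt
    have : t ∈ E := not_lt.mp hlt
    simp [hh, indicator_of_mem this] at ht
  have hall : ∀ᵐ t, ∀ n : ℕ, N t < A + 1 / ((n : ℝ) + 1) :=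
    ae_all_iff.mpr fun n => key _ (by positivity)
  filter_upwards [hall] with t ht
  refine le_of_forall_pos_le_add fun ε hε => ?_
  obtain ⟨n, hn⟩ := exists_nat_one_div_lt hε
  linarith [ht n]

/-- Testing with `h = N^{q-1}` on `{N ≥ δ}`, `q = 2/θ`, gives `Y ≤ A Y^{(2-θ)/2}` for `Y` the
integral of `N^q` over that set. As `Y` is finite, division leaves `Y^{θ/2} ≤ A`; then `δ` tends to
0 by Fatou. -/
theorem IsTest.lintegral_sliceNorm_rpow_le (hG : IsTest G) (hθ0 : 0 < θ) (hθ1 : θ < 1) {T A : ℝ}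
    (hA : 0 ≤ A) (hGT : ∀ z t, G (z, t) ≠ 0 → |t| ≤ T) (hGg : ∀ p, G p ≠ 0 → g p = G p)
    (hdual : ∀ F : (ℝ × ℝ) × ℝ → ℂ, IsTest F → (∀ z t, F (z, t) ≠ 0 → |t| ≤ T) →
      ‖∫ p, g p * F p‖ ≤ A * dualNorm θ F) :
    ∫⁻ t, ENNReal.ofReal (KP.sliceNorm (-θ) G t) ^ (2 / θ) ≤ ENNReal.ofReal A ^ (2 / θ) := by
  have hc2 : 0 < 2 - θ := by linarith
  set q : ℝ := 2 / θ with hq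
  have hq2 : 2 < q := by rw [hq, lt_div_iff₀ hθ0]; linarith
  set N : ℝ → ℝ := KP.sliceNorm (-θ) G with hN
  have hNm : Measurable N := measurable_sliceNorm hG.measurable _
  have hN0 : ∀ t, 0 ≤ N t := sliceNorm_nonneg _ _
  have hNi : Integrable fun t => N t ^ q :=
    hG.integrable_sliceNorm_rpow (θ := -θ) (by linarith) (by linarith)
  obtain ⟨B, hB⟩ := (hG.sliceNorm (θ := -θ) (by linarith)).bounded
  have hNB : ∀ t, N t ≤ B := fun t => by
    have := hB t
    rwa [Complex.norm_real, Real.norm_of_nonneg (sliceNorm_nonneg _ _ _)] at this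
  set f : ℝ → ℝ → ℝ := fun δ => {t | δ ≤ N t}.indicator fun t => N t ^ q with hf
  have hmeas : ∀ δ, MeasurableSet {t | δ ≤ N t} := fun δ => measurableSet_le measurable_const hNm
  have hf0 : ∀ δ t, 0 ≤ f δ t := fun δ t => indicator_nonneg (fun t _ => by have := hN0 t; positivity) t
  have key : ∀ δ : ℝ, 0 < δ → ∫⁻ t, ENNReal.ofReal (f δ t) ≤ ENNReal.ofReal (A ^ q) := by
    intro δ hδ
    set h : ℝ → ℝ := {t | δ ≤ N t}.indicator fun t => N t ^ (q - 1) with hh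
    have hh0 : ∀ t, 0 ≤ h t := fun t => indicator_nonneg (fun t _ => by have := hN0 t; positivity) t
    have hhB : ∀ t, h t ≤ B ^ (q - 1) := by
      intro t
      refine (indicator_le_self' (fun t _ => by have := hN0 t; positivity) t).trans ?_
      exact Real.rpow_le_rpow (hN0 t) (hNB t) (by linarith)
    have hhm : Measurable h := Measurable.indicator (by fun_prop) (hmeas δ)
    have hle := hG.integral_sliceNorm_mul_le hθ0.le hθ1 hGT hGg hdual hhm hh0 hhB hδ
      (fun t ht => by
        have : t ∈ {t | δ ≤ N t} := mem_of_indicator_ne_zero ht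
        exact this)
    have e1 : ∀ t, KP.sliceNorm (-θ) G t * h t = f δ t := by
      intro t
      change N t * h t = f δ t
      by_cases ht : t ∈ {t | δ ≤ N t}
      · have hpos : 0 < N t := hδ.trans_le ht
        simp only [hh, hf, indicator_of_mem ht]
        nth_rewrite 1 [← Real.rpow_one (N t)]
        rw [← Real.rpow_add hpos]; congr 1; ring
      · simp only [hh, hf, indicator_of_notMem ht, mul_zero]
    have e2 : ∀ t, h t ^ (2 / (2 - θ)) = f δ t := by
      intro t
      by_cases ht : t ∈ {t | δ ≤ N t}
      · simp only [hh, hf, indicator_of_mem ht]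
        rw [← Real.rpow_mul (hN0 t)]
        congr 1; rw [hq]; field_simp
      · simp only [hh, hf, indicator_of_notMem ht]
        exact Real.zero_rpow (by positivity)
    simp only [e1, e2] at hle
    set Y := ∫ t, f δ t with hY
    have hY0 : 0 ≤ Y := integral_nonneg (hf0 δ)
    rw [← ofReal_integral_eq_lintegral_ofReal (hNi.indicator (hmeas δ))
      (Filter.Eventually.of_forall (hf0 δ))]
    refine ENNReal.ofReal_le_ofReal ?_
    change Y ≤ _
    rcases eq_or_lt_of_le hY0 with h | h
    · rw [← h]; positivity
    · have h1 : Y = Y ^ (θ / 2) * Y ^ ((2 - θ) / 2) := by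
        rw [← Real.rpow_add h, show θ / 2 + (2 - θ) / 2 = 1 by ring, Real.rpow_one]
      have h2 : Y ^ (θ / 2) ≤ A := by
        nth_rewrite 1 [h1] at hle
        exact le_of_mul_le_mul_right hle (by positivity)
      have h3 := Real.rpow_le_rpow (by positivity) h2 (by linarith : 0 ≤ q)
      rwa [← Real.rpow_mul hY0, hq, show θ / 2 * (2 / θ) = 1 by field_simp, Real.rpow_one] at h3
  have hfm : ∀ δ, Measurable (f δ) := fun δ => Measurable.indicator (by fun_prop) (hmeas δ)
  rw [ENNReal.ofReal_rpow_of_nonneg hA (by linarith)]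
  calc ∫⁻ t, ENNReal.ofReal (N t) ^ q
      ≤ ∫⁻ t, Filter.liminf (fun n : ℕ => ENNReal.ofReal (f (1 / ((n : ℝ) + 1)) t))
          Filter.atTop := by
        refine lintegral_mono fun t => ?_
        rw [ENNReal.ofReal_rpow_of_nonneg (hN0 t) (by linarith)]
        rcases eq_or_lt_of_le (hN0 t) with h | h
        · rw [← h, Real.zero_rpow (by linarith), ENNReal.ofReal_zero]; exact zero_le
        · refine le_of_eq (Filter.Tendsto.liminf_eq ?_).symm
          refine tendsto_const_nhds.congr' ?_
          have h0 : Filter.Tendsto (fun n : ℕ => 1 / ((n : ℝ) + 1)) Filter.atTop (nhds 0) :=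
            tendsto_one_div_add_atTop_nhds_zero_nat
          filter_upwards [h0.eventually_lt_const h] with n hn
          have hmem : t ∈ {t | 1 / ((n : ℝ) + 1) ≤ N t} := hn.le
          simp only [hf, indicator_of_mem hmem]
    _ ≤ Filter.liminf (fun n : ℕ => ∫⁻ t, ENNReal.ofReal (f (1 / ((n : ℝ) + 1)) t))
          Filter.atTop :=
        lintegral_liminf_le fun n => (hfm _).ennreal_ofReal
    _ ≤ _ := by
        refine Filter.liminf_le_of_le (by isBoundedDefault) fun b hb => ?_
        obtain ⟨n, hn⟩ := hb.exists
        exact hn.trans (key _ (by positivity))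

/-- Truncation of a space-time function to a test function supported in `|t| ≤ T`. -/
def truncation (T : ℝ) (g : (ℝ × ℝ) × ℝ → ℂ) (n : ℕ) : (ℝ × ℝ) × ℝ → ℂ :=
  {p | ‖g p‖ ≤ n ∧ ‖p.1‖ ≤ n ∧ |p.2| ≤ T}.indicator g

theorem isTest_truncation (hg : Measurable g) (T : ℝ) (n : ℕ) : IsTest (truncation T g n) := by
  have hm : MeasurableSet {p : (ℝ × ℝ) × ℝ | ‖g p‖ ≤ n ∧ ‖p.1‖ ≤ n ∧ |p.2| ≤ T} := by
    refine (measurableSet_le hg.norm measurable_const).inter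
      ((measurableSet_le measurable_fst.norm measurable_const).inter
        (measurableSet_le measurable_snd.norm measurable_const))
  refine ⟨hg.indicator hm, ⟨n, fun p => ?_⟩, max n T, fun p hp => ?_⟩
  · by_cases hp : p ∈ {p : (ℝ × ℝ) × ℝ | ‖g p‖ ≤ n ∧ ‖p.1‖ ≤ n ∧ |p.2| ≤ T}
    · rw [truncation, indicator_of_mem hp]; exact hp.1
    · rw [truncation, indicator_of_notMem hp, norm_zero]; positivity
  · have hp' : p ∈ {p : (ℝ × ℝ) × ℝ | ‖g p‖ ≤ n ∧ ‖p.1‖ ≤ n ∧ |p.2| ≤ T} :=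
      mem_of_indicator_ne_zero hp
    exact max_le_max hp'.2.1 hp'.2.2

theorem truncation_support {T : ℝ} {n : ℕ} (z : ℝ × ℝ) (t : ℝ)
    (h : truncation T g n (z, t) ≠ 0) : |t| ≤ T := by
  have hp' : (z, t) ∈ {p : (ℝ × ℝ) × ℝ | ‖g p‖ ≤ n ∧ ‖p.1‖ ≤ n ∧ |p.2| ≤ T} :=
    mem_of_indicator_ne_zero h
  exact hp'.2.2

theorem eq_truncation {T : ℝ} {n : ℕ} (p : (ℝ × ℝ) × ℝ) (h : truncation T g n p ≠ 0) :
    g p = truncation T g n p := by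
  have hp' : p ∈ {p : (ℝ × ℝ) × ℝ | ‖g p‖ ≤ n ∧ ‖p.1‖ ≤ n ∧ |p.2| ≤ T} :=
    mem_of_indicator_ne_zero h
  rw [truncation, indicator_of_mem hp']

/-- At each point with `|t| ≤ T` the truncations eventually equal `g`, so Fatou passes the bounds
for test functions to `g`. -/
theorem eLpNorm_slice_le_liminf (hg : Measurable g) (hθ1 : θ < 1) {T t : ℝ} (ht : |t| ≤ T) :
    eLpNorm (fun z => g (z, t)) (ENNReal.ofReal (2 / (1 - θ))) volume ≤
      Filter.liminf (fun n : ℕ => ENNReal.ofReal (sliceNorm (-θ) (truncation T g n) t))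
        Filter.atTop := by
  simp only [← fun n => (isTest_truncation hg T n).eLpNorm_slice hθ1 t]
  refine Lp.eLpNorm_lim_le_liminf_eLpNorm
    (fun n => ((isTest_truncation hg T n).slice t).measurable.aestronglyMeasurable) _
    (Filter.Eventually.of_forall fun z => ?_)
  refine tendsto_const_nhds.congr' ?_
  obtain ⟨n₁, hn₁⟩ := exists_nat_ge ‖g (z, t)‖
  obtain ⟨n₂, hn₂⟩ := exists_nat_ge ‖z‖
  filter_upwards [Filter.eventually_ge_atTop (max n₁ n₂)] with n hn
  have hmem : (z, t) ∈ {p : (ℝ × ℝ) × ℝ | ‖g p‖ ≤ n ∧ ‖p.1‖ ≤ n ∧ |p.2| ≤ T} :=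
    ⟨hn₁.trans (by exact_mod_cast (le_max_left _ _).trans hn),
      hn₂.trans (by exact_mod_cast (le_max_right _ _).trans hn), ht⟩
  rw [truncation, indicator_of_mem hmem]

theorem eLpNorm_mixed_le_top (hg : Measurable g) {T A : ℝ} (hA : 0 ≤ A)
    (hdual : ∀ F : (ℝ × ℝ) × ℝ → ℂ, IsTest F → (∀ z t, F (z, t) ≠ 0 → |t| ≤ T) →
      ‖∫ p, g p * F p‖ ≤ A * dualNorm 0 F) :
    eLpNorm (fun t : ℝ => eLpNorm (fun z : ℝ × ℝ => g (z, t)) 2 volume) ∞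
      (volume.restrict (Icc (-T) T)) ≤ ENNReal.ofReal A := by
  rw [eLpNorm_exponent_top]
  refine essSup_le_of_ae_le _ ?_
  have hall : ∀ᵐ t, ∀ n : ℕ, sliceNorm (-0) (truncation T g n) t ≤ A :=
    ae_all_iff.mpr fun n => (isTest_truncation hg T n).ae_sliceNorm_le hA truncation_support
      eq_truncation hdual
  filter_upwards [ae_restrict_of_ae hall, ae_restrict_mem measurableSet_Icc] with t ht htT
  have h1 := eLpNorm_slice_le_liminf hg one_pos (abs_le.mpr htT)
  rw [sub_zero, div_one, ENNReal.ofReal_ofNat] at h1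
  rw [enorm_eq_self]
  refine h1.trans (Filter.liminf_le_of_le (by isBoundedDefault) fun b hb => ?_)
  obtain ⟨n, hn⟩ := hb.exists
  exact hn.trans (ENNReal.ofReal_le_ofReal (ht n))

theorem eLpNorm_mixed_le (hg : Measurable g) (hθ0 : 0 < θ) (hθ1 : θ < 1) {T A : ℝ} (hA : 0 ≤ A)
    (hdual : ∀ F : (ℝ × ℝ) × ℝ → ℂ, IsTest F → (∀ z t, F (z, t) ≠ 0 → |t| ≤ T) →
      ‖∫ p, g p * F p‖ ≤ A * dualNorm θ F) :
    eLpNorm (fun t : ℝ => eLpNorm (fun z : ℝ × ℝ => g (z, t)) (ENNReal.ofReal (2 / (1 - θ))) volume)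
      (ENNReal.ofReal (2 / θ)) (volume.restrict (Icc (-T) T)) ≤ ENNReal.ofReal A := by
  have hq : 0 < 2 / θ := by positivity
  rw [eLpNorm_eq_lintegral_rpow_enorm_toReal (by simpa using hθ0) ENNReal.ofReal_ne_top,
    ENNReal.toReal_ofReal hq.le, one_div, ENNReal.rpow_inv_le_iff hq]
  simp only [enorm_eq_self]
  set N : ℕ → ℝ → ℝ := fun n => sliceNorm (-θ) (truncation T g n) with hN
  have hNm : ∀ n, Measurable (N n) := fun n =>
    measurable_sliceNorm (isTest_truncation hg T n).measurable _
  calc ∫⁻ t in Icc (-T) T,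
        eLpNorm (fun z : ℝ × ℝ => g (z, t)) (ENNReal.ofReal (2 / (1 - θ))) volume ^ (2 / θ)
      ≤ ∫⁻ t in Icc (-T) T, Filter.liminf (fun n => ENNReal.ofReal (N n t) ^ (2 / θ))
          Filter.atTop := by
        refine setLIntegral_mono' measurableSet_Icc fun t ht => ?_
        have h1 := eLpNorm_slice_le_liminf hg hθ1 (abs_le.mpr ht)
        refine (ENNReal.rpow_le_rpow h1 hq.le).trans (le_of_eq ?_)
        exact (ENNReal.orderIsoRpow (2 / θ) hq).liminf_apply
    _ ≤ ∫⁻ t, Filter.liminf (fun n => ENNReal.ofReal (N n t) ^ (2 / θ)) Filter.atTop :=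
        setLIntegral_le_lintegral _ _
    _ ≤ Filter.liminf (fun n => ∫⁻ t, ENNReal.ofReal (N n t) ^ (2 / θ)) Filter.atTop :=
        lintegral_liminf_le fun n => (hNm n).ennreal_ofReal.pow_const _
    _ ≤ _ := by
        refine Filter.liminf_le_of_le (by isBoundedDefault) fun b hb => ?_
        obtain ⟨n, hn⟩ := hb.exists
        exact hn.trans ((isTest_truncation hg T n).lintegral_sliceNorm_rpow_le hθ0 hθ1 hA
          truncation_support eq_truncation hdual)

end

/-! ### Application to the dyadic pieces. -/

theorem exists_restrictionBound_tube (α : ℝ) {θ : ℝ} (hθ0 : 0 ≤ θ) (hθ1 : θ < 1) :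
    ∃ C : ℝ, 0 < C ∧ ∀ L : ℝ, 0 ≤ L →
      RestrictionBound θ √(C * L) (tube α L) fun q => |q.1.1| ^ (θ / 2) := by
  obtain ⟨C, hC, h⟩ := exists_tube_estimate α hθ0 hθ1
  refine ⟨C, hC, fun L hL F hF hsupp => ?_⟩
  rw [mul_pow, Real.sq_sqrt (by positivity)]
  refine le_trans (le_of_eq (lintegral_congr fun q => ?_)) (h L F hL hF hsupp)
  congr 1
  rw [mul_pow, ← Real.rpow_natCast, ← Real.rpow_mul (abs_nonneg _)]
  congr 2; push_cast; ring

/-- For positive index the wider of the two bumps has support `|x| ≤ 2^{j+1}`, so the piece lives in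
the tube of width `2^{j+1}`. -/
theorem dyadicCutoff_eq_zero {η : ℝ → ℝ} (hη : IsBump η) (j : ℕ) {x : ℝ}
    (hx : 2 ^ (j + 1) < |x|) : dyadicCutoff η j x = 0 := by
  have hz : ∀ y : ℝ, 2 < |y| → η y = 0 := by
    intro y hy
    refine image_eq_zero_of_notMem_tsupport fun hmem => ?_
    exact absurd (abs_le.mpr (hη.tsupport_subset hmem)) (not_le.mpr hy)
  cases j with
  | zero => exact hz x (by simpa using hx)
  | succ j =>
    have h2 : (0 : ℝ) < 2 ^ j := by positivity
    rw [pow_succ, pow_succ] at hx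
    simp only [dyadicCutoff]
    rw [hz, hz, sub_zero]
    · rw [abs_div, abs_of_pos h2, lt_div_iff₀ h2]; linarith
    · rw [abs_div, abs_of_pos (by positivity : (0 : ℝ) < 2 ^ (j + 1)),
        lt_div_iff₀ (by positivity), pow_succ]; linarith

theorem fourier_dyadicPiece_ae (α : ℝ) {η : ℝ → ℝ} (hη : IsBump η) (j : ℕ) (f : L2) :
    (𝓕 (dyadicPiece α hη j f) : L2) =ᵐ[volume] pieceFourier α η j f := by
  rw [dyadicPiece, fourier_fourierInv_eq]
  exact MemLp.coeFn_toLp _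

/-- The coordinates `((x, y), t)` of a point of `ℝ³`. -/
def coord (p : E3) : (ℝ × ℝ) × ℝ := ((p 0, p 1), p 2)

/-- The point of `ℝ³` with given coordinates. -/
def uncoord (q : (ℝ × ℝ) × ℝ) : E3 := !₂[q.1.1, q.1.2, q.2]

theorem coord_uncoord (q : (ℝ × ℝ) × ℝ) : coord (uncoord q) = q := by
  simp [coord, uncoord]

theorem uncoord_coord (p : E3) : uncoord (coord p) = p := by
  ext i; fin_cases i <;> simp [coord, uncoord]

theorem continuous_coord : Continuous coord := by unfold coord; fun_prop

theorem continuous_uncoord : Continuous uncoord := by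
  unfold uncoord
  refine (PiLp.continuous_toLp 2 _).comp (continuous_pi fun i => ?_)
  fin_cases i <;> simp <;> fun_prop

/-- Coordinates as a measurable equivalence. -/
def coordEquiv : E3 ≃ᵐ (ℝ × ℝ) × ℝ where
  toFun := coord
  invFun := uncoord
  left_inv := uncoord_coord
  right_inv := coord_uncoord
  measurable_toFun := continuous_coord.measurable
  measurable_invFun := continuous_uncoord.measurable

theorem measurePreserving_coord : MeasurePreserving coord volume volume := by
  have h1 := EuclideanSpace.volume_preserving_symm_measurableEquiv_toLp (Fin 3)
  have h2 := volume_preserving_piFinSuccAbove (fun _ : Fin 3 => ℝ) 2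
  have h3 : MeasurePreserving (Prod.swap : ℝ × (Fin 2 → ℝ) → (Fin 2 → ℝ) × ℝ) volume volume :=
    Measure.measurePreserving_swap
  have h4 : MeasurePreserving (Prod.map (MeasurableEquiv.finTwoArrow (α := ℝ)) (id : ℝ → ℝ))
      volume volume := (volume_preserving_finTwoArrow ℝ).prod (MeasurePreserving.id volume)
  have h := h4.comp (h3.comp (h2.comp h1))
  exact h

theorem integral_comp_coord {E : Type*} [NormedAddCommGroup E] [NormedSpace ℝ E]
    (H : (ℝ × ℝ) × ℝ → E) : ∫ p, H (coord p) = ∫ q, H q :=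
  measurePreserving_coord.integral_comp coordEquiv.measurableEmbedding H

theorem integral_comp_two_pi_coord {E : Type*} [NormedAddCommGroup E] [NormedSpace ℝ E]
    (H : (ℝ × ℝ) × ℝ → E) :
    ∫ p, H ((2 * Real.pi) • coord p) = ((2 * Real.pi) ^ 3)⁻¹ • ∫ q, H q := by
  have : (volume : Measure ((ℝ × ℝ) × ℝ)).IsAddHaarMeasure := by
    rw [Measure.volume_eq_prod]; infer_instance
  rw [integral_comp_coord fun q => H ((2 * Real.pi) • q), Measure.integral_comp_smul]
  congr 1
  rw [show Module.finrank ℝ ((ℝ × ℝ) × ℝ) = 3 by simp]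
  exact abs_of_pos (by positivity)

/-- The inverse transform has the kernel `exp(2πi⟨x, ζ⟩)`, so its frequencies agree with the angular
ones after scaling by `2π`. -/
theorem spaceTimeFourier_uncoord (φ : 𝓢(E3, ℂ)) (ζ : E3) :
    spaceTimeFourier (fun q => φ (uncoord q)) ((2 * Real.pi) • coord ζ) =
      (𝓕⁻ φ : 𝓢(E3, ℂ)) ζ := by
  rw [SchwartzMap.fourierInv_coe, Real.fourierInv_eq', spaceTimeFourier, ← integral_comp_coord]
  refine integral_congr_ae (Filter.Eventually.of_forall fun p => ?_)
  simp only [uncoord_coord, smul_eq_mul]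
  congr 2
  rw [mul_comm]
  congr 2
  simp [coord, dot, PiLp.inner_apply, Fin.sum_univ_three]
  ring

theorem norm_sq_eq_integral (u : L2) : ‖u‖ ^ 2 = ∫ x, ‖u x‖ ^ 2 := by
  have h0 : 0 ≤ ∫ x, ‖u x‖ ^ 2 := integral_nonneg fun _ => sq_nonneg _
  rw [Lp.norm_def, (Lp.memLp u).eLpNorm_eq_integral_rpow_norm (by norm_num) (by norm_num)]
  simp only [ENNReal.toReal_ofNat, Real.rpow_ofNat]
  rw [ENNReal.toReal_ofReal (by positivity), ← Real.rpow_natCast, ← Real.rpow_mul h0]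
  norm_num

theorem isTest_uncoord (φ : 𝓢(E3, ℂ)) (hφ : HasCompactSupport φ) :
    IsTest fun q => φ (uncoord q) := by
  refine ⟨(φ.continuous.comp continuous_uncoord).measurable, ?_, ?_⟩
  · obtain ⟨M, hM⟩ := φ.continuous.bounded_above_of_compact_support hφ
    exact ⟨M, fun q => hM _⟩
  · obtain ⟨R, hR⟩ := ((hφ.isCompact.image continuous_coord).isBounded).exists_norm_le
    refine ⟨R, fun q hq => hR q ⟨uncoord q, subset_tsupport _ hq, coord_uncoord q⟩⟩

/-- Testing against the indicator of a unit ball cut to `|t| ≤ 1` gives integrability near each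
point. -/
theorem locallyIntegrableOn_slab {g : (ℝ × ℝ) × ℝ → ℂ} {T : ℝ} (hT : T ≤ 1)
    (hg : ∀ F : (ℝ × ℝ) × ℝ → ℂ, IsTest F → (∀ z t, F (z, t) ≠ 0 → |t| ≤ 1) →
      Integrable fun p => g p * F p) :
    LocallyIntegrableOn (fun p => g (coord p)) (slab T) volume := by
  intro x hx
  set U : Set ((ℝ × ℝ) × ℝ) := Metric.ball (coord x) 1 ∩ {q | |q.2| ≤ 1} with hU
  have hUm : MeasurableSet U := Metric.isOpen_ball.measurableSet.inter
    (measurableSet_le measurable_snd.norm measurable_const)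
  have hF : IsTest (U.indicator fun _ => (1 : ℂ)) := by
    refine ⟨measurable_const.indicator hUm, ⟨1, fun q => ?_⟩, ‖coord x‖ + 1, fun q hq => ?_⟩
    · refine (norm_indicator_le_norm_self _ _).trans (by simp)
    · have hq' : q ∈ U := mem_of_indicator_ne_zero hq
      have h1 : ‖q - coord x‖ < 1 := mem_ball_iff_norm.mp hq'.1
      have h2 := norm_le_norm_add_norm_sub' q (coord x)
      linarith
  have hi := hg _ hF fun z t h => by
    have hq' : (z, t) ∈ U := mem_of_indicator_ne_zero h
    exact hq'.2
  have hi' : IntegrableOn (fun p => g (coord p)) (coord ⁻¹' U) volume := by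
    refine (measurePreserving_coord.integrableOn_comp_preimage
      coordEquiv.measurableEmbedding (f := g)).mpr ?_
    rw [← integrable_indicator_iff hUm]
    refine hi.congr (Filter.Eventually.of_forall fun q => ?_)
    by_cases hq : q ∈ U
    · simp only [indicator_of_mem hq, mul_one]
    · simp only [indicator_of_notMem hq, mul_zero]
  refine ⟨coord ⁻¹' Metric.ball (coord x) 1 ∩ slab T, ?_, hi'.mono_set fun p hp => ?_⟩
  · refine Filter.inter_mem (mem_nhdsWithin_of_mem_nhds ?_) self_mem_nhdsWithin
    exact continuous_coord.continuousAt.preimage_mem_nhds (Metric.ball_mem_nhds _ one_pos)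
  · refine ⟨hp.1, ?_⟩
    have h2 : p 2 ∈ Ioo (-T) T := hp.2
    have h3 : |p 2| ≤ 1 := abs_le.mpr ⟨by linarith [h2.1], by linarith [h2.2]⟩
    exact h3

/-- The bound for `|-i∂ₓ|^{θ/2} f_j`, in dual form. -/
theorem exists_dual_estimate (α : ℝ) {η : ℝ → ℝ} (hη : IsBump η) {θ : ℝ} (hθ0 : 0 ≤ θ)
    (hθ1 : θ < 1) :
    ∃ C : ℝ, 0 < C ∧ ∀ (j : ℕ) (f : L2), ∃ g : (ℝ × ℝ) × ℝ → ℂ, Measurable g ∧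
      (∀ T : ℝ, T ≤ 1 → IsAbsDxPow (θ / 2) T (dyadicPiece α hη j f) fun p => g (coord p)) ∧
      ∀ F : (ℝ × ℝ) × ℝ → ℂ, IsTest F → (∀ z t, F (z, t) ≠ 0 → |t| ≤ 1) →
        ‖∫ p, g p * F p‖ ≤
          C * (2 : ℝ) ^ ((j : ℝ) / 2) * ‖dyadicPiece α hη j f‖ * dualNorm θ F := by
  obtain ⟨C, hC, hB⟩ := exists_restrictionBound_tube α hθ0 hθ1
  have hπ : 0 < 2 * Real.pi := by positivity
  set c : ℝ := ((2 * Real.pi) ^ 3)⁻¹ with hc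
  have hc0 : 0 < c := by positivity
  -- The factor `√(2C)` comes from the tube width `2 · 2^j`, `√c⁻¹` from the `L²` norm of `a` in
  -- angular frequencies, and `c = (2π)^{-3}` from the change of variables in the pairing.
  refine ⟨c * (√(2 * C) * √c⁻¹), by positivity, fun j f => ?_⟩
  set u := dyadicPiece α hη j f with hu
  set v : L2 := 𝓕 u with hv
  have hL : (0 : ℝ) ≤ 2 ^ (j + 1) := by positivity
  set Ω := tube α (2 ^ (j + 1)) with hΩ
  have hΩm : MeasurableSet Ω := measurableSet_tube α _
  set a : (ℝ × ℝ) × ℝ → ℂ :=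
    Ω.indicator fun q => v (uncoord ((2 * Real.pi)⁻¹ • q)) with ha
  have ham : Measurable a :=
    (((Lp.stronglyMeasurable v).measurable.comp continuous_uncoord.measurable).comp
      (measurable_const_smul _)).indicator hΩm
  -- Outside the tube the cut-off vanishes, so restricting the representative of the Fourier
  -- transform to `Ω` changes it only on a null set, yet makes it vanish everywhere off `Ω`.
  have hav : ∀ᵐ ζ : E3, a ((2 * Real.pi) • coord ζ) = v ζ := by
    filter_upwards [fourier_dyadicPiece_ae α hη j f] with ζ hζ
    by_cases h : (2 * Real.pi) • coord ζ ∈ Ω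
    · rw [ha, indicator_of_mem h, smul_smul, inv_mul_cancel₀ hπ.ne', one_smul, uncoord_coord]
    · rw [ha, indicator_of_notMem h]
      refine Eq.symm (hζ.trans ?_)
      rw [pieceFourier, modulationCutoff, dyadicCutoff_eq_zero hη j, Complex.ofReal_zero, zero_mul]
      exact not_le.mp h
  have hva : Integrable fun ζ : E3 => ‖a ((2 * Real.pi) • coord ζ)‖ ^ 2 := by
    have h1 := (Lp.memLp v).integrable_norm_pow (by norm_num)
    refine Integrable.congr (by simpa using h1) ?_
    filter_upwards [hav] with ζ hζ
    rw [hζ]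
  have : (volume : Measure ((ℝ × ℝ) × ℝ)).IsAddHaarMeasure := by
    rw [Measure.volume_eq_prod]; infer_instance
  have ha2 : Integrable fun q => ‖a q‖ ^ 2 := by
    have h1 : Integrable ((fun q => ‖a ((2 * Real.pi) • q)‖ ^ 2) ∘ coord) volume := hva
    rw [measurePreserving_coord.integrable_comp_emb coordEquiv.measurableEmbedding] at h1
    exact (integrable_comp_smul_iff volume (fun q => ‖a q‖ ^ 2) hπ.ne').mp h1
  have hanorm : ∫ q, ‖a q‖ ^ 2 = c⁻¹ * ‖u‖ ^ 2 := by
    have h1 := integral_comp_two_pi_coord fun q => ‖a q‖ ^ 2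
    have h2 : ∫ ζ : E3, ‖a ((2 * Real.pi) • coord ζ)‖ ^ 2 = ‖u‖ ^ 2 := by
      rw [← Lp.norm_fourier_eq u, norm_sq_eq_integral]
      refine integral_congr_ae ?_
      filter_upwards [hav] with ζ hζ
      rw [hζ]
    rw [h2, ← hc, smul_eq_mul] at h1
    rw [h1, inv_mul_cancel_left₀ hc0.ne']
  obtain ⟨g, hgm, hg⟩ := (hB _ hL).exists_function (a := a) (Real.sqrt_nonneg _) hΩm
    (by fun_prop) (fun q => by positivity)
    (fun R => ⟨R ^ (θ / 2), fun q hq => Real.rpow_le_rpow (abs_nonneg _)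
      (((norm_fst_le q.1).trans (norm_fst_le q)).trans hq) (by positivity)⟩)
    ham ha2 (fun q hq => indicator_of_notMem hq _)
  refine ⟨fun q => c * g q, hgm.const_mul _, fun T hT => ⟨?_, fun φ hφ hsupp => ?_⟩,
    fun F hF hsupp => ?_⟩
  · refine locallyIntegrableOn_slab (g := fun q => c * g q) hT fun F hF hsupp => ?_
    simpa only [mul_assoc] using (hg F hF hsupp).1.const_mul (c : ℂ)
  · have hΦ := isTest_uncoord φ hφ
    have hΦs : ∀ z t, φ (uncoord (z, t)) ≠ 0 → |t| ≤ 1 := by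
      intro z t h
      have h1 : uncoord (z, t) ∈ slab T := hsupp (subset_tsupport _ h)
      have h2 : t ∈ Ioo (-T) T := by simpa [slab, uncoord] using h1
      exact abs_le.mpr ⟨by linarith [h2.1], by linarith [h2.2]⟩
    have h1 := integral_comp_coord fun q => (c * g q) * φ (uncoord q)
    simp only [uncoord_coord] at h1
    rw [h1]
    simp only [mul_assoc]
    rw [integral_const_mul, (hg _ hΦ hΦs).2.1]
    have h2 := integral_comp_two_pi_coord fun q : (ℝ × ℝ) × ℝ => ((|q.1.1| ^ (θ / 2) : ℝ) : ℂ) *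
      a q * spaceTimeFourier (fun q => φ (uncoord q)) q
    rw [← hc, Complex.real_smul] at h2
    rw [← h2]
    refine integral_congr_ae ?_
    filter_upwards [hav] with ζ hζ
    rw [hζ, spaceTimeFourier_uncoord, mul_assoc, ← mul_assoc 2 Real.pi]
    rfl
  · simp only [mul_assoc]
    rw [integral_const_mul, norm_mul, Complex.norm_real, Real.norm_of_nonneg hc0.le]
    refine mul_le_mul_of_nonneg_left (((hg F hF hsupp).2.2).trans (le_of_eq ?_)) hc0.le
    rw [hanorm, Real.sqrt_mul (inv_nonneg.mpr hc0.le), Real.sqrt_sq (norm_nonneg _)]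
    have h2 : √(C * 2 ^ (j + 1)) = √(2 * C) * (2 : ℝ) ^ ((j : ℝ) / 2) := by
      rw [show C * 2 ^ (j + 1) = (2 * C) * 2 ^ j by ring, Real.sqrt_mul (by positivity)]
      congr 1
      rw [Real.sqrt_eq_rpow, ← Real.rpow_natCast, ← Real.rpow_mul (by norm_num)]
      congr 1; ring
    rw [h2]; ring

theorem mixedNorm_comp_coord (q r : ℝ≥0∞) (T : ℝ) (g : (ℝ × ℝ) × ℝ → ℂ) :
    mixedNorm q r T (fun p => g (coord p)) =
      eLpNorm (fun t : ℝ => eLpNorm (fun z : ℝ × ℝ => g (z, t)) r volume) q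
        (volume.restrict (Icc (-T) T)) := by
  have : ∀ (z : ℝ × ℝ) (t : ℝ), coord !₂[z.1, z.2, t] = (z, t) := fun z t =>
    coord_uncoord (z, t)
  simp only [mixedNorm, this]

/-- The choice `θ = 1 - 2/r` gives `θ/2 = 1/2 - 1/r`, `2/(1-θ) = r` and `2/θ = 2r/(r-2)`. The time
`T < 1` only restricts the class of test functions, so the constant does not depend on it. -/
theorem exists_strichartz_estimate (α : ℝ) {η : ℝ → ℝ} (hη : IsBump η) {r : ℝ} (hr : 2 ≤ r) :
    ∃ C : ℝ, 0 < C ∧ ∀ T : ℝ, 0 < T → T < 1 → ∀ (j : ℕ) (f : L2), ∃ g : E3 → ℂ,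
      IsAbsDxPow (1 / 2 - 1 / r) T (dyadicPiece α hη j f) g ∧
      mixedNorm (timeExponent r) (ENNReal.ofReal r) T g ≤
        ENNReal.ofReal (C * (2 : ℝ) ^ ((j : ℝ) / 2) * ‖dyadicPiece α hη j f‖) := by
  have hr0 : 0 < r := by linarith
  set θ : ℝ := 1 - 2 / r with hθ
  have hθ0 : 0 ≤ θ := by
    have : 2 / r ≤ 1 := (div_le_one hr0).mpr hr
    linarith
  have hθ1 : θ < 1 := by
    have : 0 < 2 / r := by positivity
    linarith
  obtain ⟨C, hC, h⟩ := exists_dual_estimate α hη hθ0 hθ1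
  refine ⟨C, hC, fun T hT0 hT1 j f => ?_⟩
  obtain ⟨g, hgm, hgD, hgF⟩ := h j f
  refine ⟨fun p => g (coord p), ?_, ?_⟩
  · rw [show 1 / 2 - 1 / r = θ / 2 by rw [hθ]; field_simp]
    exact hgD T hT1.le
  · rw [mixedNorm_comp_coord]
    have hF : ∀ F : (ℝ × ℝ) × ℝ → ℂ, IsTest F → (∀ z t, F (z, t) ≠ 0 → |t| ≤ T) → _ :=
      fun F hF hs => hgF F hF fun z t h => (hs z t h).trans hT1.le
    rcases eq_or_lt_of_le hr with h2 | h2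
    · have h0 : θ = 0 := by rw [hθ, ← h2]; norm_num
      rw [h0] at hF
      have hq : timeExponent r = ⊤ := by
        rw [timeExponent, ← h2, sub_self, ENNReal.ofReal_zero, ENNReal.div_zero]
        simp
      rw [hq, ← h2, ENNReal.ofReal_ofNat]
      exact eLpNorm_mixed_le_top hgm (by positivity) hF
    · have hr2 : 0 < r - 2 := by linarith
      have h0 : 0 < θ := by
        rw [hθ, sub_pos, div_lt_one hr0]; exact h2
      have hq : timeExponent r = ENNReal.ofReal (2 / θ) := by
        rw [timeExponent, ← ENNReal.ofReal_div_of_pos hr2, hθ]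
        congr 1
        have : 1 - 2 / r ≠ 0 := by rw [← hθ]; exact h0.ne'
        field_simp
      have hrθ : r = 2 / (1 - θ) := by rw [hθ]; field_simp; ring
      rw [hq, hrθ]
      exact eLpNorm_mixed_le hgm h0 hθ1 (by positivity) hF

end KP

end

theorem proposition2p3 (α : ℝ) (η : ℝ → ℝ) (hη : KP.IsBump η) :
    (∀ r : ℝ, 2 ≤ r → ∃ C : ℝ, 0 < C ∧
      ∀ T : ℝ, 0 < T → T < 1 → ∀ (j : ℕ) (f : KP.L2),
        ∃ g : KP.E3 → ℂ,
          KP.IsAbsDxPow (1 / 2 - 1 / r) T (KP.dyadicPiece α hη j f) g ∧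
          KP.mixedNorm (KP.timeExponent r) (ENNReal.ofReal r) T g ≤
            ENNReal.ofReal (C * (2 : ℝ) ^ ((j : ℝ) / 2) * ‖KP.dyadicPiece α hη j f‖)) ∧
    (∃ C : ℝ, 0 < C ∧
      ∀ T : ℝ, 0 < T → T < 1 → ∀ (j : ℕ) (f : KP.L2),
        ∃ g : KP.E3 → ℂ,
          KP.IsAbsDxPow (1 / 4) T (KP.dyadicPiece α hη j f) g ∧
          KP.mixedNorm 4 4 T g ≤
            ENNReal.ofReal (C * (2 : ℝ) ^ ((j : ℝ) / 2) * ‖KP.dyadicPiece α hη j f‖)) := by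
  refine ⟨fun r hr => KP.exists_strichartz_estimate α hη hr, ?_⟩
  have h := KP.exists_strichartz_estimate α hη (r := 4) (by norm_num)
  have hq : KP.timeExponent 4 = 4 := by
    rw [KP.timeExponent, ← ENNReal.ofReal_div_of_pos (by norm_num)]
    norm_num
  rwa [hq, ENNReal.ofReal_ofNat, show (1 / 2 - 1 / 4 : ℝ) = 1 / 4 by norm_num] at h
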